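/- For Boolean matrices $A\in\{0,1\}^{d_1\times d_3}$ and $B\in\{0,1\}^{d_3\times d_2}$ with $d_1,d_2,d_3\ge 1$, let $C=AB$ be the Boolean product, $C_{ij}=\bigvee_k A_{ik}B_{kj}$, and let $\psi_1=d_1+d_2+d_3$, $\psi_2=d_1d_2+d_1d_3+d_2d_3$, $\psi_3=d_1d_2d_3$. Algorithm 1, with parameter $s\ge 0$ and base case $b\ge 1$. Put $m=2^sb$ and identify $[m]$ with $\{0,1\}^s\times[b]$, so that $x\in[m]$ is a pair $(x',x'')$. Draw functions $f_i:[m]\to[d_i]$ ($i=1,2,3$) and a matrix $D\in\{0,1\}^{m\times m}$ uniformly at random and independently. Over $GF(2)$ let $\bar A_{xz}=A_{f_1(x)f_3(z)}$ and $\bar B_{zy}=B_{f_3(z)f_2(y)}D_{zy}$, and let $$\bar C_{xy}=\sum_{z\in[m]:\ x'\vee y'\vee z'=\vec 1}\bar A_{xz}\bar B_{zy}$$ be their pseudo-product, where $\vec 1$ is the all-ones vector of length $s$. Return $\tilde C$ with $\tilde C_{ij}=\bigvee_{x\in f_1^{-1}(i),\,y\in f_2^{-1}(j)}\bar C_{xy}$.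 Machine model. Running time is counted on a randomized random access machine with integer registers, integer arrays and bit arrays. Each of the following costs one step: an integer operation ($+$, truncated $-$, $\times$, integer division, remainder), loading a constant or an array entry, a store, a Boolean operation on two stored bits, drawing a uniform integer below a given integer, drawing a fair bit, a test, the start of a loop and each pass through it. Every matrix entry is stored as a separate bit, integers never depend on bits, and loops are counted loops. Theorem. Fix an integer $b\ge1$ and a real $c>0$. There are a choice of parameter $s=s(d_1,d_2,d_3)$, a single program $P$ for this machine, and constants $K,\kappa$ such that for all $d_1,d_2,d_3\ge 1$ with $$\psi_3^{0.345}\ge\psi_1\qquad\text{and}\qquad\psi_3^{0.681}\ge\psi_2$$ and all Boolean matrices $A$ ($d_1\times d_3$) and $B$ ($d_3\times d_2$) the following hold. 1. Algorithm 1 with parameters $s$ and $b$ returns $\tilde C=AB$ with probability at least $1-\psi_3^{-c}$. 2. The program $P$, given only $d_1,d_2,d_3,A,B$, carries out Algorithm 1: its output has the same distribution as $\tilde C$. 3. In every run, $P$ makes at most $K(\psi_3\log\psi_3)^{\frac{\log 6}{\log 7}}$ steps and writes only integers of size at most $\psi_3^{\kappa}$, that is, of $O(\log\psi_3)$ bits.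 -/

import Mathlib

namespace BMM

/-! ### Boolean matrix multiplication and the randomized algorithm -/

/-- The Boolean product `C i j = ⋁ k, A i k ∧ B k j`. -/
def boolMul {d₁ d₂ d₃ : ℕ} (A : Matrix (Fin d₁) (Fin d₃) Bool) (B : Matrix (Fin d₃) (Fin d₂) Bool) :
    Matrix (Fin d₁) (Fin d₂) Bool :=
  fun i j => decide (∃ k, A i k = true ∧ B k j = true)

/-- The index set `[m]` with `m = 2 ^ s * b`: an index is a pair of a bit vector of length `s` and
an element of `[b]`. -/
abbrev Index (s b : ℕ) : Type := (Fin s → Bool) × Fin b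

instance (s b : ℕ) : Fintype (Index s b) := inferInstance

/-- The pseudo-product `A ⊗ B` with base case `b`: only those `z` contribute to entry `(x, y)` for
which the disjunction of the bit vectors of `x`, `y` and `z` is the all-ones vector. -/
def pseudoProduct {s b : ℕ} {R : Type*} [NonUnitalNonAssocSemiring R]
    (A B : Matrix (Index s b) (Index s b) R) : Matrix (Index s b) (Index s b) R :=
  fun x y => ∑ z : Index s b with x.1 ⊔ y.1 ⊔ z.1 = fun _ => true, A x z * B z y

/-- A Boolean value as an element of `GF(2)`. -/
def toGF2 (v : Bool) : ZMod 2 := if v then 1 else 0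

/-- The random choices of the algorithm: functions `f₁ : [m] → [d₁]`, `f₂ : [m] → [d₂]`,
`f₃ : [m] → [d₃]` and a binary `m × m` matrix `D`. -/
abbrev Coins (d₁ d₂ d₃ s b : ℕ) : Type :=
  (Index s b → Fin d₁) × (Index s b → Fin d₂) × (Index s b → Fin d₃) ×
    (Index s b → Index s b → Bool)

/-- The matrix over `GF(2)` with entries `A (f₁ x) (f₃ z)`. -/
def Abar {d₁ d₂ d₃ s b : ℕ} (A : Matrix (Fin d₁) (Fin d₃) Bool) (ω : Coins d₁ d₂ d₃ s b) :
    Matrix (Index s b) (Index s b) (ZMod 2) :=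
  fun x z => toGF2 (A (ω.1 x) (ω.2.2.1 z))

/-- The matrix over `GF(2)` with entries `B (f₃ z) (f₂ y) * D z y`. -/
def Bbar {d₁ d₂ d₃ s b : ℕ} (B : Matrix (Fin d₃) (Fin d₂) Bool) (ω : Coins d₁ d₂ d₃ s b) :
    Matrix (Index s b) (Index s b) (ZMod 2) :=
  fun z y => toGF2 (B (ω.2.2.1 z) (ω.2.1 y)) * toGF2 (ω.2.2.2 z y)

open Classical in
/-- The matrix returned by the algorithm for given random choices. -/
noncomputable def estimate {d₁ d₂ d₃ s b : ℕ} (A : Matrix (Fin d₁) (Fin d₃) Bool)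
    (B : Matrix (Fin d₃) (Fin d₂) Bool) (ω : Coins d₁ d₂ d₃ s b) :
    Matrix (Fin d₁) (Fin d₂) Bool :=
  fun i j => decide (∃ x y : Index s b,
    ω.1 x = i ∧ ω.2.1 y = j ∧ pseudoProduct (Abar A ω) (Bbar B ω) x y = 1)

/-- The law of the matrix returned by the algorithm with parameter `s` and base case `b`, all
random choices being uniform and independent. -/
noncomputable def algorithmLaw {d₁ d₂ d₃ : ℕ} [NeZero d₁] [NeZero d₂] [NeZero d₃] (s b : ℕ)
    (A : Matrix (Fin d₁) (Fin d₃) Bool) (B : Matrix (Fin d₃) (Fin d₂) Bool) :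
    PMF (Matrix (Fin d₁) (Fin d₂) Bool) :=
  (PMF.uniformOfFintype (Coins d₁ d₂ d₃ s b)).map (estimate A B)

/-! ### A randomized random access machine

The machine has integer registers, arrays of integers ("words") and arrays of bits. Matrix
entries are stored as single bits. Bits are processed by Boolean gates only, at addresses held in
registers; integers serve for addressing and for control and never depend on bits, so that several
bits cannot be packed into one integer. Every instruction costs one step. The largest integer that
was ever written is recorded (`peak`), so that the word length can be bounded. Registers and arrays
are named by numbers that are fixed in the program, so a program uses finitely many of them. -/

/-- The integer instructions (subtraction is truncated at `0`, division rounds down). -/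
inductive Op : Type
  | add | sub | mul | div | mod

/-- The value of an integer instruction. -/
def Op.eval : Op → ℕ → ℕ → ℕ
  | .add, u, v => u + v
  | .sub, u, v => u - v
  | .mul, u, v => u * v
  | .div, u, v => u / v
  | .mod, u, v => u % v

/-- A reference to a bit in memory: the name of a bit array, and the name of the register that
holds the position in that array. -/
structure BitRef where
  arr : ℕ
  reg : ℕ

/-- Programs. All loops are counted loops. -/
inductive Program : Type
  /-- Do nothing. -/
  | skip : Program
  /-- Register `r` becomes the number `n`. -/
  | const (r n : ℕ) : Program
  /-- Register `r` becomes the value of `o` at registers `u` and `v`. -/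
  | op (o : Op) (r u v : ℕ) : Program
  /-- Register `r` becomes the entry of the word array `a` at the position in register `u`. -/
  | load (r a u : ℕ) : Program
  /-- The entry of the word array `a` at the position in register `u` becomes register `r`. -/
  | store (a u r : ℕ) : Program
  /-- The bit at `t` becomes `g` applied to the bits at `p` and `q`. -/
  | gate (g : Bool → Bool → Bool) (t p q : BitRef) : Program
  /-- Register `r` becomes a uniformly random number below the number in register `u`. -/
  | drawWord (r u : ℕ) : Program
  /-- The bit at `t` becomes a fair random bit. -/
  | drawBit (t : BitRef) : Program
  /-- First the one program, then the other. -/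
  | seq (P Q : Program) : Program
  /-- Run `P` if register `r` is zero and `Q` otherwise. -/
  | ifZero (r : ℕ) (P Q : Program) : Program
  /-- Run `P` as many times as the number that is in register `r` at the start. -/
  | loop (r : ℕ) (P : Program) : Program

/-- States of the machine, with the number of steps made so far (`time`) and the largest integer
written so far (`peak`). -/
structure State where
  reg : ℕ → ℕ
  word : ℕ → ℕ → ℕ
  bit : ℕ → ℕ → Bool
  time : ℕ
  peak : ℕ

namespace State

/-- One step passes. -/
def tick (σ : State) : State := { σ with time := σ.time + 1 }

/-- Write the number `v` to register `r`. -/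
def setReg (σ : State) (r v : ℕ) : State :=
  { σ with reg := Function.update σ.reg r v, peak := max σ.peak v }

/-- Write the number `v` to position `i` of the word array `a`. -/
def setWord (σ : State) (a i v : ℕ) : State :=
  { σ with
    word := Function.update σ.word a (Function.update (σ.word a) i v)
    peak := max σ.peak v }

/-- The bit that is referred to. -/
def getBit (σ : State) (t : BitRef) : Bool := σ.bit t.arr (σ.reg t.reg)

/-- Overwrite the bit that is referred to. -/
def setBit (σ : State) (t : BitRef) (v : Bool) : State :=
  { σ with
    bit := Function.update σ.bit t.arr (Function.update (σ.bit t.arr) (σ.reg t.reg) v) }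

end State

/-- The uniform distribution on `{0, …, n - 1}` (and the point mass at `0` if `n = 0`). -/
noncomputable def uniformBelow (n : ℕ) : PMF ℕ :=
  if h : n = 0 then PMF.pure 0
  else
    haveI : NeZero n := ⟨h⟩
    (PMF.uniformOfFintype (Fin n)).map Fin.val

/-- Run a random transformation `n` times. -/
noncomputable def iterate (step : State → PMF State) : ℕ → State → PMF State
  | 0, σ => PMF.pure σ
  | n + 1, σ => (step σ).bind (iterate step n)

/-- The law of the final state of a program. An instruction costs one step, and so do a test, the
start of a loop, and each pass through a loop in addition to the cost of its body. -/
noncomputable def Program.run : Program → State → PMF State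
  | .skip, σ => PMF.pure σ
  | .const r n, σ => PMF.pure (σ.tick.setReg r n)
  | .op o r u v, σ => PMF.pure (σ.tick.setReg r (o.eval (σ.reg u) (σ.reg v)))
  | .load r a u, σ => PMF.pure (σ.tick.setReg r (σ.word a (σ.reg u)))
  | .store a u r, σ => PMF.pure (σ.tick.setWord a (σ.reg u) (σ.reg r))
  | .gate g t p q, σ => PMF.pure (σ.tick.setBit t (g (σ.getBit p) (σ.getBit q)))
  | .drawWord r u, σ => (uniformBelow (σ.reg u)).map (fun v => σ.tick.setReg r v)
  | .drawBit t, σ => (PMF.uniformOfFintype Bool).map (fun v => σ.tick.setBit t v)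
  | .seq P Q, σ => (P.run σ).bind Q.run
  | .ifZero r P Q, σ => if σ.reg r = 0 then P.run σ.tick else Q.run σ.tick
  | .loop r P, σ => iterate (fun τ => P.run τ.tick) (σ.reg r) σ.tick

/-- A Boolean matrix as a bit array, in row-major order. -/
def bitArray {p q : ℕ} (M : Matrix (Fin p) (Fin q) Bool) (n : ℕ) : Bool :=
  if h : n < p * q then
    M (finProdFinEquiv.symm ⟨n, h⟩).1 (finProdFinEquiv.symm ⟨n, h⟩).2
  else false

/-- The initial state: registers `0`, `1`, `2` hold `d₁`, `d₂`, `d₃`, the bit arrays `0` and `1`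
hold `A` and `B`, and all the rest is zero. -/
def initial {d₁ d₂ d₃ : ℕ} (A : Matrix (Fin d₁) (Fin d₃) Bool)
    (B : Matrix (Fin d₃) (Fin d₂) Bool) : State where
  reg := fun r => if r = 0 then d₁ else if r = 1 then d₂ else if r = 2 then d₃ else 0
  word := fun _ _ => 0
  bit := fun a n => if a = 0 then bitArray A n else if a = 1 then bitArray B n else false
  time := 0
  peak := 0

/-- The output, which is read from bit array `2` in row-major order. -/
def output (d₁ d₂ : ℕ) (σ : State) : Matrix (Fin d₁) (Fin d₂) Bool :=
  fun i j => σ.bit 2 ((i : ℕ) * d₂ + (j : ℕ))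

end BMM

/-! The decomposition of rank 6. Over `GF(2)`, the 2×2 block product with the single term `X₀₀ Y₀₀`
removed needs only six block products (`sum_coeff`). Iterating this `s` times computes the
pseudo-product with `6 ^ s` base products, although `7 ^ s * b ^ 3` triples `(x, y, z)` take part in
it. Hence `7 ^ s` has to be of order `ψ₃ log ψ₃`, and the work is of order `6 ^ s = (7 ^ s) ^ (log 6
/ log 7)`.

Correctness. The error is one-sided: an entry of `AB` without a witness is never reported. Let `k`
witness entry `(i, j)`. The fibres of `f₁` over `i` and of `f₃` over `k` are random subsets of
densities `1 / d₁` and `1 / d₃`. Call `y` good if some compatible `(x, y, z)` has `x` and `z` in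
these fibres. A good `y` has `f₂ y = j` with probability `1 / d₂`, and then the entry `(x, y)` is a
fair bit, because flipping `D z y` flips it. Different `y` use different columns of `D`, so they are
independent. The probability of a miss is therefore at most the probability that a random subset of
three copies of the index set, with densities `1 / d₁`, `1 / (2 d₂)`, `1 / d₃`, contains no
compatible triple (`card_misses_le`).

Janson's inequality (`janson`) bounds the latter by `exp (-μ² / (4 Δ))`. Here `μ` is `7 ^ s * b ^ 3
/ (2 ψ₃)`, and `Δ` is governed by the number of pairs of triples that share one coordinate (`25 ^ s
* b ^ 5`), two (`13 ^ s * b ^ 4`) or all three (`7 ^ s * b ^ 3`). The two hypotheses on `ψ₁` and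
`ψ₂` say exactly that the first two kinds stay negligible, since `log₇ (25 / 7) < 0.655 = 1 - 0.345`
and `log₇ (13 / 7) < 0.319 = 1 - 0.681`. So the exponent exceeds `(c + 1) log ψ₃`
(`log_mul_le_exponent`), and a union bound over at most `ψ₃` entries finishes
(`one_sub_rpow_le_algorithmLaw`).

Machine. Programs are assembled from compiled integer and Boolean expressions and counted loops.
`Tr` and `Rn` are Hoare-style judgements for deterministic and random runs; in `Rn` the final state
is a function of one uniform element, so equality of laws becomes a pointwise statement about coins.
The recursion runs breadth first: all `6 ^ l` matrices of level `l` lie in one array, and the total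
size of the levels is a geometric series dominated by the last one (`tr_multiply`). Together with
computing `s`, drawing the coins and collecting the output this gives `rn_program`. -/

namespace BMM

/-! ### Random subsets and Janson's inequality -/

section Janson

set_option linter.unusedSectionVars false

open Finset

variable {G : Type*} [Fintype G] [DecidableEq G]

/-- The probability of `U` as a random subset that contains each `g` independently with
probability `p g`. -/
noncomputable def subsetWeight (p : G → ℝ) (U : Finset G) : ℝ :=
  ∏ g, if g ∈ U then p g else 1 - p g

/-- The expectation of `h` on a random subset. -/
noncomputable def subsetMean (p : G → ℝ) (h : Finset G → ℝ) : ℝ :=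
  ∑ U, subsetWeight p U * h U

lemma sum_prod_mem_ite (a b : G → ℝ) :
    ∑ U : Finset G, ∏ g, (if g ∈ U then a g else b g) = ∏ g, (a g + b g) := by
  rw [Finset.prod_add, Finset.powerset_univ]
  refine sum_congr rfl fun U _ => ?_
  rw [Finset.prod_ite]
  congr 2
  · ext; simp
  · ext; simp

lemma sum_subsetWeight (p : G → ℝ) : ∑ U, subsetWeight p U = 1 := by
  simp [subsetWeight, sum_prod_mem_ite]

lemma subsetWeight_nonneg {p : G → ℝ} (h0 : ∀ g, 0 ≤ p g) (h1 : ∀ g, p g ≤ 1) (U : Finset G) :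
    0 ≤ subsetWeight p U := by
  refine prod_nonneg fun g _ => ?_
  split_ifs
  · exact h0 g
  · linarith [h1 g]

lemma subsetMean_mono {p : G → ℝ} (h0 : ∀ g, 0 ≤ p g) (h1 : ∀ g, p g ≤ 1)
    {h k : Finset G → ℝ} (hk : ∀ U, h U ≤ k U) : subsetMean p h ≤ subsetMean p k :=
  sum_le_sum fun U _ => mul_le_mul_of_nonneg_left (hk U) (subsetWeight_nonneg h0 h1 U)

/-- Subsets come in pairs `V`, `insert a V` whose weights differ only in the factor at `a`. As `k`
does not see `a`, that factor splits off. -/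
lemma subsetMean_mem_mul (p : G → ℝ) (a : G) (k : Finset G → ℝ)
    (hk : ∀ U, k (insert a U) = k U) :
    subsetMean p (fun U => if a ∈ U then k U else 0) = p a * subsetMean p k := by
  have key : ∀ h : Finset G → ℝ, subsetMean p h =
      ∑ V ∈ (univ.erase a).powerset, (∏ g ∈ univ.erase a, if g ∈ V then p g else 1 - p g) *
        ((1 - p a) * h V + p a * h (insert a V)) := by
    intro h
    have h1 : (univ : Finset (Finset G)) = (insert a (univ.erase a)).powerset := by
      rw [insert_erase (mem_univ a), powerset_univ]
    rw [subsetMean, h1, sum_powerset_insert (notMem_erase a univ), ← sum_add_distrib]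
    refine sum_congr rfl fun V hV => ?_
    have ha : a ∉ V := fun h => notMem_erase a univ (mem_powerset.mp hV h)
    have h2 : ∏ g ∈ univ.erase a, (if g ∈ insert a V then p g else 1 - p g) =
        ∏ g ∈ univ.erase a, (if g ∈ V then p g else 1 - p g) := by
      refine prod_congr rfl fun g hg => ?_
      simp [mem_insert, (mem_erase.mp hg).1]
    rw [subsetWeight, subsetWeight, ← mul_prod_erase univ _ (mem_univ a),
      ← mul_prod_erase univ (fun g => if g ∈ insert a V then p g else 1 - p g) (mem_univ a), h2]
    simp only [ha, if_false, mem_insert_self, if_true]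
    ring
  rw [key, key, mul_sum]
  refine sum_congr rfl fun V hV => ?_
  have ha : a ∉ V := fun h => notMem_erase a univ (mem_powerset.mp hV h)
  simp only [ha, if_false, mem_insert_self, if_true, hk]
  ring

/-- Independence: `k` ignores the points of `A`, which can therefore be split off one by one. -/
lemma subsetMean_subset_mul (p : G → ℝ) (A : Finset G) (k : Finset G → ℝ)
    (hk : ∀ a ∈ A, ∀ U, k (insert a U) = k U) :
    subsetMean p (fun U => if A ⊆ U then k U else 0) = (∏ a ∈ A, p a) * subsetMean p k := by
  induction A using Finset.induction_on with
  | empty => simp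
  | insert a A ha ih =>
    rw [prod_insert ha, mul_assoc, ← ih fun b hb => hk b (mem_insert_of_mem hb),
      ← subsetMean_mem_mul]
    · congr 1
      ext U
      by_cases h1 : a ∈ U <;> by_cases h2 : A ⊆ U <;> simp [insert_subset_iff, h1, h2]
    · intro U
      have h : A ⊆ insert a U ↔ A ⊆ U := by
        rw [subset_insert_iff_of_notMem ha]
      simp only [h, hk a (mem_insert_self a A)]

lemma subsetMean_const (p : G → ℝ) (c : ℝ) : subsetMean p (fun _ => c) = c := by
  rw [subsetMean, ← sum_mul, sum_subsetWeight, one_mul]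

lemma subsetMean_subset (p : G → ℝ) (A : Finset G) :
    subsetMean p (fun U => if A ⊆ U then 1 else 0) = ∏ a ∈ A, p a := by
  rw [subsetMean_subset_mul p A (fun _ => 1) (fun _ _ _ => rfl), subsetMean_const, mul_one]

/-- Harris' inequality. -/
lemma subsetMean_mul_le {p : G → ℝ} (h0 : ∀ g, 0 ≤ p g) (h1 : ∀ g, p g ≤ 1)
    {f g : Finset G → ℝ} (hf0 : 0 ≤ f) (hg0 : 0 ≤ g) (hf : Monotone f) (hg : Monotone g) :
    subsetMean p f * subsetMean p g ≤ subsetMean p (fun U => f U * g U) := by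
  have := fkg f g (subsetWeight p) (fun U => subsetWeight_nonneg h0 h1 U) hf0 hg0 hf hg ?_
  · rwa [sum_subsetWeight, one_mul] at this
  -- For a product weight the lattice condition of the FKG inequality holds with equality, factor by
  -- factor.
  · intro U V
    rw [subsetWeight, subsetWeight, subsetWeight, subsetWeight, ← prod_mul_distrib,
      ← prod_mul_distrib]
    refine (prod_congr rfl fun x _ => ?_).le
    by_cases hU : x ∈ U <;> by_cases hV : x ∈ V <;> simp [hU, hV, mul_comm]

variable {ι : Type*} [DecidableEq ι]

/-- The indicator of the event that a subset contains none of the sets `F i` with `i ∈ t`. -/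
noncomputable def avoids (F : ι → Finset G) (t : Finset ι) (U : Finset G) : ℝ :=
  if ∀ i ∈ t, ¬ F i ⊆ U then 1 else 0

lemma avoids_nonneg (F : ι → Finset G) (t : Finset ι) (U : Finset G) : 0 ≤ avoids F t U := by
  unfold avoids; split_ifs <;> simp

lemma avoids_le_one (F : ι → Finset G) (t : Finset ι) (U : Finset G) : avoids F t U ≤ 1 := by
  unfold avoids; split_ifs <;> simp

lemma avoids_anti (F : ι → Finset G) {t t' : Finset ι} (h : t ⊆ t') {U V : Finset G}
    (hUV : U ⊆ V) : avoids F t' V ≤ avoids F t U := by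
  by_cases h1 : ∀ i ∈ t', ¬ F i ⊆ V
  · have h2 : ∀ i ∈ t, ¬ F i ⊆ U := fun i hi hU => h1 i (h hi) (hU.trans hUV)
    simp [avoids, if_pos h2, if_pos h1]
  · rw [avoids, if_neg h1]
    exact avoids_nonneg F t U

/-- The sum of the probabilities `P(F i ∪ F j ⊆ U)` over `j ∈ t` that meet `F i`. -/
noncomputable def meetSum (p : G → ℝ) (F : ι → Finset G) (t : Finset ι) (i : ι) : ℝ :=
  ∑ j ∈ t with ¬ Disjoint (F i) (F j), ∏ g ∈ F i ∪ F j, p g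

/-- The inductive step of Janson's inequality. The sets disjoint from `F i` (`t0`) are independent
of the event `F i ⊆ U`; those that meet it (`t1`) are removed by a union bound, each term being
controlled by Harris' inequality. -/
lemma subsetMean_avoids_insert_le {p : G → ℝ} (h0 : ∀ g, 0 ≤ p g) (h1 : ∀ g, p g ≤ 1)
    (F : ι → Finset G) (t : Finset ι) (i : ι) :
    subsetMean p (avoids F (insert i t)) ≤
      subsetMean p (avoids F t) * Real.exp (-(∏ g ∈ F i, p g) + meetSum p F t i) := by
  set t0 := t.filter fun j => Disjoint (F i) (F j) with ht0
  set t1 := t.filter fun j => ¬ Disjoint (F i) (F j) with ht1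
  set P0 := subsetMean p (avoids F t0)
  set P := subsetMean p (avoids F t)
  have hPP0 : P ≤ P0 :=
    subsetMean_mono h0 h1 fun U => avoids_anti F (filter_subset _ _) subset_rfl
  have hP : 0 ≤ P := by
    have := subsetMean_mono h0 h1 (fun U => avoids_nonneg F t U)
    rwa [subsetMean_const] at this
  have hsplit : subsetMean p (avoids F (insert i t)) =
      P - subsetMean p (fun U => if F i ⊆ U then avoids F t U else 0) := by
    simp only [P, subsetMean, ← sum_sub_distrib, ← mul_sub]
    refine sum_congr rfl fun U _ => ?_
    congr 1
    by_cases h : F i ⊆ U <;> simp [avoids, h]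
  have hlow : ((∏ g ∈ F i, p g) - meetSum p F t i) * P0 ≤
      subsetMean p (fun U => if F i ⊆ U then avoids F t U else 0) := by
    have hA : subsetMean p (fun U => if F i ⊆ U then avoids F t0 U else 0) =
        (∏ g ∈ F i, p g) * P0 := by
      refine subsetMean_subset_mul p _ _ fun a ha U => ?_
      have : (∀ j ∈ t0, ¬ F j ⊆ insert a U) ↔ (∀ j ∈ t0, ¬ F j ⊆ U) := by
        refine forall₂_congr fun j hj => ?_
        rw [subset_insert_iff_of_notMem]
        exact disjoint_left.mp (mem_filter.mp hj).2 ha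
      simp only [avoids, this]
    -- Containing `F i ∪ F j` is increasing and avoiding `t0` is decreasing, so they are negatively
    -- correlated; Harris is applied to `1 - avoids F t0`.
    have hB : ∀ j, subsetMean p (fun U => if F i ∪ F j ⊆ U then avoids F t0 U else 0) ≤
        (∏ g ∈ F i ∪ F j, p g) * P0 := by
      intro j
      have h := subsetMean_mul_le h0 h1 (f := fun U => if F i ∪ F j ⊆ U then 1 else 0)
        (g := fun U => 1 - avoids F t0 U) (fun U => by dsimp; split_ifs <;> simp)
        (fun U => by have := avoids_le_one F t0 U; dsimp; linarith)
        (fun U V hUV => by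
          dsimp only
          by_cases h : F i ∪ F j ⊆ U
          · rw [if_pos h, if_pos (h.trans hUV)]
          · rw [if_neg h]; split_ifs <;> simp)
        (fun U V hUV => by
          have := avoids_anti F (subset_refl t0) hUV
          dsimp only; linarith)
      rw [subsetMean_subset] at h
      have e1 : subsetMean p (fun U => 1 - avoids F t0 U) = 1 - P0 := by
        simp only [P0, subsetMean, mul_sub, sum_sub_distrib, mul_one, sum_subsetWeight]
      have e2 : subsetMean p (fun U => (if F i ∪ F j ⊆ U then 1 else 0) * (1 - avoids F t0 U)) =
          (∏ g ∈ F i ∪ F j, p g) -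
            subsetMean p (fun U => if F i ∪ F j ⊆ U then avoids F t0 U else 0) := by
        rw [← subsetMean_subset]
        simp only [subsetMean, ← sum_sub_distrib]
        refine sum_congr rfl fun U _ => ?_
        split_ifs <;> ring
      rw [e1, e2] at h
      linarith
    -- Union bound: if `U` avoids `t0` but not `t`, then it contains `F j` for some `j ∈ t1`.
    have hC : subsetMean p (fun U => if F i ⊆ U then avoids F t0 U else 0) -
        ∑ j ∈ t1, subsetMean p (fun U => if F i ∪ F j ⊆ U then avoids F t0 U else 0) ≤
        subsetMean p (fun U => if F i ⊆ U then avoids F t U else 0) := by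
      have e : ∑ j ∈ t1, subsetMean p (fun U => if F i ∪ F j ⊆ U then avoids F t0 U else 0) =
          subsetMean p (fun U => ∑ j ∈ t1, if F i ∪ F j ⊆ U then avoids F t0 U else 0) := by
        simp only [subsetMean, mul_sum]
        exact sum_comm
      have e' : ∀ h k : Finset G → ℝ,
          subsetMean p h - subsetMean p k = subsetMean p fun U => h U - k U := fun h k => by
        simp only [subsetMean, mul_sub, sum_sub_distrib]
      rw [e, e']
      refine subsetMean_mono h0 h1 fun U => ?_
      have hsum : 0 ≤ ∑ j ∈ t1, if F i ∪ F j ⊆ U then avoids F t0 U else 0 :=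
        sum_nonneg fun j _ => by split_ifs <;> simp [avoids_nonneg]
      by_cases hi : F i ⊆ U
      · rw [if_pos hi, if_pos hi]
        by_cases h : ∀ j ∈ t1, ¬ F j ⊆ U
        · have : avoids F t0 U = avoids F t U := by
            have : (∀ j ∈ t0, ¬ F j ⊆ U) ↔ (∀ j ∈ t, ¬ F j ⊆ U) := by
              constructor
              · intro h' j hj
                by_cases hd : Disjoint (F i) (F j)
                · exact h' j (mem_filter.mpr ⟨hj, hd⟩)
                · exact h j (mem_filter.mpr ⟨hj, hd⟩)
              · exact fun h' j hj => h' j (mem_filter.mp hj).1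
            simp only [avoids, this]
          linarith
        · push Not at h
          obtain ⟨j, hj, hjU⟩ := h
          have h3 : avoids F t0 U ≤ ∑ j ∈ t1, if F i ∪ F j ⊆ U then avoids F t0 U else 0 := by
            have := single_le_sum (s := t1)
              (f := fun j => if F i ∪ F j ⊆ U then avoids F t0 U else 0)
              (fun j _ => by split_ifs <;> simp [avoids_nonneg]) hj
            rwa [if_pos (union_subset hi hjU)] at this
          linarith [avoids_nonneg F t U]
      · rw [if_neg hi, if_neg hi]
        linarith
    have hD := sum_le_sum fun j (_ : j ∈ t1) => hB j
    rw [← sum_mul] at hD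
    have : meetSum p F t i = ∑ j ∈ t1, ∏ g ∈ F i ∪ F j, p g := rfl
    rw [sub_mul, this]
    linarith
  have hnn : 0 ≤ subsetMean p (fun U => if F i ⊆ U then avoids F t U else 0) := by
    have := subsetMean_mono h0 h1 (h := fun _ => 0)
      (k := fun U => if F i ⊆ U then avoids F t U else 0)
      (fun U => by split_ifs <;> simp [avoids_nonneg])
    rwa [subsetMean_const] at this
  -- `P0` can be replaced by the smaller `P` when the factor is nonnegative; otherwise the left side
  -- is at most `0` and nothing is to be shown.
  have hlow' : ((∏ g ∈ F i, p g) - meetSum p F t i) * P ≤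
      subsetMean p (fun U => if F i ⊆ U then avoids F t U else 0) := by
    rcases le_total 0 ((∏ g ∈ F i, p g) - meetSum p F t i) with h | h
    · exact (mul_le_mul_of_nonneg_left hPP0 h).trans hlow
    · exact (mul_nonpos_of_nonpos_of_nonneg h hP).trans hnn
  rw [hsplit]
  have := Real.add_one_le_exp (-(∏ g ∈ F i, p g) + meetSum p F t i)
  nlinarith

/-- The sets are added one at a time and the exponents add up. Only pairs with an earlier set arise;
the symmetric double sum is larger but does not depend on the order. -/
lemma subsetMean_avoids_le_exp {p : G → ℝ} (h0 : ∀ g, 0 ≤ p g) (h1 : ∀ g, p g ≤ 1)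
    (F : ι → Finset G) (t : Finset ι) :
    subsetMean p (avoids F t) ≤
      Real.exp (-∑ i ∈ t, ∏ g ∈ F i, p g + ∑ i ∈ t, meetSum p F (t.erase i) i) := by
  induction t using Finset.induction_on with
  | empty => simp [avoids, subsetMean, sum_subsetWeight]
  | insert i t hi ih =>
    refine (subsetMean_avoids_insert_le h0 h1 F t i).trans ?_
    refine (mul_le_mul_of_nonneg_right ih (Real.exp_pos _).le).trans ?_
    rw [← Real.exp_add, sum_insert hi, sum_insert hi, erase_insert hi]
    refine Real.exp_le_exp.mpr ?_
    have : ∑ j ∈ t, meetSum p F (t.erase j) j ≤ ∑ j ∈ t, meetSum p F ((insert i t).erase j) j := by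
      refine sum_le_sum fun j hj => ?_
      refine sum_le_sum_of_subset_of_nonneg ?_ fun _ _ _ => prod_nonneg fun _ _ => h0 _
      exact filter_subset_filter _ (erase_subset_erase _ (subset_insert _ _))
    linarith

/-- Janson's inequality with sampling probability `q`. -/
lemma subsetMean_avoids_le_exp_thinned [Fintype ι] {p : G → ℝ} (h0 : ∀ g, 0 ≤ p g)
    (h1 : ∀ g, p g ≤ 1) (F : ι → Finset G) {q : ℝ} (hq0 : 0 ≤ q) (hq1 : q ≤ 1) :
    subsetMean p (avoids F univ) ≤
      Real.exp (-(q * ∑ i, ∏ g ∈ F i, p g) + q ^ 2 * ∑ i, meetSum p F univ i) := by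
  -- `X t` is the exponent for the subfamily `t`. Keeping each index with probability `q` weights
  -- single sets by `q` and pairs by `q ^ 2`, and some `t` does at least as well as the average.
  set X : Finset ι → ℝ := fun t =>
    -∑ i ∈ t, ∏ g ∈ F i, p g + ∑ i ∈ t, meetSum p F (t.erase i) i with hX
  have hmean : subsetMean (fun _ : ι => q) X ≤
      -(q * ∑ i, ∏ g ∈ F i, p g) + q ^ 2 * ∑ i, meetSum p F univ i := by
    have e : X = fun t => (∑ i, (if {i} ⊆ t then -∏ g ∈ F i, p g else 0)) +
        ∑ i, ∑ j, (if {i, j} ⊆ t then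
          (if j ≠ i ∧ ¬ Disjoint (F i) (F j) then ∏ g ∈ F i ∪ F j, p g else 0) else 0) := by
      ext t
      simp only [hX, meetSum, singleton_subset_iff]
      congr 1
      · rw [← sum_neg_distrib, ← sum_filter]
        simp
      · rw [← sum_subset (subset_univ t)]
        · refine sum_congr rfl fun i hi => ?_
          rw [sum_filter, ← sum_subset (subset_univ (t.erase i))]
          · refine sum_congr rfl fun j hj => ?_
            simp [insert_subset_iff, hi, (mem_erase.mp hj).1, (mem_erase.mp hj).2]
          · intro j _ hj
            by_cases hji : j = i <;> simp_all [insert_subset_iff]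
        · intro i _ hi
          simp [insert_subset_iff, hi]
    have lin : ∀ h k : Finset ι → ℝ, subsetMean (fun _ : ι => q) (fun t => h t + k t) =
        subsetMean (fun _ : ι => q) h + subsetMean (fun _ : ι => q) k := fun h k => by
      simp only [subsetMean, mul_add, sum_add_distrib]
    have lins : ∀ h : ι → Finset ι → ℝ, subsetMean (fun _ : ι => q) (fun t => ∑ i, h i t) =
        ∑ i, subsetMean (fun _ : ι => q) (h i) := fun h => by
      simp only [subsetMean, mul_sum]
      exact sum_comm
    rw [e, lin, lins, lins]
    simp only [lins]
    simp only [subsetMean_subset_mul _ _ (fun _ => _) (fun _ _ _ => rfl), subsetMean_const]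
    refine add_le_add (le_of_eq ?_) ?_
    · rw [mul_sum, ← sum_neg_distrib]
      simp
    · rw [mul_sum]
      refine sum_le_sum fun i _ => ?_
      rw [meetSum, sum_filter, mul_sum]
      refine sum_le_sum fun j _ => ?_
      -- The diagonal does not occur in `X` but does occur in `meetSum F univ`, where it is
      -- nonnegative; hence an inequality only.
      by_cases hij : j = i
      · simp only [hij, ne_eq, not_true_eq_false, false_and, if_false, mul_zero]
        refine mul_nonneg (sq_nonneg q) ?_
        split_ifs
        · exact le_rfl
        · exact prod_nonneg fun _ _ => h0 _
      · rw [prod_pair (Ne.symm hij), ← sq]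
        simp [hij]
  obtain ⟨t, ht⟩ : ∃ t, X t ≤ subsetMean (fun _ : ι => q) X := by
    by_contra! h
    have h2 : subsetMean (fun _ : ι => q) (fun _ => subsetMean (fun _ : ι => q) X) <
        subsetMean (fun _ : ι => q) X := by
      refine sum_lt_sum
        (fun U _ => mul_le_mul_of_nonneg_left (h U).le
          (subsetWeight_nonneg (fun _ => hq0) (fun _ => hq1) U)) ?_
      by_contra! h'
      have : ∑ U, subsetWeight (fun _ : ι => q) U ≤ 0 := by
        refine sum_nonpos fun U hU => ?_
        by_contra! hpos
        exact absurd (h' U hU) (not_le.mpr (mul_lt_mul_of_pos_left (h U) hpos))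
      rw [sum_subsetWeight] at this
      linarith
    rw [subsetMean_const] at h2
    exact lt_irrefl _ h2
  calc subsetMean p (avoids F univ) ≤ subsetMean p (avoids F t) :=
        subsetMean_mono h0 h1 fun U => avoids_anti F (subset_univ t) subset_rfl
    _ ≤ Real.exp (X t) := subsetMean_avoids_le_exp h0 h1 F t
    _ ≤ _ := Real.exp_le_exp.mpr (ht.trans hmean)

/-- Janson's inequality. -/
lemma janson [Fintype ι] {p : G → ℝ} (h0 : ∀ g, 0 ≤ p g) (h1 : ∀ g, p g ≤ 1)
    (F : ι → Finset G) {μ Δ : ℝ} (hμ : μ = ∑ i, ∏ g ∈ F i, p g) (hμ0 : 0 ≤ μ) (hμΔ : μ ≤ Δ)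
    (hΔ : ∑ i, meetSum p F univ i ≤ Δ) :
    subsetMean p (avoids F univ) ≤ Real.exp (-(μ ^ 2 / (4 * Δ))) := by
  rcases hμ0.eq_or_lt with h | h
  · rw [← h]
    have := subsetMean_mono h0 h1 (avoids_le_one F univ)
    rw [subsetMean_const] at this
    simpa using this
  have hΔ0 : 0 < Δ := h.trans_le hμΔ
  -- This `q` minimises `-q μ + q² Δ`; it is at most `1` because `μ ≤ Δ`.
  refine (subsetMean_avoids_le_exp_thinned h0 h1 F (q := μ / (2 * Δ)) (by positivity) ?_).trans ?_
  · rw [div_le_one (by positivity)]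
    linarith
  · refine Real.exp_le_exp.mpr ?_
    rw [← hμ]
    have := mul_le_mul_of_nonneg_left hΔ (sq_nonneg (μ / (2 * Δ)))
    have e : -(μ / (2 * Δ) * μ) + (μ / (2 * Δ)) ^ 2 * Δ = -(μ ^ 2 / (4 * Δ)) := by
      field_simp
      ring
    linarith

end Janson

/-! ### Random functions and random bits as random subsets -/

section Sampling

open Finset

lemma subsetMean_sum {α β : Type*} [Fintype α] [DecidableEq α] [Fintype β] [DecidableEq β]
    (p : α ⊕ β → ℝ) (h : Finset (α ⊕ β) → ℝ) :
    subsetMean p h = subsetMean (fun a => p (.inl a)) fun X =>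
      subsetMean (fun b => p (.inr b)) fun Y => h (X.disjSum Y) := by
  simp only [subsetMean, mul_sum]
  rw [← Fintype.sum_prod_type', ← Finset.sumEquiv.symm.toEquiv.sum_comp]
  refine sum_congr rfl fun XY _ => ?_
  rw [← mul_assoc]
  congr 1
  simp [subsetWeight, Finset.sumEquiv]

/-- Reads a product of failure probabilities as the probability that a random subset contains no
point with property `g`. This is how the positions `y` enter the random subset model. -/
lemma prod_one_sub_ite {α : Type*} [Fintype α] [DecidableEq α] (p : α → ℝ) (g : α → Prop)
    [DecidablePred g] :
    ∏ y, (1 - if g y then p y else 0) =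
      subsetMean p fun Y => if ∀ y ∈ Y, ¬ g y then 1 else 0 := by
  have : ∀ Y : Finset α, subsetWeight p Y * (if ∀ y ∈ Y, ¬ g y then 1 else 0) =
      ∏ y, if y ∈ Y then (if g y then 0 else p y) else 1 - p y := by
    intro Y
    by_cases h : ∀ y ∈ Y, ¬ g y
    · rw [if_pos h, mul_one]
      refine prod_congr rfl fun y _ => ?_
      by_cases hy : y ∈ Y
      · simp [hy, h y hy]
      · simp [hy]
    · rw [if_neg h, mul_zero]
      push Not at h
      obtain ⟨y, hy, hgy⟩ := h
      exact (prod_eq_zero (mem_univ y) (by simp [hy, hgy])).symm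
  simp only [subsetMean, this, sum_prod_mem_ite]
  refine prod_congr rfl fun y _ => ?_
  split_ifs <;> ring

/-- A fibre of a uniformly random function is a random subset. -/
lemma sum_fiber {α : Type*} [Fintype α] [DecidableEq α] {d : ℕ} (hd : d ≠ 0) (i : Fin d)
    (h : Finset α → ℝ) :
    ∑ f : α → Fin d, h (univ.filter fun x => f x = i) =
      (d : ℝ) ^ Fintype.card α * subsetMean (fun _ => 1 / (d : ℝ)) h := by
  have hd' : (d : ℝ) ≠ 0 := by exact_mod_cast hd
  rw [← sum_fiberwise univ (fun f : α → Fin d => univ.filter fun x => f x = i), subsetMean,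
    mul_sum]
  refine sum_congr rfl fun U _ => ?_
  -- The functions with fibre `U` over `i` form a box: one value at each point of `U`, `d - 1`
  -- values elsewhere.
  have hset : (univ.filter fun f : α → Fin d => (univ.filter fun x => f x = i) = U) =
      Fintype.piFinset fun x => if x ∈ U then {i} else {i}ᶜ := by
    ext f
    simp only [mem_filter, mem_univ, true_and, Fintype.mem_piFinset, Finset.ext_iff]
    refine forall_congr' fun x => ?_
    by_cases hx : x ∈ U <;> simp [hx]
  rw [sum_congr rfl (g := fun _ => h U) (fun f hf => by rw [(mem_filter.mp hf).2]), sum_const,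
    hset, Fintype.card_piFinset, nsmul_eq_mul, ← mul_assoc]
  congr 1
  rw [subsetWeight, Nat.cast_prod, ← Finset.card_univ, ← prod_const, ← prod_mul_distrib]
  refine prod_congr rfl fun x _ => ?_
  by_cases hx : x ∈ U
  · simp [hx, hd']
  · have : 1 ≤ d := Nat.one_le_iff_ne_zero.mpr hd
    simp [hx, card_compl, Nat.cast_sub this, mul_sub, hd']

/-- A function to `ZMod 2` that flips with some coordinate is balanced. -/
lemma two_mul_card_ne_one {α : Type*} [Fintype α] [DecidableEq α] (φ : (α → Bool) → ZMod 2)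
    (z : α) (hφ : ∀ δ, φ (Function.update δ z (!δ z)) = φ δ + 1) :
    2 * #{δ | φ δ = 1} = 2 ^ Fintype.card α := by
  -- Flipping coordinate `z` is an involution that exchanges the two sets.
  have h1 : #{δ | φ δ = 1} = #{δ | ¬ φ δ = 1} := by
    refine card_bijective (fun δ => Function.update δ z (!δ z)) ?_ ?_
    · refine Function.Involutive.bijective fun δ => ?_
      simp
    · intro δ
      simp only [mem_filter, mem_univ, true_and, hφ]
      generalize φ δ = a
      revert a
      decide
  have h2 := card_filter_add_card_filter_not (s := (univ : Finset (α → Bool))) (fun δ => φ δ = 1)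
  rw [card_univ, Fintype.card_fun, Fintype.card_bool] at h2
  omega

end Sampling

/-! ### The probability of missing one entry -/

section Failure

open Finset

variable {s b : ℕ}

/-- The condition under which `z` contributes to entry `(x, y)` of the pseudo-product. -/
def Compatible (x y z : Index s b) : Prop := x.1 ⊔ y.1 ⊔ z.1 = fun _ => true

instance (x y z : Index s b) : Decidable (Compatible x y z) := by
  unfold Compatible; infer_instance

/-- The triples of indices that contribute to the pseudo-product. -/
abbrev Triple (s b : ℕ) : Type :=
  {t : Index s b × Index s b × Index s b // Compatible t.1 t.2.1 t.2.2}

/-- A triple as a set of three points in three copies of the index set. -/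
def Triple.points (t : Triple s b) : Finset (Index s b ⊕ Index s b ⊕ Index s b) :=
  {.inl t.1.1, .inr (.inl t.1.2.1), .inr (.inr t.1.2.2)}

/-- The sampling probabilities for three copies of the index set. -/
def samplingProb (p₁ p₂ p₃ : ℝ) : Index s b ⊕ Index s b ⊕ Index s b → ℝ :=
  Sum.elim (fun _ => p₁) (Sum.elim (fun _ => p₂) fun _ => p₃)

variable {d₁ d₂ d₃ : ℕ}

/-- The event that no entry of the pseudo-product witnesses entry `(i, j)`. -/
def Misses (A : Matrix (Fin d₁) (Fin d₃) Bool) (B : Matrix (Fin d₃) (Fin d₂) Bool)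
    (i : Fin d₁) (j : Fin d₂) (ω : Coins d₁ d₂ d₃ s b) : Prop :=
  ∀ x y, ω.1 x = i → ω.2.1 y = j → pseudoProduct (Abar A ω) (Bbar B ω) x y ≠ 1

-- With `f₁` and `f₃` fixed, the pairs `(f₂ y, D · y)` are independent for different `y`. For a good
-- `y`, a fraction `1 / (2 d₂)` of the pairs yields a witness: `f₂ y` must be `j`, and the entry
-- `(x, y)` is balanced because it flips with `D z y`.
open Classical in
lemma card_misses_fixed_le (A : Matrix (Fin d₁) (Fin d₃) Bool) (B : Matrix (Fin d₃) (Fin d₂) Bool)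
    (i : Fin d₁) (j : Fin d₂) (k : Fin d₃) (hA : A i k = true) (hB : B k j = true)
    (f₁ : Index s b → Fin d₁) (f₃ : Index s b → Fin d₃) :
    ((#{gD : (Index s b → Fin d₂) × (Index s b → Index s b → Bool) |
        Misses A B i j (f₁, gD.1, f₃, gD.2)} : ℕ) : ℝ) ≤
      ((d₂ : ℝ) * 2 ^ Fintype.card (Index s b)) ^ Fintype.card (Index s b) *
        ∏ y : Index s b, (1 - if ∃ x z, f₁ x = i ∧ f₃ z = k ∧ Compatible x y z then
          1 / (2 * (d₂ : ℝ)) else 0) := by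
  set good : Index s b → Prop := fun y => ∃ x z, f₁ x = i ∧ f₃ z = k ∧ Compatible x y z
  have hd : (d₂ : ℝ) ≠ 0 := by exact_mod_cast (Fin.pos j).ne'
  -- Entry `(x, y)` of the pseudo-product as a function of column `y` of `D`, once `f₁ x = i` and
  -- `f₂ y = j`.
  set φ : Index s b → Index s b → (Index s b → Bool) → ZMod 2 := fun x y δ =>
    ∑ z : Index s b with x.1 ⊔ y.1 ⊔ z.1 = fun _ => true,
      toGF2 (A i (f₃ z)) * (toGF2 (B (f₃ z) j) * toGF2 (δ z))
  have hflip : ∀ x y z, f₃ z = k → Compatible x y z → ∀ δ,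
      φ x y (Function.update δ z (!δ z)) = φ x y δ + 1 := by
    intro x y z hz hc δ
    have hmem : z ∈ ({z : Index s b | x.1 ⊔ y.1 ⊔ z.1 = fun _ => true} : Finset _) :=
      mem_filter.mpr ⟨mem_univ _, hc⟩
    simp only [φ]
    rw [← add_sum_erase _ _ hmem, ← add_sum_erase _ _ hmem, add_right_comm]
    congr 1
    · simp only [hz, hA, hB, Function.update_self]
      cases δ z <;> decide
    · refine sum_congr rfl fun w hw => ?_
      rw [Function.update_of_ne (mem_erase.mp hw).1]
  set S : Index s b → Finset (Fin d₂ × (Index s b → Bool)) := fun y =>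
    {vδ | ∀ x, f₁ x = i → vδ.1 = j → φ x y vδ.2 ≠ 1}
  have hcard : ∀ y, ((S y).card : ℝ) ≤ (d₂ : ℝ) * 2 ^ Fintype.card (Index s b) *
      (1 - if good y then 1 / (2 * (d₂ : ℝ)) else 0) := by
    intro y
    by_cases hy : good y
    · obtain ⟨x, z, hx, hz, hc⟩ := id hy
      have h2 := two_mul_card_ne_one (φ x y) z (hflip x y z hz hc)
      have hsub : S y ⊆ (({j} : Finset (Fin d₂)) ×ˢ ({δ | φ x y δ = 1} : Finset _))ᶜ := by
        intro vδ hv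
        simp only [S, mem_filter, mem_univ, true_and] at hv
        simp only [mem_compl, mem_product, mem_singleton, mem_filter, mem_univ, true_and, not_and]
        exact hv x hx
      have h3 := card_le_card hsub
      have h4 : #(({j} : Finset (Fin d₂)) ×ˢ ({δ | φ x y δ = 1} : Finset _))ᶜ +
          #{δ | φ x y δ = 1} = d₂ * 2 ^ Fintype.card (Index s b) := by
        have := card_compl_add_card (({j} : Finset (Fin d₂)) ×ˢ ({δ | φ x y δ = 1} : Finset _))
        rw [card_product, card_singleton, one_mul, Fintype.card_prod, Fintype.card_fun,
          Fintype.card_bool, Fintype.card_fin] at this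
        exact this
      rw [if_pos hy]
      have h2' : (2 : ℝ) * #{δ | φ x y δ = 1} = 2 ^ Fintype.card (Index s b) := by
        exact_mod_cast h2
      have h3' : (#(S y) : ℝ) + #{δ | φ x y δ = 1} ≤ d₂ * 2 ^ Fintype.card (Index s b) := by
        exact_mod_cast (Nat.add_le_add_right h3 _).trans_eq h4
      have e : (d₂ : ℝ) * 2 ^ Fintype.card (Index s b) * (1 - 1 / (2 * (d₂ : ℝ))) =
          d₂ * 2 ^ Fintype.card (Index s b) - 2 ^ Fintype.card (Index s b) / 2 := by
        field_simp
      rw [e]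
      linarith
    · rw [if_neg hy, sub_zero, mul_one]
      have := card_le_univ (S y)
      rw [Fintype.card_prod, Fintype.card_fun, Fintype.card_bool, Fintype.card_fin] at this
      exact_mod_cast this
  -- Sorting `D` by columns makes the set of misses a subset of a product over `y`.
  have hinj : #{gD : (Index s b → Fin d₂) × (Index s b → Index s b → Bool) |
      Misses A B i j (f₁, gD.1, f₃, gD.2)} ≤ #(Fintype.piFinset S) := by
    refine card_le_card_of_injOn (fun gD y => (gD.1 y, fun z => gD.2 z y)) ?_ ?_
    · intro gD hgD
      simp only [coe_filter, mem_univ, true_and, Set.mem_ofPred_eq] at hgD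
      simp only [Fintype.coe_piFinset, Set.mem_pi, Set.mem_univ, forall_const, S, coe_filter,
        mem_univ, true_and, Set.mem_ofPred_eq]
      intro y x hx hy
      have := hgD x y hx hy
      simpa only [φ, pseudoProduct, Abar, Bbar, hx, hy] using this
    · rintro ⟨g, D⟩ - ⟨g', D'⟩ - h
      simp only [funext_iff, Prod.mk.injEq] at h
      refine Prod.ext (funext fun y => (h y).1) (funext fun z => funext fun y => (h y).2 z)
  calc _ ≤ ((#(Fintype.piFinset S) : ℕ) : ℝ) := by exact_mod_cast hinj
    _ = ∏ y, (#(S y) : ℝ) := by rw [Fintype.card_piFinset, Nat.cast_prod]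
    _ ≤ ∏ y, ((d₂ : ℝ) * 2 ^ Fintype.card (Index s b) *
        (1 - if good y then 1 / (2 * (d₂ : ℝ)) else 0)) :=
      prod_le_prod (fun _ _ => Nat.cast_nonneg _) fun y _ => hcard y
    _ = _ := by rw [prod_mul_distrib, prod_const, card_univ]

-- Averaging over `f₁` and `f₃` turns their fibres into random sets `X` and `Z`, and the product
-- over `y` is a random set `Y` of density `1 / (2 d₂)`. The factor `2` is the price of the random
-- bits `D`.
open Classical in
lemma card_misses_le [NeZero d₁] [NeZero d₃] (A : Matrix (Fin d₁) (Fin d₃) Bool)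
    (B : Matrix (Fin d₃) (Fin d₂) Bool)
    (i : Fin d₁) (j : Fin d₂) (k : Fin d₃) (hA : A i k = true) (hB : B k j = true) :
    ((#{ω : Coins d₁ d₂ d₃ s b | Misses A B i j ω} : ℕ) : ℝ) ≤
      Fintype.card (Coins d₁ d₂ d₃ s b) *
        subsetMean (samplingProb (1 / d₁) (1 / (2 * d₂)) (1 / d₃))
          (avoids (Triple.points (s := s) (b := b)) univ) := by
  set N := Fintype.card (Index s b)
  have h1 : #{ω : Coins d₁ d₂ d₃ s b | Misses A B i j ω} =
      ∑ f₁ : Index s b → Fin d₁, ∑ f₃ : Index s b → Fin d₃,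
        #{gD : (Index s b → Fin d₂) × (Index s b → Index s b → Bool) |
          Misses A B i j (f₁, gD.1, f₃, gD.2)} := by
    simp only [card_filter]
    rw [Fintype.sum_prod_type]
    refine sum_congr rfl fun f₁ _ => ?_
    rw [Fintype.sum_prod_type]
    simp only [Fintype.sum_prod_type]
    exact sum_comm
  have h2 : ∀ X Z : Finset (Index s b),
      ∏ y : Index s b, (1 - if ∃ x z, x ∈ X ∧ z ∈ Z ∧ Compatible x y z then
          1 / (2 * (d₂ : ℝ)) else 0) =
        subsetMean (fun _ => 1 / (2 * (d₂ : ℝ))) fun Y =>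
          avoids (Triple.points (s := s) (b := b)) univ (X.disjSum (Y.disjSum Z)) := by
    intro X Z
    rw [prod_one_sub_ite]
    congr 1
    ext Y
    have : (∀ y ∈ Y, ¬ ∃ x z, x ∈ X ∧ z ∈ Z ∧ Compatible x y z) ↔
        ∀ t ∈ (univ : Finset (Triple s b)), ¬ t.points ⊆ X.disjSum (Y.disjSum Z) := by
      constructor
      · intro h t _ ht
        simp only [Triple.points, insert_subset_iff, singleton_subset_iff, inl_mem_disjSum,
          inr_mem_disjSum] at ht
        exact h _ ht.2.1 ⟨_, _, ht.1, ht.2.2, t.2⟩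
      · rintro h y hy ⟨x, z, hx, hz, hc⟩
        refine h ⟨(x, y, z), hc⟩ (mem_univ _) ?_
        simp [Triple.points, insert_subset_iff, hx, hy, hz]
    simp only [avoids, this]
    congr
  rw [h1]
  push_cast
  calc _ ≤ ∑ f₁ : Index s b → Fin d₁, ∑ f₃ : Index s b → Fin d₃, ((d₂ : ℝ) * 2 ^ N) ^ N *
        subsetMean (fun _ => 1 / (2 * (d₂ : ℝ))) (fun Y =>
          avoids (Triple.points (s := s) (b := b)) univ
            ((univ.filter fun x => f₁ x = i).disjSum
              (Y.disjSum (univ.filter fun z => f₃ z = k)))) := by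
        refine sum_le_sum fun f₁ _ => sum_le_sum fun f₃ _ => ?_
        rw [← h2]
        refine (card_misses_fixed_le A B i j k hA hB f₁ f₃).trans_eq ?_
        simp [N]
    _ = ((d₂ : ℝ) * 2 ^ N) ^ N * ((d₁ : ℝ) ^ N * ((d₃ : ℝ) ^ N *
        subsetMean (fun _ => 1 / (d₁ : ℝ)) fun X => subsetMean (fun _ => 1 / (d₃ : ℝ)) fun Z =>
        subsetMean (fun _ => 1 / (2 * (d₂ : ℝ))) fun Y =>
          avoids (Triple.points (s := s) (b := b)) univ (X.disjSum (Y.disjSum Z)))) := by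
        simp only [← mul_sum]
        congr 1
        have e1 : ∀ X : Finset (Index s b), ∑ f₃ : Index s b → Fin d₃,
            subsetMean (fun _ => 1 / (2 * (d₂ : ℝ))) (fun Y =>
              avoids (Triple.points (s := s) (b := b)) univ
                (X.disjSum (Y.disjSum (univ.filter fun z => f₃ z = k)))) =
            (d₃ : ℝ) ^ N * subsetMean (fun _ => 1 / (d₃ : ℝ)) fun Z =>
              subsetMean (fun _ => 1 / (2 * (d₂ : ℝ))) fun Y =>
                avoids (Triple.points (s := s) (b := b)) univ (X.disjSum (Y.disjSum Z)) :=
          fun X => sum_fiber (NeZero.ne d₃) k fun Z =>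
            subsetMean (fun _ => 1 / (2 * (d₂ : ℝ))) fun Y =>
              avoids (Triple.points (s := s) (b := b)) univ (X.disjSum (Y.disjSum Z))
        simp only [e1, ← mul_sum]
        rw [mul_left_comm]
        congr 1
        exact sum_fiber (NeZero.ne d₁) i fun X => subsetMean (fun _ => 1 / (d₃ : ℝ)) fun Z =>
            subsetMean (fun _ => 1 / (2 * (d₂ : ℝ))) fun Y =>
              avoids (Triple.points (s := s) (b := b)) univ (X.disjSum (Y.disjSum Z))
    _ = _ := by
        rw [subsetMean_sum]
        simp only [subsetMean_sum (α := Index s b) (β := Index s b)]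
        simp only [samplingProb, Sum.elim_inl, Sum.elim_inr]
        have e2 : Fintype.card (Coins d₁ d₂ d₃ s b) = d₁ ^ N * (d₂ ^ N * (d₃ ^ N * (2 ^ N) ^ N)) := by
          simp [Coins, N]
        rw [e2]
        -- Exchanges the averages over `Y` and `Z`, which occur in the opposite order in
        -- `samplingProb`.
        have e3 : ∀ X : Finset (Index s b),
            (subsetMean (fun _ => 1 / (d₃ : ℝ)) fun Z =>
              subsetMean (fun _ => 1 / (2 * (d₂ : ℝ))) fun Y =>
                avoids (Triple.points (s := s) (b := b)) univ (X.disjSum (Y.disjSum Z))) =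
            (subsetMean (fun _ => 1 / (2 * (d₂ : ℝ))) fun Y =>
              subsetMean (fun _ => 1 / (d₃ : ℝ)) fun Z =>
                avoids (Triple.points (s := s) (b := b)) univ (X.disjSum (Y.disjSum Z))) := by
          intro X
          simp only [subsetMean, mul_sum]
          rw [sum_comm]
          exact sum_congr rfl fun _ _ => sum_congr rfl fun _ _ => by ring
        simp only [e3]
        push_cast
        ring

end Failure

/-! ### Counting pairs of compatible triples -/

section Counting

open Finset

/-- Two triples agree in the components selected by `e`. -/
def AgreeOn {α : Type*} (e : Bool × Bool × Bool) (u v : α × α × α) : Prop :=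
  (e.1 = true → u.1 = v.1) ∧ (e.2.1 = true → u.2.1 = v.2.1) ∧ (e.2.2 = true → u.2.2 = v.2.2)

instance {α : Type*} [DecidableEq α] (e : Bool × Bool × Bool) (u v : α × α × α) :
    Decidable (AgreeOn e u v) := by
  unfold AgreeOn; infer_instance

/-- Pairs of triples of bits with true disjunctions that agree in the components selected by
`e`. -/
abbrev BitPairs (e : Bool × Bool × Bool) : Type :=
  {w : (Bool × Bool × Bool) × (Bool × Bool × Bool) //
    (w.1.1 || w.1.2.1 || w.1.2.2) = true ∧ (w.2.1 || w.2.2.1 || w.2.2.2) = true ∧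
      AgreeOn e w.1 w.2}

variable {s b : ℕ}

lemma compatible_iff (x y z : Index s b) :
    Compatible x y z ↔ ∀ l, (x.1 l || y.1 l || z.1 l) = true := by
  simp [Compatible, funext_iff]

/-- Pairs of triples of indices are given by their bits and their components in `[b]`. -/
def triplePairsEquiv (e : Bool × Bool × Bool) :
    {tt : Triple s b × Triple s b // AgreeOn e tt.1.1 tt.2.1} ≃
      (Fin s → BitPairs e) ×
        {v : (Fin b × Fin b × Fin b) × (Fin b × Fin b × Fin b) // AgreeOn e v.1 v.2} where
  toFun tt :=
    (fun l => ⟨((tt.1.1.1.1.1 l, tt.1.1.1.2.1.1 l, tt.1.1.1.2.2.1 l),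
        (tt.1.2.1.1.1 l, tt.1.2.1.2.1.1 l, tt.1.2.1.2.2.1 l)),
      (compatible_iff _ _ _).mp tt.1.1.2 l, (compatible_iff _ _ _).mp tt.1.2.2 l,
      fun h => congrFun (congrArg Prod.fst (tt.2.1 h)) l,
      fun h => congrFun (congrArg Prod.fst (tt.2.2.1 h)) l,
      fun h => congrFun (congrArg Prod.fst (tt.2.2.2 h)) l⟩,
    ⟨((tt.1.1.1.1.2, tt.1.1.1.2.1.2, tt.1.1.1.2.2.2),
        (tt.1.2.1.1.2, tt.1.2.1.2.1.2, tt.1.2.1.2.2.2)),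
      fun h => (Prod.ext_iff.mp (tt.2.1 h)).2,
      fun h => (Prod.ext_iff.mp (tt.2.2.1 h)).2,
      fun h => (Prod.ext_iff.mp (tt.2.2.2 h)).2⟩)
  invFun p :=
    ⟨(⟨((fun l => (p.1 l).1.1.1, p.2.1.1.1), (fun l => (p.1 l).1.1.2.1, p.2.1.1.2.1),
          (fun l => (p.1 l).1.1.2.2, p.2.1.1.2.2)),
        (compatible_iff _ _ _).mpr fun l => (p.1 l).2.1⟩,
      ⟨((fun l => (p.1 l).1.2.1, p.2.1.2.1), (fun l => (p.1 l).1.2.2.1, p.2.1.2.2.1),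
          (fun l => (p.1 l).1.2.2.2, p.2.1.2.2.2)),
        (compatible_iff _ _ _).mpr fun l => (p.1 l).2.2.1⟩),
      fun h => Prod.ext (funext fun l => (p.1 l).2.2.2.1 h) (p.2.2.1 h),
      fun h => Prod.ext (funext fun l => (p.1 l).2.2.2.2.1 h) (p.2.2.2.1 h),
      fun h => Prod.ext (funext fun l => (p.1 l).2.2.2.2.2 h) (p.2.2.2.2 h)⟩
  left_inv _ := rfl
  right_inv _ := rfl

/-- Compatibility and agreement are conditions on each bit position separately, so the count is a
product over the `s` positions and the components in `[b]`. -/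
lemma card_triplePairs (e : Bool × Bool × Bool) {n k : ℕ} (hn : Fintype.card (BitPairs e) = n)
    (hk : Fintype.card {v : (Fin b × Fin b × Fin b) × (Fin b × Fin b × Fin b) //
      AgreeOn e v.1 v.2} = b ^ k) :
    #{tt : Triple s b × Triple s b | AgreeOn e tt.1.1 tt.2.1} = n ^ s * b ^ k := by
  rw [← Fintype.card_subtype, Fintype.card_congr (triplePairsEquiv e), Fintype.card_prod,
    Fintype.card_fun, Fintype.card_fin, hn, hk]

/-- The parameter `q` carries the indicator in a simplified form in which the six sums can be
evaluated. -/
lemma card_agreeOn {e : Bool × Bool × Bool} (q : Fin b → Fin b → Fin b → Fin b → Fin b → Fin b → ℕ)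
    (h : ∀ x₁ x₂ x₃ y₁ y₂ y₃,
      (if AgreeOn e (x₁, x₂, x₃) (y₁, y₂, y₃) then 1 else 0) = q x₁ x₂ x₃ y₁ y₂ y₃) :
    Fintype.card {v : (Fin b × Fin b × Fin b) × (Fin b × Fin b × Fin b) //
      AgreeOn e v.1 v.2} = ∑ x₁ : Fin b, ∑ x₂ : Fin b, ∑ x₃ : Fin b, ∑ y₁ : Fin b, ∑ y₂ : Fin b,
        ∑ y₃ : Fin b, q x₁ x₂ x₃ y₁ y₂ y₃ := by
  rw [Fintype.card_subtype, card_filter]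
  simp only [Fintype.sum_prod_type, h]

/-- `25 = 4² + 3²`: a shared bit `1` leaves four completions to a true disjunction, a shared bit `0`
leaves three. -/
lemma card_triplePairs_one {e : Bool × Bool × Bool}
    (he : e = (true, false, false) ∨ e = (false, true, false) ∨ e = (false, false, true)) :
    #{tt : Triple s b × Triple s b | AgreeOn e tt.1.1 tt.2.1} = 25 ^ s * b ^ 5 := by
  refine card_triplePairs e ?_ ?_
  · rcases he with rfl | rfl | rfl <;> decide
  · rcases he with rfl | rfl | rfl
    · rw [card_agreeOn (fun x₁ _ _ y₁ _ _ => if x₁ = y₁ then 1 else 0) (by simp [AgreeOn])]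
      simp [-sum_boole]
      ring
    · rw [card_agreeOn (fun _ x₂ _ _ y₂ _ => if x₂ = y₂ then 1 else 0) (by simp [AgreeOn])]
      simp [-sum_boole]
      ring
    · rw [card_agreeOn (fun _ _ x₃ _ _ y₃ => if x₃ = y₃ then 1 else 0) (by simp [AgreeOn])]
      simp [-sum_boole]
      ring

/-- `13 = 3 * 2² + 1`: two shared bits leave two completions, or one if both are `0`. -/
lemma card_triplePairs_two {e : Bool × Bool × Bool}
    (he : e = (true, true, false) ∨ e = (true, false, true) ∨ e = (false, true, true)) :
    #{tt : Triple s b × Triple s b | AgreeOn e tt.1.1 tt.2.1} = 13 ^ s * b ^ 4 := by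
  refine card_triplePairs e ?_ ?_
  · rcases he with rfl | rfl | rfl <;> decide
  · rcases he with rfl | rfl | rfl
    · rw [card_agreeOn (fun x₁ x₂ _ y₁ y₂ _ => if x₁ = y₁ ∧ x₂ = y₂ then 1 else 0) (by simp [AgreeOn])]
      simp [-sum_boole, ite_and]
      ring
    · rw [card_agreeOn (fun x₁ _ x₃ y₁ _ y₃ => if x₁ = y₁ ∧ x₃ = y₃ then 1 else 0) (by simp [AgreeOn])]
      simp [-sum_boole, ite_and]
      ring
    · rw [card_agreeOn (fun _ x₂ x₃ _ y₂ y₃ => if x₂ = y₂ ∧ x₃ = y₃ then 1 else 0) (by simp [AgreeOn])]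
      simp [-sum_boole, ite_and]
      ring

lemma card_triplePairs_three :
    #{tt : Triple s b × Triple s b | AgreeOn (true, true, true) tt.1.1 tt.2.1} =
      7 ^ s * b ^ 3 := by
  refine card_triplePairs _ (by decide) ?_
  rw [card_agreeOn (fun x₁ x₂ x₃ y₁ y₂ y₃ => if x₁ = y₁ ∧ x₂ = y₂ ∧ x₃ = y₃ then 1 else 0)
    (by simp [AgreeOn])]
  simp [-sum_boole, ite_and]
  ring

lemma card_triple : Fintype.card (Triple s b) = 7 ^ s * b ^ 3 := by
  rw [← card_triplePairs_three, ← Finset.card_univ]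
  refine card_bij (fun t _ => (t, t)) (fun t _ => ?_) (fun t _ t' _ h => congrArg Prod.fst h) ?_
  · simp [AgreeOn]
  · rintro ⟨t, t'⟩ h
    simp only [mem_filter, mem_univ, true_and, AgreeOn, forall_const] at h
    exact ⟨t, mem_univ _, Prod.ext rfl (Subtype.ext (Prod.ext h.1 (Prod.ext h.2.1 h.2.2)))⟩

lemma prod_points_union (p₁ p₂ p₃ : ℝ) (t t' : Triple s b) :
    ∏ g ∈ t.points ∪ t'.points, samplingProb p₁ p₂ p₃ g =
      p₁ ^ #{t.1.1, t'.1.1} * (p₂ ^ #{t.1.2.1, t'.1.2.1} * p₃ ^ #{t.1.2.2, t'.1.2.2}) := by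
  have : t.points ∪ t'.points =
      ({t.1.1, t'.1.1} : Finset _).disjSum
        (({t.1.2.1, t'.1.2.1} : Finset _).disjSum {t.1.2.2, t'.1.2.2}) := by
    ext g
    rcases g with g | g | g <;> simp [Triple.points] <;> tauto
  rw [this, prod_disjSum, prod_disjSum]
  simp [samplingProb]

lemma prod_points (p₁ p₂ p₃ : ℝ) (t : Triple s b) :
    ∏ g ∈ t.points, samplingProb p₁ p₂ p₃ g = p₁ * p₂ * p₃ := by
  have := prod_points_union p₁ p₂ p₃ t t
  simpa [mul_assoc] using this

/-- Pairs are sorted by the coordinates they share. Two triples that share only the first one cover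
five points, with probability `p₁p₂p₃ * p₂p₃`, and so on. `I e` counts agreement at least on `e`;
the overcount is harmless. -/
lemma sum_meetSum_points_le {p₁ p₂ p₃ : ℝ} (h₁ : 0 ≤ p₁) (h₂ : 0 ≤ p₂) (h₃ : 0 ≤ p₃) :
    ∑ t : Triple s b, meetSum (samplingProb p₁ p₂ p₃) Triple.points univ t ≤
      p₁ * p₂ * p₃ * ((p₁ * p₂ + p₁ * p₃ + p₂ * p₃) * (25 ^ s * b ^ 5) +
        (p₁ + p₂ + p₃) * (13 ^ s * b ^ 4) + 7 ^ s * b ^ 3) := by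
  set I : Bool × Bool × Bool → Triple s b → Triple s b → ℝ := fun e t t' =>
    if AgreeOn e t.1 t'.1 then 1 else 0
  have hI : ∀ e, ∑ t : Triple s b, ∑ t' : Triple s b, I e t t' =
      (#{tt : Triple s b × Triple s b | AgreeOn e tt.1.1 tt.2.1} : ℕ) := by
    intro e
    rw [card_filter, Nat.cast_sum, Fintype.sum_prod_type]
    simp [I]
  have key : ∀ t t' : Triple s b,
      (if ¬ Disjoint t.points t'.points then
        ∏ g ∈ t.points ∪ t'.points, samplingProb p₁ p₂ p₃ g else 0) ≤
      p₁ * p₂ * p₃ * (p₂ * p₃ * I (true, false, false) t t' + p₁ * p₃ * I (false, true, false) t t'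
        + p₁ * p₂ * I (false, false, true) t t' + p₃ * I (true, true, false) t t'
        + p₂ * I (true, false, true) t t' + p₁ * I (false, true, true) t t'
        + I (true, true, true) t t') := by
    intro t t'
    have n1 := mul_nonneg h₁ h₂
    have n2 := mul_nonneg h₁ h₃
    have n3 := mul_nonneg h₂ h₃
    have n4 := mul_nonneg n1 h₃
    rw [prod_points_union]
    by_cases hx : t.1.1 = t'.1.1 <;> by_cases hy : t.1.2.1 = t'.1.2.1 <;>
      by_cases hz : t.1.2.2 = t'.1.2.2
    all_goals
      have hd : Disjoint t.points t'.points ↔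
          t.1.1 ≠ t'.1.1 ∧ t.1.2.1 ≠ t'.1.2.1 ∧ t.1.2.2 ≠ t'.1.2.2 := by
        simp [Triple.points, eq_comm]
      simp only [hd, I, AgreeOn, hx, hy, hz, card_pair, ne_eq, not_true_eq_false, not_false_eq_true,
        and_self, and_true, and_false, if_true, if_false, pair_eq_singleton,
        card_singleton, forall_const, implies_true, reduceCtorEq, IsEmpty.forall_iff, mul_zero,
        mul_one, add_zero, zero_add, le_refl]
    all_goals nlinarith [mul_nonneg n4 n1, mul_nonneg n4 n2, mul_nonneg n4 n3, mul_nonneg n4 h₁,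
      mul_nonneg n4 h₂, mul_nonneg n4 h₃]
  calc _ ≤ ∑ t : Triple s b, ∑ t' : Triple s b, p₁ * p₂ * p₃ *
        (p₂ * p₃ * I (true, false, false) t t' + p₁ * p₃ * I (false, true, false) t t'
        + p₁ * p₂ * I (false, false, true) t t' + p₃ * I (true, true, false) t t'
        + p₂ * I (true, false, true) t t' + p₁ * I (false, true, true) t t'
        + I (true, true, true) t t') := by
        refine sum_le_sum fun t _ => ?_
        rw [meetSum, sum_filter]
        exact sum_le_sum fun t' _ => key t t'
    _ = _ := by
        simp only [← mul_sum, sum_add_distrib, hI]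
        rw [card_triplePairs_one (by simp), card_triplePairs_one (by simp),
          card_triplePairs_one (by simp), card_triplePairs_two (by simp),
          card_triplePairs_two (by simp), card_triplePairs_two (by simp), card_triplePairs_three]
        push_cast
        ring

/-- The probability that no triple of indices is sampled. -/
lemma subsetMean_avoids_points_le {p₁ p₂ p₃ ρ : ℝ} (h₁ : 0 ≤ p₁) (h₂ : 0 ≤ p₂) (h₃ : 0 ≤ p₃)
    (h₁' : p₁ ≤ 1) (h₂' : p₂ ≤ 1) (h₃' : p₃ ≤ 1)
    (hρ : (p₁ * p₂ + p₁ * p₃ + p₂ * p₃) * (25 ^ s * b ^ 5) +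
      (p₁ + p₂ + p₃) * (13 ^ s * b ^ 4) ≤ ρ * (7 ^ s * b ^ 3)) (hρ0 : 0 ≤ ρ) :
    subsetMean (samplingProb p₁ p₂ p₃) (avoids (Triple.points (s := s) (b := b)) univ) ≤
      Real.exp (-(p₁ * p₂ * p₃ * (7 ^ s * b ^ 3) / (4 * (1 + ρ)))) := by
  set μ : ℝ := p₁ * p₂ * p₃ * (7 ^ s * b ^ 3) with hμ
  have hp : 0 ≤ p₁ * p₂ * p₃ := mul_nonneg (mul_nonneg h₁ h₂) h₃
  have hμ0 : 0 ≤ μ := mul_nonneg hp (by positivity)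
  have : DecidableEq (Triple s b) := Classical.decEq _
  -- In `Δ = μ (1 + ρ)` the `1` stands for the pairs of equal triples; it also ensures `μ ≤ Δ`.
  have hj := janson (p := samplingProb (s := s) (b := b) p₁ p₂ p₃)
    (fun g => by rcases g with g | g | g <;> assumption)
    (fun g => by rcases g with g | g | g <;> assumption)
    (Triple.points (s := s) (b := b)) (μ := μ) (Δ := μ * (1 + ρ)) ?_ hμ0 (by nlinarith) ?_
  · refine hj.trans_eq ?_
    congr 2
    -- For `μ = 0` the quotient is `0 / 0 = 0`, which agrees with the claimed exponent.
    rcases hμ0.eq_or_lt with h | h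
    · simp [← h]
    · field_simp
  · simp only [prod_points, sum_const, card_univ, card_triple]
    rw [nsmul_eq_mul, hμ]
    push_cast
    ring
  · refine (sum_meetSum_points_le h₁ h₂ h₃).trans ?_
    have := mul_le_mul_of_nonneg_left hρ hp
    rw [hμ]
    nlinarith

end Counting

/-! ### The choice of the parameter `s` -/

section Parameter

/-- After `k` steps: the least `s` with `N * (s + 1) ≤ 7 ^ s`, or `k` if that is smaller. -/
def growExp (N : ℕ) : ℕ → ℕ
  | 0 => 0
  | k + 1 => if 7 ^ growExp N k < N * (growExp N k + 1) then growExp N k + 1 else growExp N k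

lemma growExp_le (N k : ℕ) : growExp N k ≤ k := by
  induction k with
  | zero => simp [growExp]
  | succ k ih => simp only [growExp]; split_ifs <;> omega

lemma growExp_spec (N k : ℕ) : growExp N k = k ∨ N * (growExp N k + 1) ≤ 7 ^ growExp N k := by
  induction k with
  | zero => simp [growExp]
  | succ k ih =>
    simp only [growExp]
    split_ifs with h
    · rcases ih with ih | ih
      · left; rw [ih]
      · omega
    · right; omega

lemma pow_lt_of_lt_growExp (N k : ℕ) : ∀ j < growExp N k, 7 ^ j < N * (j + 1) := by
  induction k with
  | zero => simp [growExp]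
  | succ k ih =>
    simp only [growExp]
    split_ifs with h
    · intro j hj
      rcases Nat.lt_succ_iff_lt_or_eq.mp hj with h' | rfl
      · exact ih j h'
      · exact h
    · exact ih

/-- The parameter `s` of the algorithm, for a constant `C`. -/
def levels (C d₁ d₂ d₃ : ℕ) : ℕ := growExp (C * (d₁ * d₂ * d₃)) (d₁ + d₂ + d₃ + C)

/-- The search may stop at the cap `K = d₁ + d₂ + d₃ + C`, because there the inequality holds
anyway: the left side is at most `2 ^ K * 2 ^ K`. The cap lets a counted loop perform the search. -/
lemma levels_spec (C d₁ d₂ d₃ : ℕ) :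
    C * (d₁ * d₂ * d₃) * (levels C d₁ d₂ d₃ + 1) ≤ 7 ^ levels C d₁ d₂ d₃ := by
  rcases growExp_spec (C * (d₁ * d₂ * d₃)) (d₁ + d₂ + d₃ + C) with h | h
  · rw [levels, h]
    set K := d₁ + d₂ + d₃ + C with hK
    have h2 : ∀ n : ℕ, n + 1 ≤ 2 ^ n := fun n => Nat.lt_two_pow_self
    have e : C * (d₁ * d₂ * d₃) ≤ 2 ^ K := by
      calc C * (d₁ * d₂ * d₃) ≤ 2 ^ C * (2 ^ d₁ * 2 ^ d₂ * 2 ^ d₃) := by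
            gcongr <;> exact Nat.lt_two_pow_self.le
        _ = 2 ^ K := by rw [hK]; ring
    calc C * (d₁ * d₂ * d₃) * (K + 1) ≤ 2 ^ K * 2 ^ K := Nat.mul_le_mul e (h2 K)
      _ = 4 ^ K := by rw [← mul_pow]; norm_num
      _ ≤ 7 ^ K := Nat.pow_le_pow_left (by norm_num) K
  · exact h

/-- Minimality of `s`: the defining inequality fails at `s - 1`. The case `s = 0` is excluded by
`h`. -/
lemma pow_levels_le (C d₁ d₂ d₃ : ℕ) (h : 2 ≤ C * (d₁ * d₂ * d₃)) :
    7 ^ levels C d₁ d₂ d₃ ≤ 7 * (C * (d₁ * d₂ * d₃)) * levels C d₁ d₂ d₃ := by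
  have hs := levels_spec C d₁ d₂ d₃
  have hlt := pow_lt_of_lt_growExp (C * (d₁ * d₂ * d₃)) (d₁ + d₂ + d₃ + C)
  rw [← levels] at hlt
  rcases Nat.eq_zero_or_pos (levels C d₁ d₂ d₃) with h0 | h0
  · rw [h0] at hs
    simp at hs
    omega
  · obtain ⟨n, hn⟩ := Nat.exists_eq_add_of_le' h0
    rw [hn] at hlt ⊢
    have := hlt n (by omega)
    rw [pow_succ]
    nlinarith

end Parameter

/-! ### Lower bound for the failure exponent -/

section Analysis

lemma pow_ratio_le {a : ℝ} {e : ℝ} (h : a ≤ 7 ^ (1 + e)) (ha : 0 ≤ a) (s : ℕ) :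
    a ^ s / 7 ^ s ≤ ((7 : ℝ) ^ s) ^ e := by
  have h1 : a ^ s ≤ ((7 : ℝ) ^ (1 + e)) ^ s := pow_le_pow_left₀ ha h s
  have h2 : ((7 : ℝ) ^ (1 + e)) ^ s = 7 ^ s * ((7 : ℝ) ^ s) ^ e := by
    rw [Real.rpow_add (by norm_num), Real.rpow_one, mul_pow, ← Real.rpow_natCast (7 ^ e),
      ← Real.rpow_natCast 7, ← Real.rpow_mul (by norm_num), ← Real.rpow_mul (by norm_num),
      mul_comm e]
  rw [div_le_iff₀ (by positivity)]
  linarith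

/-- `0.3185` lies between `log₇ (13 / 7)` and `0.319 = 1 - 0.681`. The power `2000` makes the
exponent an integer. -/
lemma thirteen_le : (13 : ℝ) ≤ 7 ^ (1 + 0.3185 : ℝ) := by
  have h : ((13 : ℝ) ^ (2000 : ℕ)) ≤ (7 ^ (1 + 0.3185 : ℝ)) ^ (2000 : ℕ) := by
    rw [← Real.rpow_natCast (7 ^ _), ← Real.rpow_mul (by norm_num)]
    have : ((1 + 0.3185 : ℝ) * ((2000 : ℕ) : ℝ)) = ((2637 : ℕ) : ℝ) := by norm_num
    rw [this, Real.rpow_natCast]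
    exact_mod_cast (by decide +kernel : 13 ^ 2000 ≤ 7 ^ 2637)
  exact le_of_pow_le_pow_left₀ (by norm_num) (by positivity) h

/-- `0.6545` lies between `log₇ (25 / 7)` and `0.655 = 1 - 0.345`. -/
lemma twentyFive_le : (25 : ℝ) ≤ 7 ^ (1 + 0.6545 : ℝ) := by
  have h : ((25 : ℝ) ^ (2000 : ℕ)) ≤ (7 ^ (1 + 0.6545 : ℝ)) ^ (2000 : ℕ) := by
    rw [← Real.rpow_natCast (7 ^ _), ← Real.rpow_mul (by norm_num)]
    have : ((1 + 0.6545 : ℝ) * ((2000 : ℕ) : ℝ)) = ((3309 : ℕ) : ℝ) := by norm_num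
    rw [this, Real.rpow_natCast]
    exact_mod_cast (by decide +kernel : 25 ^ 2000 ≤ 7 ^ 3309)
  exact le_of_pow_le_pow_left₀ (by norm_num) (by positivity) h

lemma log_seven_le_two : Real.log 7 ≤ 2 := by
  rw [Real.log_le_iff_le_exp (by norm_num)]
  have h := Real.exp_one_gt_d9
  have : Real.exp 2 = Real.exp 1 * Real.exp 1 := by rw [← Real.exp_add]; norm_num
  rw [this]
  nlinarith

lemma log_le_two_mul {ψ : ℝ} (hψ : 1 ≤ ψ) {s : ℕ} (h : ψ ≤ 7 ^ s) : Real.log ψ ≤ 2 * s := by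
  calc Real.log ψ ≤ Real.log (7 ^ s) := Real.log_le_log (by linarith) h
    _ = s * Real.log 7 := by rw [Real.log_pow]
    _ ≤ 2 * s := by nlinarith [log_seven_le_two, Nat.cast_nonneg (α := ℝ) s]

/-- The failure exponent exceeds `(c + 1) * log ψ`. -/
lemma log_mul_le_exponent {c b ψ τ₁ τ₂ : ℝ} {C s : ℕ} (hc : 0 < c) (hb : 1 ≤ b) (hψ : 1 < ψ)
    (hC : (6000 * (8 * (c + 1)) * b ^ 2) ^ 3 + 6 * (8 * (c + 1)) ≤ C)
    (hs : C * ψ * (s + 1) ≤ 7 ^ s) (hτ₁ : τ₁ ≤ ψ ^ (-0.319 : ℝ)) (hτ₂ : τ₂ ≤ ψ ^ (-0.655 : ℝ))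
    (hτ₁0 : 0 ≤ τ₁) (hτ₂0 : 0 ≤ τ₂) :
    (c + 1) * Real.log ψ ≤ 1 / (2 * ψ) * (7 ^ s * b ^ 3) /
      (4 * (1 + (τ₁ * b * (13 ^ s / 7 ^ s) + τ₂ * b ^ 2 * (25 ^ s / 7 ^ s)))) := by
  have hψ0 : 0 < ψ := by linarith
  -- `8 = 2 * 4` collects the `2` of `1 / (2 ψ)` and the `4` of Janson's inequality. The goal
  -- becomes `k L (1 + ρ) ≤ lam * b ^ 3` with `lam = 7 ^ s / ψ`.
  set k := 8 * (c + 1) with hk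
  have hk0 : 8 ≤ k := by linarith
  set lam : ℝ := 7 ^ s / ψ with hlam
  have e7 : (7 : ℝ) ^ s = lam * ψ := by rw [hlam]; field_simp
  have hC1 : (1 : ℝ) ≤ C := by
    have : 0 ≤ (6000 * k * b ^ 2) ^ 3 := by positivity
    linarith
  have hCs : C * ((s : ℝ) + 1) ≤ lam := by
    rw [hlam, le_div_iff₀ hψ0]
    linarith
  have hs0 : (0 : ℝ) ≤ s := Nat.cast_nonneg s
  have hCl : (C : ℝ) ≤ lam := by nlinarith
  have hl1 : 1 ≤ lam := hC1.trans hCl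
  have hl0 : 0 < lam := by linarith
  set L := Real.log ψ with hL
  have hL0 : 0 < L := Real.log_pos hψ
  have hLs : L ≤ 2 * s := log_le_two_mul hψ.le (by rw [e7]; nlinarith)
  -- The factor `s + 1` in `hs` pays for the logarithm. One third of `lam` covers the summand `1` of
  -- `1 + ρ`, the other two thirds cover `ρ`.
  have hkL : 3 * k * L ≤ lam := by
    have h6 : 6 * k ≤ C := by
      have : 0 ≤ (6000 * k * b ^ 2) ^ 3 := by positivity
      linarith
    calc 3 * k * L ≤ 6 * k * (s + 1) := by nlinarith
      _ ≤ C * (s + 1) := by gcongr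
      _ ≤ lam := hCs
  -- A common bound for both parts of `ρ`: both exponents of `lam` are below `2 / 3`, and `0.0005`
  -- is the slack left in the exponents of `ψ`.
  set r := b ^ 2 * lam ^ (2 / 3 : ℝ) * ψ ^ (-0.0005 : ℝ) with hr
  have hr1 : τ₁ * b * (13 ^ s / 7 ^ s) ≤ r := by
    calc τ₁ * b * (13 ^ s / 7 ^ s)
        ≤ ψ ^ (-0.319 : ℝ) * b ^ 2 * (lam ^ (0.3185 : ℝ) * ψ ^ (0.3185 : ℝ)) := by
          have := pow_ratio_le thirteen_le (by norm_num) s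
          rw [e7, Real.mul_rpow hl0.le hψ0.le] at this
          rw [e7]
          refine mul_le_mul (mul_le_mul hτ₁ (by nlinarith) (by linarith) (by positivity)) this
            (by positivity) (by positivity)
      _ = b ^ 2 * lam ^ (0.3185 : ℝ) * (ψ ^ (-0.319 : ℝ) * ψ ^ (0.3185 : ℝ)) := by ring
      _ = b ^ 2 * lam ^ (0.3185 : ℝ) * ψ ^ (-0.0005 : ℝ) := by
          rw [← Real.rpow_add hψ0]; congr 2; norm_num
      _ ≤ r := by
          rw [hr]
          exact mul_le_mul_of_nonneg_right (mul_le_mul_of_nonneg_left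
            (Real.rpow_le_rpow_of_exponent_le hl1 (by norm_num)) (by positivity)) (by positivity)
  have hr2 : τ₂ * b ^ 2 * (25 ^ s / 7 ^ s) ≤ r := by
    calc τ₂ * b ^ 2 * (25 ^ s / 7 ^ s)
        ≤ ψ ^ (-0.655 : ℝ) * b ^ 2 * (lam ^ (0.6545 : ℝ) * ψ ^ (0.6545 : ℝ)) := by
          have := pow_ratio_le twentyFive_le (by norm_num) s
          rw [e7, Real.mul_rpow hl0.le hψ0.le] at this
          rw [e7]
          exact mul_le_mul (mul_le_mul_of_nonneg_right hτ₂ (by positivity)) this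
            (by positivity) (by positivity)
      _ = b ^ 2 * lam ^ (0.6545 : ℝ) * (ψ ^ (-0.655 : ℝ) * ψ ^ (0.6545 : ℝ)) := by ring
      _ = b ^ 2 * lam ^ (0.6545 : ℝ) * ψ ^ (-0.0005 : ℝ) := by
          rw [← Real.rpow_add hψ0]; congr 2; norm_num
      _ ≤ r := by
          rw [hr]
          exact mul_le_mul_of_nonneg_right (mul_le_mul_of_nonneg_left
            (Real.rpow_le_rpow_of_exponent_le hl1 (by norm_num)) (by positivity)) (by positivity)
  -- The slack swallows the logarithm; `2000 = 1 / 0.0005`.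
  have hLψ : L * ψ ^ (-0.0005 : ℝ) ≤ 2000 := by
    have := Real.log_le_rpow_div hψ0.le (ε := 0.0005) (by norm_num)
    calc L * ψ ^ (-0.0005 : ℝ) ≤ ψ ^ (0.0005 : ℝ) / 0.0005 * ψ ^ (-0.0005 : ℝ) := by gcongr
      _ = 2000 * (ψ ^ (0.0005 : ℝ) * ψ ^ (-0.0005 : ℝ)) := by ring
      _ = 2000 := by rw [← Real.rpow_add hψ0]; norm_num
  -- The cube in `hC` is there for this: a third power of `lam` must absorb the constants, and `2 *
  -- 2000 = 2 / 3 * 6000`.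
  have hcube : 6000 * k * b ^ 2 ≤ lam ^ (1 / 3 : ℝ) := by
    have h3 : (6000 * k * b ^ 2) ^ 3 ≤ lam := by linarith
    calc 6000 * k * b ^ 2 = ((6000 * k * b ^ 2) ^ 3) ^ (1 / 3 : ℝ) := by
          rw [← Real.rpow_natCast (6000 * k * b ^ 2), ← Real.rpow_mul (by positivity)]
          norm_num
      _ ≤ lam ^ (1 / 3 : ℝ) := by gcongr
  have hkr : k * L * (2 * r) ≤ 2 / 3 * lam := by
    have hl23 : 0 ≤ lam ^ (2 / 3 : ℝ) := by positivity
    calc k * L * (2 * r) = 2 * k * b ^ 2 * lam ^ (2 / 3 : ℝ) * (L * ψ ^ (-0.0005 : ℝ)) := by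
          rw [hr]; ring
      _ ≤ 2 * k * b ^ 2 * lam ^ (2 / 3 : ℝ) * 2000 := by gcongr
      _ = 2 / 3 * (lam ^ (2 / 3 : ℝ) * (6000 * k * b ^ 2)) := by ring
      _ ≤ 2 / 3 * (lam ^ (2 / 3 : ℝ) * lam ^ (1 / 3 : ℝ)) := by gcongr
      _ = 2 / 3 * lam := by rw [← Real.rpow_add hl0]; norm_num
  set ρ := τ₁ * b * (13 ^ s / 7 ^ s) + τ₂ * b ^ 2 * (25 ^ s / 7 ^ s) with hρ
  have hρ0 : 0 ≤ ρ := by positivity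
  have e1 : 1 / (2 * ψ) * (7 ^ s * b ^ 3) / (4 * (1 + ρ)) = lam * b ^ 3 / (8 * (1 + ρ)) := by
    rw [e7]; field_simp; norm_num
  rw [e1, le_div_iff₀ (by positivity)]
  have hkρ : k * L * (1 + ρ) ≤ lam := by
    have : k * L * ρ ≤ k * L * (2 * r) := by gcongr; linarith
    linarith
  have hb3 : 1 ≤ b ^ 3 := one_le_pow₀ hb
  calc (c + 1) * L * (8 * (1 + ρ)) = k * L * (1 + ρ) := by rw [hk]; ring
    _ ≤ lam := hkρ
    _ ≤ lam * b ^ 3 := by nlinarith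

end Analysis

/-! ### From one entry to the whole matrix -/

section Success

open Finset

variable {d₁ d₂ d₃ s b : ℕ}

/-- The error is one-sided: without a witness every summand of the pseudo-product vanishes. -/
lemma estimate_eq_false_of_boolMul (A : Matrix (Fin d₁) (Fin d₃) Bool)
    (B : Matrix (Fin d₃) (Fin d₂) Bool) (ω : Coins d₁ d₂ d₃ s b) (i : Fin d₁) (j : Fin d₂)
    (h : boolMul A B i j = false) : estimate A B ω i j = false := by
  have h' : ∀ k, A i k = false ∨ B k j = false := by
    intro k
    by_contra! hk
    have : boolMul A B i j = true := by
      simp only [boolMul, decide_eq_true_eq]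
      exact ⟨k, by simpa using hk.1, by simpa using hk.2⟩
    simp [this] at h
  simp only [estimate, decide_eq_false_iff_not]
  rintro ⟨x, y, rfl, rfl, hxy⟩
  have : pseudoProduct (Abar A ω) (Bbar B ω) x y = 0 := by
    refine sum_eq_zero fun z _ => ?_
    rcases h' (ω.2.2.1 z) with hz | hz <;> simp [Abar, Bbar, hz, toGF2]
  rw [this] at hxy
  exact absurd hxy (by decide)

lemma misses_of_estimate_ne (A : Matrix (Fin d₁) (Fin d₃) Bool)
    (B : Matrix (Fin d₃) (Fin d₂) Bool) (ω : Coins d₁ d₂ d₃ s b)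
    (h : estimate A B ω ≠ boolMul A B) :
    ∃ ij : Fin d₁ × Fin d₂, boolMul A B ij.1 ij.2 = true ∧ Misses A B ij.1 ij.2 ω := by
  obtain ⟨i, hi⟩ := Function.ne_iff.mp h
  obtain ⟨j, hj⟩ := Function.ne_iff.mp hi
  refine ⟨(i, j), ?_⟩
  cases hB : boolMul A B i j
  · rw [hB, estimate_eq_false_of_boolMul A B ω i j hB] at hj
    exact absurd rfl hj
  · refine ⟨rfl, fun x y hx hy hxy => hj ?_⟩
    rw [hB]
    simp only [estimate, decide_eq_true_eq]
    exact ⟨x, y, hx, hy, hxy⟩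

open Classical in
lemma algorithmLaw_toReal [NeZero d₁] [NeZero d₂] [NeZero d₃] (A : Matrix (Fin d₁) (Fin d₃) Bool)
    (B : Matrix (Fin d₃) (Fin d₂) Bool) (M : Matrix (Fin d₁) (Fin d₂) Bool) :
    (algorithmLaw s b A B M).toReal =
      (#{ω : Coins d₁ d₂ d₃ s b | estimate A B ω = M} : ℕ) /
        (Fintype.card (Coins d₁ d₂ d₃ s b) : ℝ) := by
  rw [algorithmLaw, PMF.map_apply, tsum_fintype]
  simp only [PMF.uniformOfFintype_apply]
  rw [← sum_filter, sum_const, nsmul_eq_mul, ENNReal.toReal_mul, ENNReal.toReal_natCast,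
    ENNReal.toReal_inv, ENNReal.toReal_natCast, div_eq_mul_inv]
  congr 4
  ext ω
  simp [eq_comm]

/-- If every witnessed entry is missed with probability at most `ε`, then the algorithm fails with
probability at most `d₁ * d₂ * ε`. -/
lemma one_sub_le_algorithmLaw [NeZero d₁] [NeZero d₂] [NeZero d₃]
    (A : Matrix (Fin d₁) (Fin d₃) Bool) (B : Matrix (Fin d₃) (Fin d₂) Bool) {ε : ℝ} (hε : 0 ≤ ε)
    (h : subsetMean (samplingProb (1 / d₁) (1 / (2 * d₂)) (1 / d₃))
      (avoids (Triple.points (s := s) (b := b)) univ) ≤ ε) :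
    1 - d₁ * d₂ * ε ≤ (algorithmLaw s b A B (boolMul A B)).toReal := by
  classical
  rw [algorithmLaw_toReal]
  set N := Fintype.card (Coins d₁ d₂ d₃ s b)
  have hN : (0 : ℝ) < N := by exact_mod_cast Fintype.card_pos
  rw [le_div_iff₀ hN]
  have hsplit := card_filter_add_card_filter_not (s := (univ : Finset (Coins d₁ d₂ d₃ s b)))
    (fun ω => estimate A B ω = boolMul A B)
  have hbad : ((#{ω : Coins d₁ d₂ d₃ s b | ¬ estimate A B ω = boolMul A B} : ℕ) : ℝ) ≤
      d₁ * d₂ * (N * ε) := by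
    have hsub : ({ω : Coins d₁ d₂ d₃ s b | ¬ estimate A B ω = boolMul A B} : Finset _) ⊆
        (univ : Finset (Fin d₁ × Fin d₂)).biUnion fun ij =>
          if boolMul A B ij.1 ij.2 = true then
            ({ω : Coins d₁ d₂ d₃ s b | Misses A B ij.1 ij.2 ω} : Finset _) else ∅ := by
      intro ω hω
      obtain ⟨ij, h1, h2⟩ := misses_of_estimate_ne A B ω (mem_filter.mp hω).2
      simp only [mem_biUnion, mem_univ, true_and]
      exact ⟨ij, by simpa [h1] using h2⟩
    calc ((#{ω : Coins d₁ d₂ d₃ s b | ¬ estimate A B ω = boolMul A B} : ℕ) : ℝ)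
        ≤ ∑ ij : Fin d₁ × Fin d₂, ((#(if boolMul A B ij.1 ij.2 = true then
            ({ω : Coins d₁ d₂ d₃ s b | Misses A B ij.1 ij.2 ω} : Finset _) else ∅) : ℕ) : ℝ) := by
          exact_mod_cast (card_le_card hsub).trans card_biUnion_le
      _ ≤ ∑ _ij : Fin d₁ × Fin d₂, (N * ε : ℝ) := by
          refine sum_le_sum fun ij _ => ?_
          split_ifs with hij
          · simp only [boolMul, decide_eq_true_eq] at hij
            obtain ⟨k, hA, hB⟩ := hij
            exact (card_misses_le A B ij.1 ij.2 k hA hB).trans (by gcongr)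
          · simp only [card_empty, Nat.cast_zero]
            positivity
      _ = _ := by simp
  rw [card_univ] at hsplit
  have hsplit' : ((#{ω : Coins d₁ d₂ d₃ s b | estimate A B ω = boolMul A B} : ℕ) : ℝ) +
      (#{ω : Coins d₁ d₂ d₃ s b | ¬ estimate A B ω = boolMul A B} : ℕ) = N := by
    exact_mod_cast hsplit
  linarith

/-- The algorithm is correct with high probability if `7 ^ s` is large enough. -/
theorem one_sub_rpow_le_algorithmLaw [NeZero d₁] [NeZero d₂] [NeZero d₃] {c ψ₁ ψ₂ ψ₃ : ℝ}
    (hc : 0 < c) (hb : 1 ≤ b) {C : ℕ}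
    (hC : (6000 * (8 * (c + 1)) * (b : ℝ) ^ 2) ^ 3 + 6 * (8 * (c + 1)) ≤ C)
    (hs : C * (d₁ * d₂ * d₃) * (s + 1) ≤ 7 ^ s)
    (h₁ : ψ₁ = d₁ + d₂ + d₃) (h₂ : ψ₂ = d₁ * d₂ + d₁ * d₃ + d₂ * d₃) (h₃ : ψ₃ = d₁ * d₂ * d₃)
    (hψ : 1 < ψ₃) (h₁' : ψ₁ ≤ ψ₃ ^ (0.345 : ℝ)) (h₂' : ψ₂ ≤ ψ₃ ^ (0.681 : ℝ))
    (A : Matrix (Fin d₁) (Fin d₃) Bool) (B : Matrix (Fin d₃) (Fin d₂) Bool) :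
    1 - ψ₃ ^ (-c) ≤ (algorithmLaw s b A B (boolMul A B)).toReal := by
  have hψ0 : 0 < ψ₃ := by linarith
  have D₁ : (1 : ℝ) ≤ d₁ := by exact_mod_cast Nat.one_le_iff_ne_zero.mpr (NeZero.ne d₁)
  have D₂ : (1 : ℝ) ≤ d₂ := by exact_mod_cast Nat.one_le_iff_ne_zero.mpr (NeZero.ne d₂)
  have D₃ : (1 : ℝ) ≤ d₃ := by exact_mod_cast Nat.one_le_iff_ne_zero.mpr (NeZero.ne d₃)
  have hb' : (1 : ℝ) ≤ b := by exact_mod_cast hb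
  -- Turns the exponents `0.681` and `0.345` into `-0.319` and `-0.655`.
  have hτ : ∀ u v : ℝ, u ≤ ψ₃ ^ v → u / ψ₃ ≤ ψ₃ ^ (v - 1) := fun u v huv => by
    rw [Real.rpow_sub_one hψ0.ne']
    gcongr
  have e := log_mul_le_exponent (c := c) (b := b) (ψ := ψ₃) (τ₁ := ψ₂ / ψ₃) (τ₂ := ψ₁ / ψ₃) (C := C)
    (s := s) hc hb' hψ hC (by rw [h₃]; exact_mod_cast hs)
    ((hτ _ _ h₂').trans_eq (by norm_num)) ((hτ _ _ h₁').trans_eq (by norm_num))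
    (by rw [h₂]; positivity) (by rw [h₁]; positivity)
  set ρ := ψ₂ / ψ₃ * b * (13 ^ s / 7 ^ s) + ψ₁ / ψ₃ * (b : ℝ) ^ 2 * (25 ^ s / 7 ^ s) with hρ
  have hρ0 : 0 ≤ ρ := by rw [hρ, h₁, h₂]; positivity
  have hD2 : 1 / (2 * (d₂ : ℝ)) ≤ 1 / d₂ := by gcongr; linarith
  have hmean := subsetMean_avoids_points_le (s := s) (b := b) (p₁ := 1 / (d₁ : ℝ))
    (p₂ := 1 / (2 * (d₂ : ℝ))) (p₃ := 1 / (d₃ : ℝ)) (ρ := ρ) (by positivity) (by positivity)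
    (by positivity) ((div_le_one (by linarith)).mpr D₁)
    (hD2.trans ((div_le_one (by linarith)).mpr D₂)) ((div_le_one (by linarith)).mpr D₃) ?_ hρ0
  · have hexp : Real.exp (-(1 / (d₁ : ℝ) * (1 / (2 * (d₂ : ℝ))) * (1 / (d₃ : ℝ)) *
        (7 ^ s * (b : ℝ) ^ 3) / (4 * (1 + ρ)))) ≤ ψ₃ ^ (-(c + 1)) := by
      rw [Real.rpow_def_of_pos hψ0]
      refine Real.exp_le_exp.mpr ?_
      have : 1 / (d₁ : ℝ) * (1 / (2 * (d₂ : ℝ))) * (1 / (d₃ : ℝ)) = 1 / (2 * ψ₃) := by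
        rw [h₃]; field_simp
      rw [this]
      linarith
    have hlaw := one_sub_le_algorithmLaw A B (by positivity) (hmean.trans hexp)
    refine le_trans ?_ hlaw
    -- The union bound over the entries costs one factor `ψ₃`, hence `c + 1` in the exponent.
    have hd : (d₁ : ℝ) * d₂ ≤ ψ₃ := by
      rw [h₃]
      have : (0 : ℝ) ≤ d₁ * d₂ := by positivity
      nlinarith
    have : (d₁ : ℝ) * d₂ * ψ₃ ^ (-(c + 1)) ≤ ψ₃ ^ (-c) := by
      calc (d₁ : ℝ) * d₂ * ψ₃ ^ (-(c + 1)) ≤ ψ₃ * ψ₃ ^ (-(c + 1)) := by gcongr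
        _ = ψ₃ ^ (1 + -(c + 1)) := by rw [Real.rpow_add hψ0, Real.rpow_one]
        _ = ψ₃ ^ (-c) := by ring_nf
    linarith
  -- The pairwise products of the `1 / dᵢ` sum to `ψ₁ / ψ₃`, the `1 / dᵢ` themselves to `ψ₂ / ψ₃`.
  · calc _ ≤ (1 / (d₁ : ℝ) * (1 / d₂) + 1 / d₁ * (1 / d₃) + 1 / d₂ * (1 / d₃)) *
          (25 ^ s * (b : ℝ) ^ 5) + (1 / d₁ + 1 / d₂ + 1 / d₃) * (13 ^ s * (b : ℝ) ^ 4) := by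
          gcongr
      _ = ρ * (7 ^ s * (b : ℝ) ^ 3) := by
          rw [hρ, h₁, h₂, h₃]
          field_simp
          ring

end Success

/-! ### A calculus for programs -/

/-- The part of a state that consists of the registers and bit arrays below `100` and all word
arrays. The other registers and bit arrays are scratch space. -/
@[ext] structure Mem where
  reg : ℕ → ℕ
  word : ℕ → ℕ → ℕ
  bit : ℕ → ℕ → Bool

namespace Mem

def setReg (M : Mem) (r v : ℕ) : Mem := { M with reg := Function.update M.reg r v }

def setWord (M : Mem) (a i v : ℕ) : Mem :=
  { M with word := Function.update M.word a (Function.update (M.word a) i v) }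

/-- Replace the bit array `a`. -/
def setBits (M : Mem) (a : ℕ) (g : ℕ → Bool) : Mem := { M with bit := Function.update M.bit a g }

/-- All numbers are at most `V`. -/
def Le (M : Mem) (V : ℕ) : Prop := (∀ r, M.reg r ≤ V) ∧ ∀ a i, M.word a i ≤ V

lemma Le.setReg {M : Mem} {V : ℕ} (h : M.Le V) (r : ℕ) {v : ℕ} (hv : v ≤ V) :
    (M.setReg r v).Le V := by
  refine ⟨fun r' => ?_, h.2⟩
  by_cases hr : r' = r
  · subst hr; simpa [Mem.setReg] using hv
  · simpa [Mem.setReg, hr] using h.1 r'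

lemma Le.setWord {M : Mem} {V : ℕ} (h : M.Le V) (a i : ℕ) {v : ℕ} (hv : v ≤ V) :
    (M.setWord a i v).Le V := by
  refine ⟨h.1, fun a' i' => ?_⟩
  by_cases ha : a' = a
  · subst ha
    by_cases hi : i' = i
    · subst hi; simpa [Mem.setWord] using hv
    · simpa [Mem.setWord, hi] using h.2 a' i'
  · simpa [Mem.setWord, ha] using h.2 a' i'

lemma Le.setBits {M : Mem} {V : ℕ} (h : M.Le V) (a : ℕ) (g : ℕ → Bool) : (M.setBits a g).Le V := h

end Mem

/-- The visible part of a state. -/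
def State.view (σ : State) : Mem where
  reg := fun r => if r < 100 then σ.reg r else 0
  word := σ.word
  bit := fun a => if a < 100 then σ.bit a else fun _ => false

lemma view_eq_of {σ τ : State} (hr : ∀ r < 100, τ.reg r = σ.reg r) (hw : τ.word = σ.word)
    (hb : ∀ a < 100, τ.bit a = σ.bit a) : τ.view = σ.view := by
  refine Mem.ext (funext fun r => ?_) hw (funext fun a => ?_)
  · simp only [State.view]; split_ifs with h
    · exact hr r h
    · rfl
  · simp only [State.view]; split_ifs with h
    · exact hb a h
    · rfl

lemma view_setReg {σ : State} {r : ℕ} (hr : r < 100) (v : ℕ) :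
    (σ.setReg r v).view = σ.view.setReg r v := by
  refine Mem.ext (funext fun r' => ?_) rfl rfl
  by_cases h : r' = r
  · subst h; simp [State.view, State.setReg, Mem.setReg, hr]
  · simp [State.view, State.setReg, Mem.setReg, h]

lemma view_setWord (σ : State) (a i v : ℕ) :
    (σ.setWord a i v).view = σ.view.setWord a i v := rfl

lemma view_setBit {σ : State} {t : BitRef} (ht : t.arr < 100) (v : Bool) :
    (σ.setBit t v).view =
      σ.view.setBits t.arr (Function.update (σ.view.bit t.arr) (σ.reg t.reg) v) := by
  refine Mem.ext rfl rfl (funext fun a => ?_)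
  by_cases h : a = t.arr
  · subst h; simp [State.view, State.setBit, Mem.setBits, ht]
  · simp [State.view, State.setBit, Mem.setBits, h]

/-- Integer expressions. -/
inductive Expr : Type
  | reg (r : ℕ) : Expr
  | const (n : ℕ) : Expr
  | op (o : Op) (e f : Expr) : Expr
  | load (a : ℕ) (e : Expr) : Expr

namespace Expr

def eval : Expr → Mem → ℕ
  | reg r, M => M.reg r
  | const n, _ => n
  | op o e f, M => o.eval (e.eval M) (f.eval M)
  | load a e, M => M.word a (e.eval M)

/-- A program that computes the value of an expression in register `k`. -/
def code : Expr → ℕ → Program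
  -- A copy is an addition to a cleared register.
  | reg r, k => .seq (.const k 0) (.op .add k r k)
  | const n, k => .const k n
  | op o e f, k => .seq (e.code k) (.seq (f.code (k + 1)) (.op o k k (k + 1)))
  | load a e, k => .seq (e.code k) (.load k a k)

def cost : Expr → ℕ
  | reg _ => 2
  | const _ => 1
  | op _ e f => e.cost + f.cost + 1
  | load _ e => e.cost + 1

def leaves : Expr → ℕ
  | reg _ => 1
  | const _ => 1
  | op _ e f => e.leaves + f.leaves
  | load _ e => e.leaves

/-- The registers are visible and the constants are at most `V`. -/
def Ok (V : ℕ) : Expr → Prop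
  | reg r => r < 100
  | const n => n ≤ V
  | op _ e f => e.Ok V ∧ f.Ok V
  | load _ e => e.Ok V

lemma one_le_leaves (e : Expr) : 1 ≤ e.leaves := by
  induction e with
  | reg | const => exact le_rfl
  | op o e f he hf => simp only [leaves]; omega
  | load a e he => exact he

/-- Every operation is bounded by the product of the bounds of its operands. For a sum this uses
that both bounds are at least `2`. -/
lemma eval_le {V : ℕ} (hV : 2 ≤ V) {M : Mem} (hM : M.Le V) {e : Expr} (he : e.Ok V) :
    e.eval M ≤ V ^ e.leaves := by
  induction e with
  | reg r => simpa [eval, leaves] using hM.1 r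
  | const n => simpa [eval, leaves, Ok] using he
  | load a e ih =>
    exact (hM.2 a _).trans (Nat.le_self_pow (Nat.one_le_iff_ne_zero.mp e.one_le_leaves) V)
  | op o e f ihe ihf =>
    have h1 := ihe he.1
    have h2 := ihf he.2
    have e2 : 2 ≤ V ^ e.leaves :=
      hV.trans (Nat.le_self_pow (Nat.one_le_iff_ne_zero.mp e.one_le_leaves) V)
    have f2 : 2 ≤ V ^ f.leaves :=
      hV.trans (Nat.le_self_pow (Nat.one_le_iff_ne_zero.mp f.one_le_leaves) V)
    have h3 : V ^ e.leaves ≤ V ^ e.leaves * V ^ f.leaves := Nat.le_mul_of_pos_right _ (by omega)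
    simp only [eval, leaves, pow_add]
    cases o <;> simp only [Op.eval]
    · calc _ ≤ V ^ e.leaves + V ^ f.leaves := Nat.add_le_add h1 h2
        _ ≤ _ := by nlinarith
    · exact (Nat.sub_le _ _).trans (h1.trans h3)
    · exact Nat.mul_le_mul h1 h2
    · exact (Nat.div_le_self _ _).trans (h1.trans h3)
    · exact (Nat.mod_le _ _).trans (h1.trans h3)

/-- Registers from `k` on serve as a stack: the second operand is evaluated in `k + 1` while the
first one waits in `k`. As `100 ≤ k`, the visible memory is untouched. -/
lemma run_code {V κ : ℕ} (hV : 2 ≤ V) {e : Expr} (he : e.Ok V) (hκ : e.leaves ≤ κ) {k : ℕ}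
    (hk : 100 ≤ k) (σ : State) (hM : σ.view.Le V) :
    ∃ τ, (e.code k).run σ = PMF.pure τ ∧ τ.reg k = e.eval σ.view ∧ (∀ r < k, τ.reg r = σ.reg r) ∧
      τ.word = σ.word ∧ τ.bit = σ.bit ∧ τ.time = σ.time + e.cost ∧
      τ.peak ≤ max σ.peak (V ^ κ) := by
  have hle : ∀ {e : Expr} {σ : State}, e.Ok V → σ.view.Le V → e.leaves ≤ κ →
      e.eval σ.view ≤ V ^ κ := fun he hM hκ =>
    (eval_le hV hM he).trans (Nat.pow_le_pow_right (by omega) hκ)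
  induction e generalizing k σ with
  | reg r =>
    have hr : r < 100 := he
    have hrk : r ≠ k := by omega
    have := hle he hM hκ
    refine ⟨(σ.tick.setReg k 0).tick.setReg k (σ.reg r), ?_, ?_, ?_, rfl, rfl, rfl, ?_⟩
    · simp [code, Program.run, State.setReg, State.tick, Op.eval, hrk]
    · simp [State.setReg, eval, State.view, hr]
    · intro r' hr'
      simp [State.setReg, State.tick, hr'.ne]
    · simp [eval, State.view, hr] at this
      simp [State.setReg, State.tick, this]; omega
  | const n =>
    have := hle he hM hκ
    refine ⟨σ.tick.setReg k n, by simp [code, Program.run], by simp [State.setReg, eval], ?_, rfl,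
      rfl, rfl, ?_⟩
    · intro r' hr'
      simp [State.setReg, State.tick, hr'.ne]
    · simp [eval] at this
      simp [State.setReg, State.tick, this]; omega
  | load a e ih =>
    obtain ⟨τ, h1, h2, h3, h4, h5, h6, h7⟩ := ih he hκ hk σ hM
    have := hle (e := load a e) he hM hκ
    refine ⟨τ.tick.setReg k (τ.word a (τ.reg k)), ?_, ?_, ?_, h4, h5, ?_, ?_⟩
    · simp [code, Program.run, h1]
    · simp [State.setReg, eval, h4, h2, State.view]
    · intro r' hr'
      simp [State.setReg, State.tick, hr'.ne, h3 r' hr']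
    · simp [State.setReg, State.tick, h6, cost]; ring
    · have h8 : τ.word a (τ.reg k) ≤ V ^ κ := by
        rw [h4, h2]
        exact this
      simp only [State.setReg, State.tick, sup_le_iff]
      exact ⟨h7, le_max_of_le_right h8⟩
  | op o e f ihe ihf =>
    simp only [leaves] at hκ
    obtain ⟨τ, h1, h2, h3, h4, h5, h6, h7⟩ := ihe he.1 (by omega) hk σ hM
    have hv : τ.view = σ.view := view_eq_of (fun r hr => h3 r (by omega)) h4
      (fun a _ => by rw [h5])
    obtain ⟨υ, g1, g2, g3, g4, g5, g6, g7⟩ := ihf he.2 (by omega) (Nat.le_succ_of_le hk) τ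
      (by rwa [hv])
    have := hle (e := op o e f) he hM (by simpa [leaves] using hκ)
    refine ⟨υ.tick.setReg k (o.eval (υ.reg k) (υ.reg (k + 1))), ?_, ?_, ?_, g4.trans h4,
      g5.trans h5, ?_, ?_⟩
    · simp only [code, Program.run, h1, PMF.pure_bind, g1]
    · simp [State.setReg, eval, g3 k (by omega), h2, g2, hv]
    · intro r' hr'
      simp [State.setReg, State.tick, hr'.ne, g3 r' (by omega), h3 r' hr']
    · simp [State.setReg, State.tick, g6, h6, cost]; ring
    · have h8 : o.eval (υ.reg k) (υ.reg (k + 1)) ≤ V ^ κ := by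
        rw [g3 k (by omega), h2, g2, hv]
        exact this
      simp only [State.setReg, State.tick, sup_le_iff]
      exact ⟨g7.trans (max_le h7 (le_max_right _ _)), le_max_of_le_right h8⟩

end Expr

/-- Boolean expressions. -/
inductive BExpr : Type
  | bit (a : ℕ) (e : Expr) : BExpr
  | gate (g : Bool → Bool → Bool) (p q : BExpr) : BExpr
  | isZero (e : Expr) : BExpr

namespace BExpr

def eval : BExpr → Mem → Bool
  | bit a e, M => M.bit a (e.eval M)
  | gate g p q, M => g (p.eval M) (q.eval M)
  | isZero e, M => decide (e.eval M = 0)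

/-- A program that computes the value of an expression in the bit array `k`, at the position in
register `99`. -/
def code : BExpr → ℕ → Program
  | bit a e, k => .seq (e.code 100) (.gate (fun u _ => u) ⟨k, 99⟩ ⟨a, 100⟩ ⟨a, 100⟩)
  | gate g p q, k =>
    .seq (p.code k) (.seq (q.code (k + 1)) (.gate g ⟨k, 99⟩ ⟨k, 99⟩ ⟨k + 1, 99⟩))
  | isZero e, k => .seq (e.code 100) (.ifZero 100
      (.gate (fun _ _ => true) ⟨k, 99⟩ ⟨k, 99⟩ ⟨k, 99⟩)
      (.gate (fun _ _ => false) ⟨k, 99⟩ ⟨k, 99⟩ ⟨k, 99⟩))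

def cost : BExpr → ℕ
  | bit _ e => e.cost + 1
  | gate _ p q => p.cost + q.cost + 1
  | isZero e => e.cost + 2

/-- The registers and arrays are visible, the constants are at most `V` and integer expressions have
at most `κ` leaves. -/
def Ok (V κ : ℕ) : BExpr → Prop
  | bit a e => a < 100 ∧ e.Ok V ∧ e.leaves ≤ κ
  | gate _ p q => p.Ok V κ ∧ q.Ok V κ
  | isZero e => e.Ok V ∧ e.leaves ≤ κ

/-- Here the stack consists of the bit arrays from `k` on, all used at the position in register
`99`. Its value is irrelevant, as it does not change during the evaluation. -/
lemma run_code {V κ : ℕ} (hV : 2 ≤ V) {e : BExpr} (he : e.Ok V κ) {k : ℕ}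
    (hk : 100 ≤ k) (σ : State) (hM : σ.view.Le V) :
    ∃ τ, (e.code k).run σ = PMF.pure τ ∧ τ.bit k (τ.reg 99) = e.eval σ.view ∧
      (∀ r < 100, τ.reg r = σ.reg r) ∧
      τ.word = σ.word ∧ (∀ a < k, τ.bit a = σ.bit a) ∧ τ.time = σ.time + e.cost ∧
      τ.peak ≤ max σ.peak (V ^ κ) := by
  induction e generalizing k σ with
  | bit a e =>
    obtain ⟨ha, he, hκ⟩ := he
    obtain ⟨τ, h1, h2, h3, h4, h5, h6, h7⟩ := Expr.run_code hV he hκ le_rfl σ hM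
    refine ⟨τ.tick.setBit ⟨k, 99⟩ (τ.getBit ⟨a, 100⟩), ?_, ?_, h3, h4, ?_, ?_, h7⟩
    · simp only [code, Program.run, h1, PMF.pure_bind]
    · simp [State.setBit, State.tick, State.getBit, h2, h5, eval, State.view, ha]
    · intro a' ha'
      simp [State.setBit, State.tick, ha'.ne, h5]
    · simp [State.setBit, State.tick, h6, cost]; ring
  | isZero e =>
    obtain ⟨he, hκ⟩ := he
    obtain ⟨τ, h1, h2, h3, h4, h5, h6, h7⟩ := Expr.run_code hV he hκ le_rfl σ hM
    refine ⟨τ.tick.tick.setBit ⟨k, 99⟩ (decide (e.eval σ.view = 0)), ?_, ?_, h3, h4, ?_, ?_, h7⟩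
    · simp only [code, Program.run, h1, PMF.pure_bind, h2]
      by_cases h : e.eval σ.view = 0
      · simp [h]
      · simp [h]
    · simp [State.setBit, State.tick, eval]
    · intro a' ha'
      simp [State.setBit, State.tick, ha'.ne, h5]
    · simp [State.setBit, State.tick, h6, cost]; ring
  | gate g p q ihp ihq =>
    obtain ⟨τ, h1, h2, h3, h4, h5, h6, h7⟩ := ihp he.1 hk σ hM
    have hv : τ.view = σ.view := view_eq_of h3 h4 (fun a ha => h5 a (by omega))
    obtain ⟨υ, g1, g2, g3, g4, g5, g6, g7⟩ := ihq he.2 (Nat.le_succ_of_le hk) τ (by rwa [hv])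
    refine ⟨υ.tick.setBit ⟨k, 99⟩ (g (υ.getBit ⟨k, 99⟩) (υ.getBit ⟨k + 1, 99⟩)), ?_, ?_,
      fun r hr => (g3 r hr).trans (h3 r hr), g4.trans h4, ?_, ?_,
      g7.trans (max_le h7 (le_max_right _ _))⟩
    · simp only [code, Program.run, h1, PMF.pure_bind, g1]
    · have : υ.reg 99 = τ.reg 99 := g3 99 (by norm_num)
      rw [hv] at g2
      simp [State.setBit, State.tick, State.getBit, eval, g2]
      rw [this, g5 k (by omega), h2]
    · intro a' ha'
      simp [State.setBit, State.tick, ha'.ne]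
      rw [g5 a' (by omega), h5 a' ha']
    · simp [State.setBit, State.tick, g6, h6, cost]; ring

end BExpr

/-- Deterministic execution: from visible memory `M` the program ends with visible memory in `Q`
after at most `T` steps, writing no number above `W`. -/
def Tr (P : Program) (M : Mem) (Q : Mem → Prop) (T W : ℕ) : Prop :=
  ∀ σ : State, σ.view = M → ∃ τ, P.run σ = PMF.pure τ ∧ Q τ.view ∧ τ.time ≤ σ.time + T ∧
    τ.peak ≤ max σ.peak W

/-- Random execution: the final state is a function of a uniformly distributed element `a`. -/
def Rn (P : Program) (M : Mem) {α : Type} [Fintype α] [Nonempty α] (Q : α → Mem → Prop)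
    (T W : ℕ) : Prop :=
  ∀ σ : State, σ.view = M → ∃ g : α → State, P.run σ = (PMF.uniformOfFintype α).map g ∧
    ∀ a, Q a (g a).view ∧ (g a).time ≤ σ.time + T ∧ (g a).peak ≤ max σ.peak W

lemma Tr.mono {P : Program} {M : Mem} {Q Q' : Mem → Prop} {T T' W : ℕ} (h : Tr P M Q T W)
    (hQ : ∀ M, Q M → Q' M) (hT : T ≤ T') : Tr P M Q' T' W := by
  intro σ hσ
  obtain ⟨τ, h1, h2, h3, h4⟩ := h σ hσ
  exact ⟨τ, h1, hQ _ h2, by omega, h4⟩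

lemma Tr.seq {P P' : Program} {M : Mem} {Q Q' : Mem → Prop} {T T' W : ℕ} (h : Tr P M Q T W)
    (h' : ∀ M', Q M' → Tr P' M' Q' T' W) : Tr (.seq P P') M Q' (T + T') W := by
  intro σ hσ
  obtain ⟨τ, h1, h2, h3, h4⟩ := h σ hσ
  obtain ⟨υ, g1, g2, g3, g4⟩ := h' _ h2 τ rfl
  exact ⟨υ, by simp [Program.run, h1, g1], g2, by omega, by omega⟩

lemma Rn.mono {P : Program} {M : Mem} {α : Type} [Fintype α] [Nonempty α] {Q Q' : α → Mem → Prop}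
    {T T' W : ℕ} (h : Rn P M Q T W) (hQ : ∀ a M, Q a M → Q' a M) (hT : T ≤ T') :
    Rn P M Q' T' W := by
  intro σ hσ
  obtain ⟨g, h1, h2⟩ := h σ hσ
  exact ⟨g, h1, fun a => ⟨hQ _ _ (h2 a).1, by have := (h2 a).2.1; omega, (h2 a).2.2⟩⟩

lemma Tr.seq_rn {P P' : Program} {M : Mem} {Q : Mem → Prop} {α : Type} [Fintype α] [Nonempty α]
    {Q' : α → Mem → Prop} {T T' W : ℕ} (h : Tr P M Q T W)
    (h' : ∀ M', Q M' → Rn P' M' Q' T' W) : Rn (.seq P P') M Q' (T + T') W := by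
  intro σ hσ
  obtain ⟨τ, h1, h2, h3, h4⟩ := h σ hσ
  obtain ⟨g, g1, g2⟩ := h' _ h2 τ rfl
  refine ⟨g, by simp [Program.run, h1, g1], fun a => ⟨(g2 a).1, ?_, ?_⟩⟩
  · have := (g2 a).2.1; omega
  · have := (g2 a).2.2; omega

lemma Rn.seq_tr {P P' : Program} {M : Mem} {α : Type} [Fintype α] [Nonempty α]
    {Q Q' : α → Mem → Prop} {T T' W : ℕ} (h : Rn P M Q T W)
    (h' : ∀ a M', Q a M' → Tr P' M' (Q' a) T' W) : Rn (.seq P P') M Q' (T + T') W := by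
  intro σ hσ
  obtain ⟨g, g1, g2⟩ := h σ hσ
  choose τ h1 h2 h3 h4 using fun a => h' a _ (g2 a).1 (g a) rfl
  refine ⟨τ, ?_, fun a => ⟨h2 a, ?_, ?_⟩⟩
  · simp only [Program.run, g1, PMF.bind_map]
    rw [← PMF.bind_pure_comp]
    congr 1
    ext1 a
    exact h1 a
  · have := (g2 a).2.1; have := h3 a; omega
  · have := (g2 a).2.2; have := h4 a; omega

lemma uniformOfFintype_map_equiv {α β : Type} [Fintype α] [Nonempty α] [Fintype β] [Nonempty β]
    (e : α ≃ β) : (PMF.uniformOfFintype α).map e = PMF.uniformOfFintype β := by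
  classical
  ext b
  rw [PMF.map_apply, tsum_eq_single (e.symm b)]
  · simp [Fintype.card_congr e]
  · intro a ha
    rw [if_neg]
    rintro rfl
    simp at ha

/-- Two successive independent draws are one uniform draw from the product; this is what makes `Rn`
closed under composition. -/
lemma uniformOfFintype_bind_map {α β γ : Type} [Fintype α] [Nonempty α] [Fintype β] [Nonempty β]
    (g : α → β → γ) :
    ((PMF.uniformOfFintype α).bind fun a => (PMF.uniformOfFintype β).map (g a)) =
      (PMF.uniformOfFintype (α × β)).map fun ab => g ab.1 ab.2 := by
  classical
  ext c
  rw [PMF.bind_apply, PMF.map_apply, tsum_fintype, tsum_fintype, Fintype.sum_prod_type]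
  refine Finset.sum_congr rfl fun a _ => ?_
  rw [PMF.map_apply, tsum_fintype, Finset.mul_sum]
  refine Finset.sum_congr rfl fun b _ => ?_
  split_ifs
  · simp only [PMF.uniformOfFintype_apply, Fintype.card_prod, Nat.cast_mul]
    rw [ENNReal.mul_inv (by simp) (by simp)]
  · simp

lemma Rn.equiv {P : Program} {M : Mem} {α β : Type} [Fintype α] [Nonempty α] [Fintype β]
    [Nonempty β] {Q : α → Mem → Prop} {T W : ℕ} (h : Rn P M Q T W) (e : β ≃ α) :
    Rn P M (fun b => Q (e b)) T W := by
  intro σ hσ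
  obtain ⟨g, g1, g2⟩ := h σ hσ
  refine ⟨g ∘ e, ?_, fun b => g2 (e b)⟩
  rw [g1, ← uniformOfFintype_map_equiv e, PMF.map_comp]

lemma Rn.seq {P P' : Program} {M : Mem} {α β : Type} [Fintype α] [Nonempty α] [Fintype β]
    [Nonempty β] {Q : α → Mem → Prop} {Q' : α → β → Mem → Prop} {T T' W : ℕ} (h : Rn P M Q T W)
    (h' : ∀ a M', Q a M' → Rn P' M' (Q' a) T' W) :
    Rn (.seq P P') M (fun ab : α × β => Q' ab.1 ab.2) (T + T') W := by
  intro σ hσ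
  obtain ⟨g, g1, g2⟩ := h σ hσ
  choose k h1 h2 using fun a => h' a _ (g2 a).1 (g a) rfl
  refine ⟨fun ab => k ab.1 ab.2, ?_, fun ab => ⟨(h2 _ _).1, ?_, ?_⟩⟩
  · rw [← uniformOfFintype_bind_map]
    simp only [Program.run, g1, PMF.bind_map]
    congr 1
    ext1 a
    exact h1 a
  · have := (g2 ab.1).2.1; have := (h2 ab.1 ab.2).2.1; dsimp only; omega
  · have := (g2 ab.1).2.2; have := (h2 ab.1 ab.2).2.2; dsimp only; omega

/-- The definition splits off the first pass, whereas invariants need the last one split off. -/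
lemma iterate_succ' (step : State → PMF State) (n : ℕ) (σ : State) :
    iterate step (n + 1) σ = (iterate step n σ).bind step := by
  induction n generalizing σ with
  | zero =>
    simp [iterate]
  | succ n ih =>
    rw [iterate, iterate, PMF.bind_bind]
    congr 1
    ext1 τ
    exact ih τ

/-- Assign the value of an expression to a register. -/
def assign (r : ℕ) (e : Expr) : Program :=
  -- The value is complete in register `100` before `r` is cleared, so `e` may mention `r`.
  .seq (e.code 100) (.seq (.const r 0) (.op .add r r 100))

/-- Assign the value of an expression to a bit. -/
def assignBit (a : ℕ) (e : Expr) (be : BExpr) : Program :=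
  .seq (be.code 100) (.seq (e.code 100) (.gate (fun u _ => u) ⟨a, 100⟩ ⟨100, 99⟩ ⟨100, 99⟩))

/-- Repeat a program as often as an expression says. -/
def repeatProg (n : Expr) (P : Program) : Program := .seq (n.code 100) (.loop 100 P)

section Rules

variable {V κ : ℕ}

lemma tr_assign (hV : 2 ≤ V) {M : Mem} (hM : M.Le V) {r : ℕ} (hr : r < 100) {e : Expr}
    (he : e.Ok V) (hκ : e.leaves ≤ κ) :
    Tr (assign r e) M (· = M.setReg r (e.eval M)) (e.cost + 2) (V ^ κ) := by
  rintro σ rfl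
  obtain ⟨τ, h1, h2, h3, h4, h5, h6, h7⟩ := Expr.run_code hV he hκ le_rfl σ hM
  have hr' : (100 : ℕ) ≠ r := by omega
  have hle : e.eval σ.view ≤ V ^ κ :=
    (Expr.eval_le hV hM he).trans (Nat.pow_le_pow_right (by omega) hκ)
  refine ⟨(τ.tick.setReg r 0).tick.setReg r (e.eval σ.view), ?_, ?_, ?_, ?_⟩
  · simp only [assign, Program.run, h1, PMF.pure_bind]
    simp [State.setReg, State.tick, Op.eval, hr', h2]
  · have hv : τ.view = σ.view := view_eq_of h3 h4 fun a _ => by rw [h5]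
    rw [view_setReg hr, ← hv]
    refine Mem.ext ?_ rfl rfl
    have : ((τ.tick.setReg r 0).tick.view).reg = Function.update τ.view.reg r 0 :=
      congrArg Mem.reg (view_setReg (σ := τ.tick) hr 0)
    simp [Mem.setReg, this]
  · simp [State.setReg, State.tick, h6]; omega
  · simp [State.setReg, State.tick]; omega

lemma tr_assignBit (hV : 2 ≤ V) {M : Mem} (hM : M.Le V) {a : ℕ} (ha : a < 100) {e : Expr}
    (he : e.Ok V) (hκ : e.leaves ≤ κ) {be : BExpr} (hbe : be.Ok V κ) :
    Tr (assignBit a e be) M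
      (· = M.setBits a (Function.update (M.bit a) (e.eval M) (be.eval M)))
      (e.cost + be.cost + 1) (V ^ κ) := by
  rintro σ rfl
  obtain ⟨τ, h1, h2, h3, h4, h5, h6, h7⟩ := BExpr.run_code hV hbe le_rfl σ hM
  have hv : τ.view = σ.view := view_eq_of h3 h4 h5
  obtain ⟨υ, g1, g2, g3, g4, g5, g6, g7⟩ := Expr.run_code hV he hκ le_rfl τ (by rwa [hv])
  have hv' : υ.view = τ.view := view_eq_of g3 g4 fun a _ => by rw [g5]
  refine ⟨υ.tick.setBit ⟨a, 100⟩ (be.eval σ.view), ?_, ?_, ?_, ?_⟩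
  · simp only [assignBit, Program.run, h1, PMF.pure_bind, g1]
    congr 2
    simp only [State.getBit]
    rw [g5, g3 99 (by norm_num), h2]
  · rw [view_setBit ha]
    have : υ.tick.view = σ.view := hv'.trans hv
    rw [this]
    simp only [State.tick, g2, hv]
  · simp [State.setBit, State.tick, h6, g6]; omega
  · simp only [State.setBit, State.tick]; omega

/-- The bound `T k` may vary with the pass: the levels of the recursion have geometrically growing
cost. -/
lemma tr_repeatProg (hV : 2 ≤ V) {M : Mem} (hM : M.Le V) {n : Expr} (hn : n.Ok V)
    (hκ : n.leaves ≤ κ) {N : ℕ} (hN : n.eval M = N) {P : Program} (I : ℕ → Mem → Prop) (T : ℕ → ℕ)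
    (h0 : I 0 M)
    (hstep : ∀ k < N, ∀ M', I k M' → Tr P M' (I (k + 1)) (T k) (V ^ κ)) :
    Tr (repeatProg n P) M (I N) (n.cost + 1 + ∑ k ∈ Finset.range N, (T k + 1)) (V ^ κ) := by
  rintro σ rfl
  obtain ⟨τ, h1, h2, h3, h4, h5, h6, h7⟩ := Expr.run_code hV hn hκ le_rfl σ hM
  have hv : τ.view = σ.view := view_eq_of h3 h4 fun a _ => by rw [h5]
  have key : ∀ k ≤ N, ∃ υ, iterate (fun τ => P.run τ.tick) k τ.tick = PMF.pure υ ∧ I k υ.view ∧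
      υ.time ≤ τ.tick.time + ∑ j ∈ Finset.range k, (T j + 1) ∧
      υ.peak ≤ max τ.peak (V ^ κ) := by
    intro k hk
    induction k with
    | zero =>
      refine ⟨τ.tick, rfl, ?_, by simp, le_max_left _ _⟩
      have : τ.tick.view = σ.view := hv
      rwa [this]
    | succ k ih =>
      obtain ⟨υ, g1, g2, g3, g4⟩ := ih (by omega)
      obtain ⟨ξ, f1, f2, f3, f4⟩ := hstep k (by omega) υ.view g2 υ.tick rfl
      refine ⟨ξ, ?_, f2, ?_, ?_⟩
      · rw [iterate_succ', g1, PMF.pure_bind, f1]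
      · rw [Finset.sum_range_succ]
        simp only [State.tick] at f3 g3 ⊢
        omega
      · simp only [State.tick] at f4
        omega
  obtain ⟨υ, g1, g2, g3, g4⟩ := key N le_rfl
  refine ⟨υ, ?_, g2, ?_, ?_⟩
  · simp only [repeatProg, Program.run, h1, PMF.pure_bind, h2, hN, g1]
  · simp only [State.tick] at g3
    omega
  · omega

lemma rn_repeatProg (hV : 2 ≤ V) {M : Mem} (hM : M.Le V) {n : Expr} (hn : n.Ok V)
    (hκ : n.leaves ≤ κ) {N : ℕ} (hN : n.eval M = N) {P : Program} {γ : Type} [Fintype γ]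
    [Nonempty γ] (I : (k : ℕ) → (Fin k → γ) → Mem → Prop) {T : ℕ}
    (h0 : I 0 Fin.elim0 M)
    (hstep : ∀ k < N, ∀ f M', I k f M' →
      Rn P M' (fun v : γ => I (k + 1) (Fin.snoc (α := fun _ => γ) f v)) T (V ^ κ)) :
    Rn (repeatProg n P) M (I N) (n.cost + 1 + N * (T + 1)) (V ^ κ) := by
  rintro σ rfl
  obtain ⟨τ, h1, h2, h3, h4, h5, h6, h7⟩ := Expr.run_code hV hn hκ le_rfl σ hM
  have hv : τ.view = σ.view := view_eq_of h3 h4 fun a _ => by rw [h5]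
  have key : ∀ k ≤ N, ∃ g : (Fin k → γ) → State, iterate (fun τ => P.run τ.tick) k τ.tick =
      (PMF.uniformOfFintype (Fin k → γ)).map g ∧ ∀ f, I k f (g f).view ∧
      (g f).time ≤ τ.tick.time + k * (T + 1) ∧ (g f).peak ≤ max τ.peak (V ^ κ) := by
    intro k hk
    induction k with
    | zero =>
      refine ⟨fun _ => τ.tick, ?_, fun f => ⟨?_, by simp, le_max_left _ _⟩⟩
      · rw [show (fun _ : Fin 0 → γ => τ.tick) = Function.const _ τ.tick from rfl, PMF.map_const]
        rfl
      · have : τ.tick.view = σ.view := hv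
        rw [this, Subsingleton.elim f Fin.elim0]
        exact h0
    | succ k ih =>
      obtain ⟨g, g1, g2⟩ := ih (by omega)
      choose ξ f1 f2 using fun f => hstep k (by omega) f (g f).view (g2 f).1 (g f).tick rfl
      refine ⟨fun f => ξ (fun i => f i.castSucc) (f (Fin.last k)), ?_, fun f => ⟨?_, ?_, ?_⟩⟩
      · rw [iterate_succ', g1, PMF.bind_map]
        have e1 : ((fun τ : State => P.run τ.tick) ∘ g) =
            fun f => (PMF.uniformOfFintype γ).map (ξ f) := funext fun f => f1 f
        rw [e1, uniformOfFintype_bind_map]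
        -- Appending the new draw identifies `(Fin k → γ) × γ` with `Fin (k + 1) → γ`.
        rw [← uniformOfFintype_map_equiv
          ((Equiv.prodComm _ _).trans (Fin.snocEquiv fun _ : Fin (k + 1) => γ)), PMF.map_comp]
        congr 1
        ext1 fv
        simp [Fin.snocEquiv]
      · have := (f2 (fun i => f i.castSucc) (f (Fin.last k))).1
        have e2 : Fin.snoc (α := fun _ => γ) (fun i : Fin k => f i.castSucc) (f (Fin.last k)) = f :=
          Fin.snoc_init_self f
        dsimp only at this
        rwa [e2] at this
      · have h8 := (f2 (fun i => f i.castSucc) (f (Fin.last k))).2.1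
        have h9 := (g2 (fun i => f i.castSucc)).2.1
        simp only [State.tick] at h8 h9 ⊢
        rw [add_mul, one_mul]
        omega
      · have h8 := (f2 (fun i => f i.castSucc) (f (Fin.last k))).2.2
        have h9 := (g2 (fun i => f i.castSucc)).2.2
        simp only [State.tick] at h8 h9 ⊢
        omega
  obtain ⟨g, g1, g2⟩ := key N le_rfl
  refine ⟨g, ?_, fun f => ⟨(g2 f).1, ?_, ?_⟩⟩
  · simp only [repeatProg, Program.run, h1, PMF.pure_bind, h2, hN, g1]
  · have := (g2 f).2.1
    simp only [State.tick] at this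
    omega
  · have := (g2 f).2.2
    omega

end Rules

/-! ### Counted loops over arrays -/

/-- Replace the word array `a`. -/
def Mem.setWords (M : Mem) (a : ℕ) (g : ℕ → ℕ) : Mem :=
  { M with word := Function.update M.word a g }

/-- Run `P` with register `3` counting from `0` to `n - 1`. -/
def forLoop (n : Expr) (P : Program) : Program :=
  .seq (assign 3 (.const 0))
    (repeatProg n (.seq P (assign 3 (.op .add (.reg 3) (.const 1)))))

/-- For each value of register `3` below `n`, assign a bit of the array `a`. -/
def scatter (a : ℕ) (n dst : Expr) (be : BExpr) : Program := forLoop n (assignBit a dst be)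

/-- Fill the first `n` places of the bit array `a`. -/
def mapBits (a : ℕ) (n : Expr) (be : BExpr) : Program := scatter a n (.reg 3) be

/-- Fill the first `n` places of the word array `a` with random numbers below register `u`. -/
def drawWords (a : ℕ) (n : Expr) (u : ℕ) : Program :=
  forLoop n (.seq (.drawWord 100 u) (.store a 3 100))

/-- Fill the first `n` places of the bit array `a` with random bits. -/
def drawBits (a : ℕ) (n : Expr) : Program := forLoop n (.drawBit ⟨a, 3⟩)

section Loops

variable {V κ : ℕ}

/-- `G t` is the array `a` after `t` assignments. The assigned value may depend on it, as is needed
for accumulating a disjunction. -/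
lemma tr_scatter (hV : 2 ≤ V) (hκ : 2 ≤ κ) {M : Mem} (hM : M.Le V) {a : ℕ} (ha : a < 100)
    {n dst : Expr} {be : BExpr} (hn : n.Ok V) (hnκ : n.leaves ≤ κ) (hd : dst.Ok V)
    (hdκ : dst.leaves ≤ κ) (hbe : be.Ok V κ) {N : ℕ} (hN : n.eval (M.setReg 3 0) = N) (hNV : N ≤ V)
    (G : ℕ → ℕ → Bool) (h0 : G 0 = M.bit a)
    (hG : ∀ t < N, G (t + 1) = Function.update (G t)
      (dst.eval ((M.setReg 3 t).setBits a (G t))) (be.eval ((M.setReg 3 t).setBits a (G t)))) :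
    Tr (scatter a n dst be) M (· = (M.setReg 3 N).setBits a (G N))
      ((N + 1) * (n.cost + dst.cost + be.cost + 20)) (V ^ κ) := by
  refine Tr.mono (Tr.seq (tr_assign hV hM (by norm_num) (Nat.zero_le V) (Nat.le_of_succ_le hκ))
    (Q' := (· = (M.setReg 3 N).setBits a (G N))) (T' := n.cost + 1 +
      ∑ k ∈ Finset.range N, ((dst.cost + be.cost + 1 + 6) + 1)) ?_) (fun _ h => h) ?_
  · rintro M' rfl
    refine tr_repeatProg hV (hM.setReg _ (Nat.zero_le V)) hn hnκ hN
      (fun t M' => M' = (M.setReg 3 t).setBits a (G t)) _ ?_ ?_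
    · simp [Mem.setBits, Mem.setReg, h0]
    · rintro t ht M' rfl
      have hMt : ((M.setReg 3 t).setBits a (G t)).Le V :=
        (hM.setReg 3 (ht.le.trans hNV)).setBits a (G t)
      refine Tr.mono (Tr.seq (tr_assignBit hV hMt ha hd hdκ hbe)
        (Q' := (· = (M.setReg 3 (t + 1)).setBits a (G (t + 1)))) (T' := 6) ?_)
        (fun _ h => h) le_rfl
      rintro M' rfl
      refine Tr.mono (tr_assign hV (hMt.setBits _ _) (by norm_num)
        (show Expr.Ok V (.op .add (.reg 3) (.const 1)) from ⟨by simp [Expr.Ok], by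
          simp [Expr.Ok]; omega⟩) hκ) ?_ le_rfl
      rintro M' rfl
      rw [hG t ht]
      simp [Mem.setBits, Mem.setReg, Expr.eval, Op.eval]
  · simp only [Finset.sum_const, Finset.card_range, smul_eq_mul, Expr.cost]
    nlinarith [Nat.zero_le (N * n.cost), Nat.zero_le N]

lemma tr_mapBits (hV : 2 ≤ V) (hκ : 2 ≤ κ) {M : Mem} (hM : M.Le V) {a : ℕ} (ha : a < 100)
    {n : Expr} {be : BExpr} (hn : n.Ok V) (hnκ : n.leaves ≤ κ) (hbe : be.Ok V κ) {N : ℕ}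
    (hN : n.eval (M.setReg 3 0) = N) (hNV : N ≤ V) (val : ℕ → Bool)
    (hval : ∀ t < N, ∀ g, be.eval ((M.setReg 3 t).setBits a g) = val t) :
    Tr (mapBits a n be) M
      (· = (M.setReg 3 N).setBits a fun p => if p < N then val p else M.bit a p)
      ((N + 1) * (n.cost + be.cost + 22)) (V ^ κ) := by
  refine Tr.mono (tr_scatter hV hκ hM ha hn hnκ (dst := .reg 3) (by simp [Expr.Ok])
    (Nat.le_of_succ_le hκ) hbe hN hNV (fun t p => if p < t then val p else M.bit a p) (by simp) ?_)
    (fun _ h => h) (by simp only [Expr.cost]; nlinarith)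
  intro t ht
  rw [hval t ht]
  ext p
  have : Expr.eval (.reg 3) ((M.setReg 3 t).setBits a
      fun p => if p < t then val p else M.bit a p) = t := by
    simp [Expr.eval, Mem.setReg, Mem.setBits]
  rw [this]
  by_cases hp : p = t
  · subst hp; simp
  · have : p < t + 1 ↔ p < t := by omega
    simp [hp, this]

lemma rn_forLoop (hV : 2 ≤ V) (hκ : 2 ≤ κ) {M : Mem} (hM : M.Le V) {n : Expr} (hn : n.Ok V)
    (hnκ : n.leaves ≤ κ) {N : ℕ} (hN : n.eval (M.setReg 3 0) = N) {P : Program}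
    {γ : Type} [Fintype γ] [Nonempty γ] (S : (k : ℕ) → (Fin k → γ) → Mem)
    (h0 : M.setReg 3 0 = S 0 Fin.elim0) {T : ℕ}
    (hstep : ∀ k < N, ∀ f, Rn P (S k f) (fun (v : γ) M' =>
      M'.setReg 3 (M'.reg 3 + 1) = S (k + 1) (Fin.snoc (α := fun _ => γ) f v) ∧ M'.Le V)
      T (V ^ κ)) :
    Rn (forLoop n P) M (fun (f : Fin N → γ) M' => M' = S N f) ((N + 1) * (n.cost + T + 20))
      (V ^ κ) := by
  refine Rn.mono (Tr.seq_rn (tr_assign hV hM (by norm_num) (Nat.zero_le V)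
    (Nat.le_of_succ_le hκ)) (Q' := fun (f : Fin N → γ) M' => M' = S N f)
    (T' := n.cost + 1 + N * (T + 6 + 1)) ?_) (fun _ _ h => h) ?_
  · rintro M' rfl
    refine rn_repeatProg hV (hM.setReg _ (Nat.zero_le V)) hn hnκ hN
      (fun k f M' => M' = S k f) h0 ?_
    rintro k hk f M' rfl
    refine Rn.seq_tr (hstep k hk f) ?_
    rintro v M' ⟨h1, h2⟩
    rw [← h1]
    exact Tr.mono (tr_assign hV h2 (by norm_num)
        (show Expr.Ok V (.op .add (.reg 3) (.const 1)) from ⟨by simp [Expr.Ok], by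
          simp [Expr.Ok]; omega⟩) hκ) (fun _ h => h) le_rfl
  · simp only [Expr.cost]
    nlinarith [Nat.zero_le (N * n.cost), Nat.zero_le N]

lemma uniformBelow_eq (d : ℕ) [NeZero d] :
    uniformBelow d = (PMF.uniformOfFintype (Fin d)).map Fin.val := by
  rw [uniformBelow, dif_neg (NeZero.ne d)]

lemma rn_drawStore {M : Mem} {d : ℕ} [NeZero d] {a u W : ℕ} (hu : u < 100) (hd : M.reg u = d)
    (hW : d ≤ W) :
    Rn (.seq (.drawWord 100 u) (.store a 3 100)) M
      (fun (v : Fin d) M' => M' = M.setWord a (M.reg 3) v) 2 W := by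
  rintro σ rfl
  refine ⟨fun v => (σ.tick.setReg 100 v).tick.setWord a (σ.reg 3) v, ?_, fun v => ⟨?_, ?_, ?_⟩⟩
  · have hσ : σ.reg u = d := by simpa [State.view, hu] using hd
    simp only [Program.run]
    rw [hσ, uniformBelow_eq, PMF.map_comp, PMF.bind_map, ← PMF.bind_pure_comp]
    congr 1
  · have h1 : (σ.tick.setReg 100 v).tick.view = σ.view :=
      view_eq_of (fun r hr => by
        have : r ≠ 100 := by omega
        simp [State.setReg, State.tick, this]) rfl
        fun _ _ => rfl
    rw [view_setWord, h1]
    simp [State.view]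
  · simp [State.setWord, State.setReg, State.tick]
  · have := v.2
    simp only [State.setWord, State.setReg, State.tick]
    omega

lemma rn_drawBit {M : Mem} {a W : ℕ} (ha : a < 100) :
    Rn (.drawBit ⟨a, 3⟩) M
      (fun (v : Bool) M' => M' = M.setBits a (Function.update (M.bit a) (M.reg 3) v)) 1 W := by
  rintro σ rfl
  refine ⟨fun v => σ.tick.setBit ⟨a, 3⟩ v, rfl, fun v => ⟨?_, le_rfl, le_max_left _ _⟩⟩
  rw [view_setBit ha]
  rfl

lemma snoc_dite_eq_update {γ δ : Type} (c : γ → δ) (w : ℕ → δ) {k : ℕ} (f : Fin k → γ) (v : γ) :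
    (fun t => if h : t < k + 1 then c (Fin.snoc (α := fun _ => γ) f v ⟨t, h⟩) else w t) =
      Function.update (fun t => if h : t < k then c (f ⟨t, h⟩) else w t) k (c v) := by
  ext t
  rcases lt_trichotomy t k with h | h | h
  · simp [h, h.ne, Nat.lt_succ_of_lt h, Fin.snoc]
  · subst h; simp [Fin.snoc]
  · have h1 : ¬ t < k + 1 := by omega
    have h2 : ¬ t < k := by omega
    simp [h1, h2, h.ne']

lemma rn_drawWords (hV : 2 ≤ V) (hκ : 2 ≤ κ) {M : Mem} (hM : M.Le V) {n : Expr} (hn : n.Ok V)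
    (hnκ : n.leaves ≤ κ) {N : ℕ} (hN : n.eval (M.setReg 3 0) = N) (hNV : N ≤ V) {d : ℕ} [NeZero d]
    {a u : ℕ} (hu : u < 100) (hu3 : u ≠ 3) (hd : M.reg u = d) :
    Rn (drawWords a n u) M (fun (f : Fin N → Fin d) M' => M' = (M.setReg 3 N).setWords a
      fun t => if h : t < N then (f ⟨t, h⟩ : ℕ) else M.word a t)
      ((N + 1) * (n.cost + 22)) (V ^ κ) := by
  have hdV : d ≤ V := hd ▸ hM.1 u
  have hVκ : V ≤ V ^ κ := Nat.le_self_pow (by omega) V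
  have hle : ∀ k ≤ N, ∀ f : Fin k → Fin d, ((M.setReg 3 k).setWords a
      fun t => if h : t < k then (f ⟨t, h⟩ : ℕ) else M.word a t).Le V := by
    intro k hk f
    have h1 := hM.setReg 3 (hk.trans hNV)
    refine ⟨h1.1, fun a' i => ?_⟩
    by_cases ha : a' = a
    · subst ha
      simp only [Mem.setWords, Function.update_self]
      split_ifs with h
      · exact (f ⟨i, h⟩).2.le.trans hdV
      · exact hM.2 _ _
    · simpa [Mem.setWords, Mem.setReg, ha] using hM.2 a' i
  refine rn_forLoop hV hκ hM hn hnκ hN (fun k (f : Fin k → Fin d) => (M.setReg 3 k).setWords a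
      fun t => if h : t < k then (f ⟨t, h⟩ : ℕ) else M.word a t) ?_ ?_
  · simp [Mem.setWords, Mem.setReg]
  · intro k hk f
    refine Rn.mono (rn_drawStore (d := d) hu (by simpa [Mem.setWords, Mem.setReg, hu3] using hd)
      (hdV.trans hVκ)) ?_ le_rfl
    rintro v M' rfl
    refine ⟨?_, (hle k hk.le f).setWord _ _ (v.2.le.trans hdV)⟩
    rw [snoc_dite_eq_update (fun v : Fin d => (v : ℕ))]
    simp [Mem.setWords, Mem.setReg, Mem.setWord]

lemma rn_drawBits (hV : 2 ≤ V) (hκ : 2 ≤ κ) {M : Mem} (hM : M.Le V) {n : Expr} (hn : n.Ok V)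
    (hnκ : n.leaves ≤ κ) {N : ℕ} (hN : n.eval (M.setReg 3 0) = N) (hNV : N ≤ V) {a : ℕ}
    (ha : a < 100) :
    Rn (drawBits a n) M (fun (f : Fin N → Bool) M' => M' = (M.setReg 3 N).setBits a
      fun t => if h : t < N then f ⟨t, h⟩ else M.bit a t)
      ((N + 1) * (n.cost + 21)) (V ^ κ) := by
  have hle : ∀ k ≤ N, ∀ f : Fin k → Bool, ((M.setReg 3 k).setBits a
      fun t => if h : t < k then f ⟨t, h⟩ else M.bit a t).Le V :=
    fun k hk f => (hM.setReg 3 (hk.trans hNV)).setBits _ _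
  refine rn_forLoop hV hκ hM hn hnκ hN (fun k f => (M.setReg 3 k).setBits a
      fun t => if h : t < k then f ⟨t, h⟩ else M.bit a t) ?_ ?_
  · simp [Mem.setBits, Mem.setReg]
  · intro k hk f
    refine Rn.mono (rn_drawBit ha) ?_ le_rfl
    rintro v M' rfl
    refine ⟨?_, (hle k hk.le f).setBits _ _⟩
    rw [snoc_dite_eq_update (fun v : Bool => v)]
    simp [Mem.setReg, Mem.setBits]

end Loops

/-! ### The pseudo-product on arrays -/

section PseudoProduct

open Finset

/-- Block `(p, q)` of size `h` of a matrix. -/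
def block (h p q : ℕ) (X : ℕ → ℕ → ZMod 2) : ℕ → ℕ → ZMod 2 :=
  fun u v => X (p * h + u) (q * h + v)

/-- The pseudo-product of matrices whose indices are numbers below `2 ^ n * b`. -/
def natPseudoProduct (b : ℕ) : ℕ → (ℕ → ℕ → ZMod 2) → (ℕ → ℕ → ZMod 2) → ℕ → ℕ → ZMod 2
  | 0, X, Y, x, y => ∑ k ∈ range b, X x k * Y k y
  | n + 1, X, Y, x, y => ∑ r ∈ range 2,
      if x / (2 ^ n * b) + y / (2 ^ n * b) + r = 0 then 0 else
        natPseudoProduct b n (block (2 ^ n * b) (x / (2 ^ n * b)) r X)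
          (block (2 ^ n * b) r (y / (2 ^ n * b)) Y) (x % (2 ^ n * b)) (y % (2 ^ n * b))

/-- The coefficients of the left factors in the decomposition of rank `6`. -/
def leftCoeff (r q : ℕ) : Bool := ([14, 12, 2, 4, 15, 10].getD r 0).testBit q

/-- The coefficients of the right factors in the decomposition of rank `6`. -/
def rightCoeff (r q : ℕ) : Bool := ([14, 12, 4, 15, 2, 10].getD r 0).testBit q

/-- The coefficients of the results in the decomposition of rank `6`. -/
def outCoeff (q r : ℕ) : Bool := ([14, 10, 15, 4, 2, 12].getD r 0).testBit q

/-- The identity behind the algorithm, a finite check: over `GF(2)` the tensor of 2×2 matrix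
multiplication without its term `(0, 0, 0)` has rank at most six. -/
lemma sum_coeff : ∀ p < 2, ∀ q < 2, ∀ i < 4, ∀ j < 4,
    ∑ r ∈ range 6, toGF2 (outCoeff (2 * p + q) r) * (toGF2 (leftCoeff r i) * toGF2 (rightCoeff r j)) =
      if i / 2 = p ∧ i % 2 = j / 2 ∧ j % 2 = q ∧ p + q + j / 2 ≠ 0 then 1 else 0 := by
  decide

/-- The linear combination of the four blocks of size `h` with the coefficients `α r`. -/
def blockComb (α : ℕ → ℕ → Bool) (h r : ℕ) (X : ℕ → ℕ → ZMod 2) : ℕ → ℕ → ZMod 2 :=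
  fun u v => ∑ q ∈ range 4, toGF2 (α r q) * block h (q / 2) (q % 2) X u v

/-- Bilinearity, by which a product of combinations of blocks expands into products of blocks. -/
lemma natPseudoProduct_sum (b n k l : ℕ) (α β : ℕ → ZMod 2) (X Y : ℕ → ℕ → ℕ → ZMod 2) (x y : ℕ) :
    natPseudoProduct b n (fun u v => ∑ i ∈ range k, α i * X i u v)
      (fun u v => ∑ j ∈ range l, β j * Y j u v) x y =
      ∑ i ∈ range k, ∑ j ∈ range l, α i * β j * natPseudoProduct b n (X i) (Y j) x y := by
  induction n generalizing X Y x y with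
  | zero =>
    simp only [natPseudoProduct, sum_mul_sum]
    rw [sum_comm]
    refine sum_congr rfl fun i _ => ?_
    rw [sum_comm]
    refine sum_congr rfl fun j _ => ?_
    rw [mul_sum]
    exact sum_congr rfl fun z _ => by ring
  | succ n ih =>
    have h : ∀ r, natPseudoProduct b n
        (block (2 ^ n * b) (x / (2 ^ n * b)) r fun u v => ∑ i ∈ range k, α i * X i u v)
        (block (2 ^ n * b) r (y / (2 ^ n * b)) fun u v => ∑ j ∈ range l, β j * Y j u v)
        (x % (2 ^ n * b)) (y % (2 ^ n * b)) = _ := fun r =>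
      ih (fun i => block (2 ^ n * b) (x / (2 ^ n * b)) r (X i))
        (fun j => block (2 ^ n * b) r (y / (2 ^ n * b)) (Y j)) _ _
    simp only [natPseudoProduct, h]
    have e : ∀ (c : Prop) [Decidable c] (f : ℕ → ℕ → ZMod 2),
        (if c then 0 else ∑ i ∈ range k, ∑ j ∈ range l, f i j) =
          ∑ i ∈ range k, ∑ j ∈ range l, if c then 0 else f i j := by
      intro c _ f
      split_ifs <;> simp
    simp only [e]
    rw [sum_comm]
    refine sum_congr rfl fun i _ => ?_
    rw [sum_comm]
    refine sum_congr rfl fun j _ => ?_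
    rw [mul_sum]
    exact sum_congr rfl fun r _ => by split_ifs <;> simp

/-- One level of the recursion with six products. -/
lemma natPseudoProduct_succ (b n : ℕ) (X Y : ℕ → ℕ → ZMod 2) {x y : ℕ}
    (hx : x / (2 ^ n * b) < 2) (hy : y / (2 ^ n * b) < 2) :
    natPseudoProduct b (n + 1) X Y x y = ∑ r ∈ range 6,
      toGF2 (outCoeff (2 * (x / (2 ^ n * b)) + y / (2 ^ n * b)) r) *
        natPseudoProduct b n (blockComb leftCoeff (2 ^ n * b) r X)
          (blockComb rightCoeff (2 ^ n * b) r Y) (x % (2 ^ n * b)) (y % (2 ^ n * b)) := by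
  -- `sum_coeff` contracted with arbitrary values `P i j` in place of the products of blocks `i` and
  -- `j`.
  have key : ∀ p < 2, ∀ q < 2, ∀ P : ℕ → ℕ → ZMod 2,
      ∑ r ∈ range 6, toGF2 (outCoeff (2 * p + q) r) *
        ∑ i ∈ range 4, ∑ j ∈ range 4, toGF2 (leftCoeff r i) * toGF2 (rightCoeff r j) * P i j =
      ∑ r ∈ range 2, if p + q + r = 0 then 0 else P (2 * p + r) (2 * r + q) := by
    intro p hp q hq P
    calc _ = ∑ i ∈ range 4, ∑ j ∈ range 4, (∑ r ∈ range 6, toGF2 (outCoeff (2 * p + q) r) *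
          (toGF2 (leftCoeff r i) * toGF2 (rightCoeff r j))) * P i j := by
          simp only [mul_sum, sum_mul]
          rw [sum_comm]
          refine sum_congr rfl fun i _ => ?_
          rw [sum_comm]
          exact sum_congr rfl fun j _ => sum_congr rfl fun r _ => by ring
      _ = ∑ i ∈ range 4, ∑ j ∈ range 4,
          (if i / 2 = p ∧ i % 2 = j / 2 ∧ j % 2 = q ∧ p + q + j / 2 ≠ 0 then 1 else 0) * P i j :=
          sum_congr rfl fun i hi => sum_congr rfl fun j hj => by
            rw [sum_coeff p hp q hq i (mem_range.mp hi) j (mem_range.mp hj)]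
      _ = _ := by
          interval_cases p <;> interval_cases q <;> simp [sum_range_succ]
  have h := key _ hx _ hy fun i j => natPseudoProduct b n (block (2 ^ n * b) (i / 2) (i % 2) X)
    (block (2 ^ n * b) (j / 2) (j % 2) Y) (x % (2 ^ n * b)) (y % (2 ^ n * b))
  have e : ∀ r, natPseudoProduct b n (blockComb leftCoeff (2 ^ n * b) r X)
      (blockComb rightCoeff (2 ^ n * b) r Y) (x % (2 ^ n * b)) (y % (2 ^ n * b)) = _ := fun r =>
    natPseudoProduct_sum b n 4 4 (fun i => toGF2 (leftCoeff r i)) (fun j => toGF2 (rightCoeff r j))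
      (fun i => block (2 ^ n * b) (i / 2) (i % 2) X) (fun j => block (2 ^ n * b) (j / 2) (j % 2) Y)
      _ _
  simp only [e]
  rw [h, natPseudoProduct]
  refine sum_congr rfl fun r hr => ?_
  have hr2 : r < 2 := mem_range.mp hr
  have e1 : ∀ u v : ℕ, v < 2 → (2 * u + v) / 2 = u := by omega
  have e2 : ∀ u v : ℕ, v < 2 → (2 * u + v) % 2 = v := by omega
  rw [e1 _ _ hr2, e2 _ _ hr2, e1 _ _ hy, e2 _ _ hy]

/-- The matrices at level `l` of the recursion, indexed by numbers below `6 ^ l`. -/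
def levelMatrix (α : ℕ → ℕ → Bool) (b s : ℕ) (X : ℕ → ℕ → ZMod 2) : ℕ → ℕ → ℕ → ℕ → ZMod 2
  | 0, _ => X
  | l + 1, R => blockComb α (2 ^ (s - (l + 1)) * b) (R % 6) (levelMatrix α b s X l (R / 6))

/-- An index is a leading bit and an index with fewer bits. -/
def indexConsEquiv (s b : ℕ) : Bool × Index s b ≃ Index (s + 1) b :=
  (Equiv.prodAssoc _ _ _).symm.trans
    (Equiv.prodCongr (Fin.consEquiv fun _ : Fin (s + 1) => Bool) (Equiv.refl _))

/-- The indices as numbers below `2 ^ s * b`. -/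
def encode (b : ℕ) : (s : ℕ) → Index s b ≃ Fin (2 ^ s * b)
  | 0 => (Equiv.uniqueProd (Fin b) (Fin 0 → Bool)).trans (finCongr (by simp))
  | s + 1 => (indexConsEquiv s b).symm.trans
      (((Equiv.prodCongr finTwoEquiv.symm (encode b s)).trans finProdFinEquiv).trans
        (finCongr (by ring)))

lemma encode_cons (b s : ℕ) (p : Bool) (x : Index s b) :
    (encode b (s + 1) (indexConsEquiv s b (p, x)) : ℕ) =
      (if p then 1 else 0) * (2 ^ s * b) + encode b s x := by
  simp only [encode, Equiv.trans_apply, Equiv.symm_apply_apply, Equiv.prodCongr_apply, Prod.map,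
    finCongr_apply, Fin.val_cast, finProdFinEquiv_apply_val]
  cases p <;> simp [finTwoEquiv, add_comm]

lemma compatible_cons {s b : ℕ} (p q r : Bool) (x y z : Index s b) :
    Compatible (indexConsEquiv s b (p, x)) (indexConsEquiv s b (q, y))
      (indexConsEquiv s b (r, z)) ↔ (p || q || r) = true ∧ Compatible x y z := by
  simp only [compatible_iff, indexConsEquiv, Equiv.trans_apply, Equiv.prodCongr_apply, Prod.map,
    Equiv.prodAssoc_symm_apply, Fin.consEquiv_apply]
  constructor
  · intro h
    exact ⟨by simpa using h 0, fun l => by simpa using h l.succ⟩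
  · rintro ⟨h0, h⟩ l
    refine Fin.cases ?_ (fun l => ?_) l
    · simpa using h0
    · simpa using h l

lemma pseudoProduct_apply {s b : ℕ} (A B : Matrix (Index s b) (Index s b) (ZMod 2))
    (x y : Index s b) :
    pseudoProduct A B x y = ∑ z, if Compatible x y z then A x z * B z y else 0 :=
  sum_filter _ _

/-- Under `encode` the leading bit of an index is the number of its block. The disjunction of three
leading bits fails only if all are `0`, which is the term left out of the recursion. -/
lemma sum_compatible_eq_natPseudoProduct (b s : ℕ) (X Y : ℕ → ℕ → ZMod 2) (x y : Index s b) :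
    (∑ z, if Compatible x y z then
        X (encode b s x) (encode b s z) * Y (encode b s z) (encode b s y) else 0) =
      natPseudoProduct b s X Y (encode b s x) (encode b s y) := by
  induction s generalizing X Y with
  | zero =>
    have hc : ∀ z : Index 0 b, Compatible x y z := fun z => Subsingleton.elim _ _
    simp only [hc, if_true]
    rw [(encode b 0).sum_comp fun z : Fin (2 ^ 0 * b) => X (encode b 0 x) z * Y z (encode b 0 y),
      natPseudoProduct, Fin.sum_univ_eq_sum_range (fun k => X (encode b 0 x) k * Y k (encode b 0 y))]
    simp
  | succ s ih =>
    obtain ⟨⟨p, x⟩, rfl⟩ := (indexConsEquiv s b).surjective x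
    obtain ⟨⟨q, y⟩, rfl⟩ := (indexConsEquiv s b).surjective y
    have hlt : ∀ w : Index s b, (encode b s w : ℕ) < 2 ^ s * b := fun w => (encode b s w).2
    have hpos : 0 < 2 ^ s * b := (Nat.zero_le _).trans_lt (hlt x)
    have hdiv : ∀ (v : Bool) (w : Index s b),
        ((if v then 1 else 0) * (2 ^ s * b) + (encode b s w : ℕ)) / (2 ^ s * b) =
          if v then 1 else 0 := fun v w => by
      rw [add_comm, Nat.add_mul_div_right _ _ hpos, Nat.div_eq_of_lt (hlt w), zero_add]
    have hmod : ∀ (v : Bool) (w : Index s b),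
        ((if v then 1 else 0) * (2 ^ s * b) + (encode b s w : ℕ)) % (2 ^ s * b) = encode b s w :=
      fun v w => by rw [add_comm, Nat.add_mul_mod_self_right, Nat.mod_eq_of_lt (hlt w)]
    rw [natPseudoProduct, encode_cons, encode_cons, hdiv, hdiv, hmod, hmod]
    simp only [← ih]
    rw [← (indexConsEquiv s b).sum_comp, Fintype.sum_prod_type,
      Fintype.sum_bool, sum_range_succ, sum_range_one, add_comm]
    simp only [compatible_cons, encode_cons]
    congr 1
    all_goals
      simp only [block]
      cases p <;> cases q <;> simp

end PseudoProduct

/-! ### Programs for the levels of the recursion -/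

section Expressions

instance : Add Expr := ⟨.op .add⟩
instance : Sub Expr := ⟨.op .sub⟩
instance : Mul Expr := ⟨.op .mul⟩
instance : Div Expr := ⟨.op .div⟩
instance : Mod Expr := ⟨.op .mod⟩

namespace Expr

variable (e : Expr) (M : Mem)

lemma op_eq : (∀ e f : Expr, e + f = .op .add e f) ∧ (∀ e f : Expr, e - f = .op .sub e f) ∧
    (∀ e f : Expr, e * f = .op .mul e f) ∧ (∀ e f : Expr, e / f = .op .div e f) ∧
    ∀ e f : Expr, e % f = .op .mod e f :=
  ⟨fun _ _ => rfl, fun _ _ => rfl, fun _ _ => rfl, fun _ _ => rfl, fun _ _ => rfl⟩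

lemma eval_setBits (a : ℕ) (g : ℕ → Bool) : e.eval (M.setBits a g) = e.eval M := by
  induction e with
  | reg | const => rfl
  | op o e f he hf => simp only [eval, he, hf]
  | load a e he => simp only [eval, he]; rfl

end Expr

namespace BExpr

/-- The expression does not read the bit array `a`. -/
def Avoids (a : ℕ) : BExpr → Prop
  | bit a' _ => a' ≠ a
  | gate _ p q => p.Avoids a ∧ q.Avoids a
  | isZero _ => True

lemma eval_setBits {a : ℕ} {e : BExpr} (he : e.Avoids a) (M : Mem) (g : ℕ → Bool) :
    e.eval (M.setBits a g) = e.eval M := by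
  induction e with
  | bit a' e =>
    have : a' ≠ a := he
    simp only [eval, Expr.eval_setBits]
    simp [Mem.setBits, this]
  | gate g p q hp hq => simp only [eval, hp he.1, hq he.2]
  | isZero e => simp only [eval, Expr.eval_setBits]

/-- The sum modulo `2` of `f i` over `i < n`. -/
def xorRange (n : ℕ) (f : ℕ → BExpr) : BExpr :=
  n.rec (isZero (.const 1)) fun i p => gate xor p (f i)

lemma toGF2_xor (u v : Bool) : toGF2 (xor u v) = toGF2 u + toGF2 v := by
  cases u <;> cases v <;> decide

lemma toGF2_and (u v : Bool) : toGF2 (u && v) = toGF2 u * toGF2 v := by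
  cases u <;> cases v <;> decide

lemma toGF2_xorRange (n : ℕ) (f : ℕ → BExpr) (M : Mem) :
    toGF2 ((xorRange n f).eval M) = ∑ i ∈ Finset.range n, toGF2 ((f i).eval M) := by
  induction n with
  | zero => simp [xorRange, eval, Expr.eval, toGF2]
  | succ n ih =>
    rw [Finset.sum_range_succ, ← ih]
    exact toGF2_xor _ _

lemma ok_xorRange {V κ : ℕ} (hV : 1 ≤ V) (hκ : 1 ≤ κ) {n : ℕ} {f : ℕ → BExpr}
    (hf : ∀ i < n, (f i).Ok V κ) : (xorRange n f).Ok V κ := by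
  induction n with
  | zero => exact ⟨hV, hκ⟩
  | succ n ih => exact ⟨ih fun i hi => hf i (by omega), hf n (by omega)⟩

lemma avoids_xorRange {a : ℕ} {n : ℕ} {f : ℕ → BExpr} (hf : ∀ i < n, (f i).Avoids a) :
    (xorRange n f).Avoids a := by
  induction n with
  | zero => exact trivial
  | succ n ih => exact ⟨ih fun i hi => hf i (by omega), hf n (by omega)⟩

/-- The bit `tab i`, where `i < n` is the value of `e`. -/
def lookup (tab : ℕ → Bool) (n : ℕ) (e : Expr) : BExpr :=
  -- With truncated subtraction this sum vanishes exactly if `e` equals `i`. The last operand is a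
  -- dummy, as gates are binary.
  xorRange n fun i => gate (fun u _ => u && tab i) (isZero ((e - .const i) + (.const i - e)))
    (isZero (.const 0))

lemma toGF2_lookup (tab : ℕ → Bool) {n : ℕ} {e : Expr} {M : Mem} (h : e.eval M < n) :
    toGF2 ((lookup tab n e).eval M) = toGF2 (tab (e.eval M)) := by
  rw [lookup, toGF2_xorRange, Finset.sum_eq_single (e.eval M)]
  · simp [eval, Expr.op_eq, Expr.eval, Op.eval]
  · intro i _ hi
    have : ¬ (e.eval M - i = 0 ∧ i - e.eval M = 0) := by omega
    simp only [eval, Expr.op_eq, Expr.eval, Op.eval, Nat.add_eq_zero_iff, this,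
      decide_false, Bool.false_and]
    rfl
  · intro h'
    exact absurd (Finset.mem_range.mpr h) h'

lemma ok_lookup {V κ : ℕ} (hV : 1 ≤ V) (tab : ℕ → Bool) {n : ℕ} (hn : n ≤ V) {e : Expr}
    (he : e.Ok V) (hκ : 2 * e.leaves + 2 ≤ κ) : (lookup tab n e).Ok V κ := by
  refine ok_xorRange hV (by omega) fun i hi => ⟨⟨?_, ?_⟩, ⟨Nat.zero_le _, ?_⟩⟩
  · exact ⟨⟨he, hi.le.trans hn⟩, hi.le.trans hn, he⟩
  · simp only [Expr.op_eq, Expr.leaves]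
    omega
  · simp only [Expr.leaves]
    omega

lemma avoids_lookup (a : ℕ) (tab : ℕ → Bool) (n : ℕ) (e : Expr) : (lookup tab n e).Avoids a :=
  avoids_xorRange fun _ _ => ⟨trivial, trivial⟩

end BExpr

end Expressions

section Levels

variable {V κ : ℕ}

/-- Replace the first `n` places of the bit array `a`, by way of the array `7`. -/
def refill (a : ℕ) (n : Expr) (be : BExpr) : Program :=
  -- The new entries may depend on old entries anywhere in `a`, so nothing in `a` is overwritten
  -- before all are computed.
  .seq (mapBits 7 n be) (mapBits a n (.bit 7 (.reg 3)))

/-- The memory after refilling `N` places of the bit array `a` with the values of `be`. -/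
def refilled (a : ℕ) (be : BExpr) (N : ℕ) (M : Mem) : Mem :=
  ((M.setReg 3 N).setBits 7 fun p => if p < N then be.eval (M.setReg 3 p) else M.bit 7 p).setBits a
    fun p => if p < N then be.eval (M.setReg 3 p) else M.bit a p

lemma Mem.setReg_setReg (M : Mem) (r u v : ℕ) : (M.setReg r u).setReg r v = M.setReg r v := by
  simp [Mem.setReg]

lemma Mem.setBits_setReg (M : Mem) (a r v : ℕ) (g : ℕ → Bool) :
    (M.setBits a g).setReg r v = (M.setReg r v).setBits a g := rfl

lemma tr_refill (hV : 2 ≤ V) (hκ : 2 ≤ κ) {M : Mem} (hM : M.Le V) {a : ℕ} (ha : a < 100)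
    (ha7 : a ≠ 7) {n : Expr} {be : BExpr} (hn : n.Ok V) (hnκ : n.leaves ≤ κ) (hbe : be.Ok V κ)
    (hbe7 : be.Avoids 7) {N : ℕ} (hN : ∀ t, n.eval (M.setReg 3 t) = N) (hNV : N ≤ V) :
    Tr (refill a n be) M (· = refilled a be N M) ((N + 1) * (2 * n.cost + be.cost + 50))
      (V ^ κ) := by
  refine Tr.mono (Tr.seq (tr_mapBits hV hκ hM (a := 7) (by norm_num) hn hnκ hbe (hN 0) hNV
    (fun t => be.eval (M.setReg 3 t)) fun t _ g => BExpr.eval_setBits hbe7 _ _)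
    (Q' := (· = refilled a be N M)) (T' := (N + 1) * (n.cost + 3 + 22)) ?_)
    (fun _ h => h) (by nlinarith)
  rintro M' rfl
  refine Tr.mono (tr_mapBits hV hκ ((hM.setReg 3 hNV).setBits _ _) ha hn hnκ
    (be := .bit 7 (.reg 3)) ⟨by norm_num, by simp [Expr.Ok], Nat.le_of_succ_le hκ⟩
    (by rw [Mem.setBits_setReg, Expr.eval_setBits, Mem.setReg_setReg, hN]) hNV
    (fun t => be.eval (M.setReg 3 t)) ?_) ?_ le_rfl
  · intro t ht g
    simp only [BExpr.eval, Expr.eval, Mem.setBits, Mem.setReg]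
    simp [ha7.symm, ht]
  · rintro M' rfl
    simp only [refilled, Mem.setBits, Mem.setReg]
    simp [ha7]

/-- The bit array `a` holds the matrices `F R` of size `sz` for `R < cnt`. -/
def Holds (M : Mem) (a cnt sz : ℕ) (F : ℕ → ℕ → ℕ → ZMod 2) : Prop :=
  ∀ R < cnt, ∀ u < sz, ∀ v < sz, toGF2 (M.bit a ((R * sz + u) * sz + v)) = F R u v

/-- The memory agrees with `M₀` in what is not used for the recursion, and there are `cnt` matrices
of size `sz`. -/
structure Frame (V : ℕ) (M₀ : Mem) (cnt sz : ℕ) (M : Mem) : Prop where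
  le : M.Le V
  word : M.word = M₀.word
  reg : ∀ r ∈ [0, 1, 2, 4, 5], M.reg r = M₀.reg r
  cnt : M.reg 6 = cnt
  sz : M.reg 7 = sz
  out : M.bit 2 = M₀.bit 2

lemma index_lt {cnt sz R u v : ℕ} (hR : R < cnt) (hu : u < sz) (hv : v < sz) :
    (R * sz + u) * sz + v < cnt * (sz * sz) := by
  have h1 : R * sz + u + 1 ≤ cnt * sz := by nlinarith
  nlinarith

lemma index_div_div {sz R u v : ℕ} (hu : u < sz) (hv : v < sz) :
    ((R * sz + u) * sz + v) / (sz * sz) = R := by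
  have h : 0 < sz := by omega
  rw [← Nat.div_div_eq_div_mul, add_comm, Nat.add_mul_div_right _ _ h, Nat.div_eq_of_lt hv, zero_add,
    add_comm, Nat.add_mul_div_right _ _ h, Nat.div_eq_of_lt hu, zero_add]

lemma index_div {sz R u v : ℕ} (hv : v < sz) :
    ((R * sz + u) * sz + v) / sz = R * sz + u := by
  have h : 0 < sz := by omega
  rw [add_comm, Nat.add_mul_div_right _ _ h, Nat.div_eq_of_lt hv, zero_add]

lemma index_div_mod {sz R u v : ℕ} (hu : u < sz) (hv : v < sz) :
    ((R * sz + u) * sz + v) / sz % sz = u := by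
  rw [index_div hv, add_comm, Nat.add_mul_mod_self_right, Nat.mod_eq_of_lt hu]

lemma index_mod {sz R u v : ℕ} (hv : v < sz) : ((R * sz + u) * sz + v) % sz = v := by
  rw [add_comm, Nat.add_mul_mod_self_right, Nat.mod_eq_of_lt hv]

lemma Frame.refilled {M₀ M : Mem} {cnt sz a N : ℕ} {be : BExpr} (h : Frame V M₀ cnt sz M)
    (ha : a ≠ 2) (hN : N ≤ V) : Frame V M₀ cnt sz (refilled a be N M) where
  le := ((h.le.setReg 3 hN).setBits _ _).setBits _ _
  word := h.word
  reg r hr := by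
    have : r ≠ 3 := by rintro rfl; simp at hr
    simpa [BMM.refilled, Mem.setBits, Mem.setReg, this] using h.reg r hr
  cnt := by simpa [BMM.refilled, Mem.setBits, Mem.setReg] using h.cnt
  sz := by simpa [BMM.refilled, Mem.setBits, Mem.setReg] using h.sz
  out := by simpa [BMM.refilled, Mem.setBits, Mem.setReg, ha.symm] using h.out

lemma Holds.refilled_of_ne {M : Mem} {cnt sz a a' N : ℕ} {be : BExpr} {F : ℕ → ℕ → ℕ → ZMod 2}
    (h : Holds M a' cnt sz F) (ha : a' ≠ a) (ha7 : a' ≠ 7) :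
    Holds (refilled a be N M) a' cnt sz F := by
  intro R hR u hu v hv
  rw [← h R hR u hu v hv]
  simp [BMM.refilled, Mem.setBits, Mem.setReg, ha, ha7]

lemma holds_refilled {M : Mem} {cnt sz a N : ℕ} {be : BExpr} {F : ℕ → ℕ → ℕ → ZMod 2}
    (hN : N = cnt * (sz * sz))
    (h : ∀ R < cnt, ∀ u < sz, ∀ v < sz,
      toGF2 (be.eval (M.setReg 3 ((R * sz + u) * sz + v))) = F R u v) :
    Holds (refilled a be N M) a cnt sz F := by
  intro R hR u hu v hv
  have := index_lt hR hu hv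
  rw [← h R hR u hu v hv]
  simp [BMM.refilled, Mem.setBits, this, hN]

lemma Frame.setReg {M₀ M : Mem} {cnt sz r v : ℕ} (h : Frame V M₀ cnt sz M) (hv : v ≤ V)
    (hr : r = 3 ∨ 8 ≤ r) : Frame V M₀ cnt sz (M.setReg r v) where
  le := h.le.setReg r hv
  word := h.word
  reg r' hr' := by
    have : r' ≠ r := by
      rintro rfl
      simp at hr'
      omega
    simpa [Mem.setReg, this] using h.reg r' hr'
  cnt := by
    have : 6 ≠ r := by omega
    simpa [Mem.setReg, this] using h.cnt
  sz := by
    have : 7 ≠ r := by omega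
    simpa [Mem.setReg, this] using h.sz
  out := h.out

lemma Frame.setCnt {M₀ M : Mem} {cnt sz v : ℕ} (h : Frame V M₀ cnt sz M) (hv : v ≤ V) :
    Frame V M₀ v sz (M.setReg 6 v) where
  le := h.le.setReg 6 hv
  word := h.word
  reg r' hr' := by
    have : r' ≠ 6 := by
      rintro rfl
      simp at hr'
    simpa [Mem.setReg, this] using h.reg r' hr'
  cnt := by simp [Mem.setReg]
  sz := by simpa [Mem.setReg] using h.sz
  out := h.out

lemma Frame.setSz {M₀ M : Mem} {cnt sz v : ℕ} (h : Frame V M₀ cnt sz M) (hv : v ≤ V) :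
    Frame V M₀ cnt v (M.setReg 7 v) where
  le := h.le.setReg 7 hv
  word := h.word
  reg r' hr' := by
    have : r' ≠ 7 := by
      rintro rfl
      simp at hr'
    simpa [Mem.setReg, this] using h.reg r' hr'
  cnt := by simpa [Mem.setReg] using h.cnt
  sz := by simp [Mem.setReg]
  out := h.out

/-- The number of entries after a forward step. -/
def forwardCount : Expr := .reg 6 * .const 6 * (.reg 8 * .reg 8)

/-- An entry after a forward step. -/
def forwardEntry (α : ℕ → ℕ → Bool) (a : ℕ) : BExpr :=
  .xorRange 4 fun q => .gate and
    (.lookup (fun r => α r q) 6 (.reg 3 / (.reg 8 * .reg 8) % .const 6))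
    (.bit a ((.reg 3 / (.reg 8 * .reg 8) / .const 6 * .reg 7 +
        (.const (q / 2) * .reg 8 + .reg 3 / .reg 8 % .reg 8)) * .reg 7 +
      (.const (q % 2) * .reg 8 + .reg 3 % .reg 8)))

lemma ok_forwardEntry (hV : 6 ≤ V) (hκ : 40 ≤ κ) (α : ℕ → ℕ → Bool) {a : ℕ} (ha : a < 100) :
    (forwardEntry α a).Ok V κ := by
  refine BExpr.ok_xorRange (by omega) (by omega) fun q hq => ⟨BExpr.ok_lookup (by omega) _ hV ?_ ?_,
    ha, ?_, ?_⟩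
  · simp [Expr.op_eq, Expr.Ok, hV]
  · simp only [Expr.op_eq, Expr.leaves]
    omega
  · simp only [Expr.op_eq, Expr.Ok]
    omega
  · simp only [Expr.op_eq, Expr.leaves]
    omega

lemma avoids_forwardEntry (α : ℕ → ℕ → Bool) {a : ℕ} (ha : a ≠ 7) :
    (forwardEntry α a).Avoids 7 :=
  BExpr.avoids_xorRange fun _ _ => ⟨BExpr.avoids_lookup _ _ _ _, ha⟩

/-- Matrix `R` of the new level is child `R % 6` of matrix `R / 6`. Register `7` still holds the old
size `2 * h`, register `8` the new size `h`. -/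
lemma toGF2_forwardEntry (α : ℕ → ℕ → Bool) {a : ℕ} {M : Mem} {cnt h : ℕ}
    {F : ℕ → ℕ → ℕ → ZMod 2} (h7 : M.reg 7 = 2 * h) (h8 : M.reg 8 = h)
    (hF : Holds M a cnt (2 * h) F) {R u v : ℕ} (hR : R < cnt * 6) (hu : u < h) (hv : v < h) :
    toGF2 ((forwardEntry α a).eval (M.setReg 3 ((R * h + u) * h + v))) =
      blockComb α h (R % 6) (F (R / 6)) u v := by
  rw [forwardEntry, BExpr.toGF2_xorRange, blockComb]
  refine Finset.sum_congr rfl fun q hq => ?_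
  have hq4 : q < 4 := Finset.mem_range.mp hq
  have e3 : (M.setReg 3 ((R * h + u) * h + v)).reg 3 = (R * h + u) * h + v := by simp [Mem.setReg]
  have e7 : (M.setReg 3 ((R * h + u) * h + v)).reg 7 = 2 * h := by simp [Mem.setReg, h7]
  have e8 : (M.setReg 3 ((R * h + u) * h + v)).reg 8 = h := by simp [Mem.setReg, h8]
  have eb : (M.setReg 3 ((R * h + u) * h + v)).bit a = M.bit a := rfl
  rw [BExpr.eval, BExpr.toGF2_and, BExpr.toGF2_lookup]
  · simp only [BExpr.eval, Expr.op_eq, Expr.eval, Op.eval,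
      e3, e7, e8, eb, index_div_div hu hv, index_div_mod hu hv, index_mod hv]
    congr 1
    refine hF (R / 6) (by omega) (q / 2 * h + u) ?_ (q % 2 * h + v) ?_
    · have : q / 2 ≤ 1 := by omega
      nlinarith
    · have : q % 2 ≤ 1 := by omega
      nlinarith
  · simp only [Expr.op_eq, Expr.eval, Op.eval]
    exact Nat.mod_lt _ (by norm_num)

/-- One forward step. -/
def forwardStep : Program :=
  .seq (assign 8 (.reg 7 / .const 2))
    (.seq (refill 4 forwardCount (forwardEntry leftCoeff 4))
      (.seq (refill 5 forwardCount (forwardEntry rightCoeff 5))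
        (.seq (assign 6 (.reg 6 * .const 6)) (assign 7 (.reg 8)))))

def forwardCost : ℕ :=
  4 * forwardCount.cost + (forwardEntry leftCoeff 4).cost + (forwardEntry rightCoeff 5).cost + 230

lemma tr_forwardStep (hV : 6 ≤ V) (hκ : 40 ≤ κ) {M₀ M : Mem} {cnt h : ℕ}
    {F G : ℕ → ℕ → ℕ → ZMod 2} (hM : Frame V M₀ cnt (2 * h) M) (hF : Holds M 4 cnt (2 * h) F)
    (hG : Holds M 5 cnt (2 * h) G) (hcnt : cnt * 6 ≤ V) (hN : cnt * 6 * (h * h) ≤ V) :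
    Tr forwardStep M (fun M' => Frame V M₀ (cnt * 6) h M' ∧
        Holds M' 4 (cnt * 6) h (fun R => blockComb leftCoeff h (R % 6) (F (R / 6))) ∧
        Holds M' 5 (cnt * 6) h (fun R => blockComb rightCoeff h (R % 6) (G (R / 6))))
      ((cnt * 6 * (h * h) + 1) * forwardCost) (V ^ κ) := by
  have hV2 : 2 ≤ V := by omega
  have hκ2 : 2 ≤ κ := by omega
  have hhV : h ≤ V := by
    have := hM.le.1 7
    rw [hM.sz] at this
    omega
  have hcount : ∀ M : Mem, M.reg 6 = cnt → M.reg 8 = h → ∀ t,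
      forwardCount.eval (M.setReg 3 t) = cnt * 6 * (h * h) := by
    intro M h6 h8 t
    simp [forwardCount, Expr.op_eq, Expr.eval, Op.eval, Mem.setReg, h6, h8]
  have hcok : forwardCount.Ok V := by
    simp [forwardCount, Expr.op_eq, Expr.Ok, hV]
  have hcl : forwardCount.leaves ≤ κ := by
    simp only [forwardCount, Expr.op_eq, Expr.leaves]; omega
  refine Tr.mono (Tr.seq (tr_assign hV2 hM.le (by norm_num) (e := .reg 7 / .const 2)
    (by simp [Expr.op_eq, Expr.Ok, hV2]) (by simp only [Expr.op_eq, Expr.leaves]; omega))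
    (T' := (cnt * 6 * (h * h) + 1) * (2 * forwardCount.cost + (forwardEntry leftCoeff 4).cost + 50) +
      ((cnt * 6 * (h * h) + 1) * (2 * forwardCount.cost + (forwardEntry rightCoeff 5).cost + 50)
        + 100)) ?_) (fun _ h => h) ?_
  · rintro M' rfl
    have e8 : Expr.eval (.reg 7 / .const 2) M = h := by
      simp [Expr.op_eq, Expr.eval, Op.eval, hM.sz]
    rw [e8]
    set M1 := M.setReg 8 h with hM1
    have f1 : Frame V M₀ cnt (2 * h) M1 := hM.setReg hhV (Or.inr le_rfl)
    have r1 : M1.reg 8 = h := by simp [hM1, Mem.setReg]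
    refine Tr.seq (tr_refill hV2 hκ2 f1.le (by norm_num) (by norm_num) hcok hcl
      (ok_forwardEntry hV hκ leftCoeff (by norm_num)) (avoids_forwardEntry _ (by norm_num))
      (hcount M1 f1.cnt r1) hN) ?_
    rintro M' rfl
    set M2 := refilled 4 (forwardEntry leftCoeff 4) (cnt * 6 * (h * h)) M1 with hM2
    have f2 : Frame V M₀ cnt (2 * h) M2 := f1.refilled (by norm_num) hN
    have r2 : M2.reg 8 = h := by simpa [hM2, refilled, Mem.setBits, Mem.setReg] using r1
    have F2 : Holds M2 4 (cnt * 6) h (fun R => blockComb leftCoeff h (R % 6) (F (R / 6))) :=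
      holds_refilled rfl fun R hR u hu v hv =>
        toGF2_forwardEntry leftCoeff f1.sz r1 (M := M1) hF hR hu hv
    have G2 : Holds M2 5 cnt (2 * h) G :=
      Holds.refilled_of_ne (M := M1) hG (by norm_num) (by norm_num)
    refine Tr.seq (tr_refill hV2 hκ2 f2.le (by norm_num) (by norm_num) hcok hcl
      (ok_forwardEntry hV hκ rightCoeff (by norm_num)) (avoids_forwardEntry _ (by norm_num))
      (hcount M2 f2.cnt r2) hN) ?_
    rintro M' rfl
    set M3 := refilled 5 (forwardEntry rightCoeff 5) (cnt * 6 * (h * h)) M2 with hM3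
    have f3 : Frame V M₀ cnt (2 * h) M3 := f2.refilled (by norm_num) hN
    have r3 : M3.reg 8 = h := by simpa [hM3, refilled, Mem.setBits, Mem.setReg] using r2
    have F3 := F2.refilled_of_ne (a := 5) (be := forwardEntry rightCoeff 5)
      (N := cnt * 6 * (h * h)) (by norm_num) (by norm_num)
    have G3 : Holds M3 5 (cnt * 6) h (fun R => blockComb rightCoeff h (R % 6) (G (R / 6))) :=
      holds_refilled rfl fun R hR u hu v hv =>
        toGF2_forwardEntry rightCoeff f2.sz r2 G2 hR hu hv
    have e6 : Expr.eval (.reg 6 * .const 6) M3 = cnt * 6 := by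
      simp [Expr.eval, Op.eval, f3.cnt]
    have t6 : Tr (assign 6 (.reg 6 * .const 6)) M3 (· = M3.setReg 6 (cnt * 6)) 6 (V ^ κ) := by
      rw [← e6]
      exact tr_assign hV2 f3.le (by norm_num) (by simp [Expr.Ok, hV])
        (by simp only [Expr.leaves]; omega)
    refine Tr.mono (Tr.seq t6 (T' := 10) ?_) (fun _ h => h) (by norm_num)
    rintro M' rfl
    have f4 := f3.setCnt hcnt
    refine Tr.mono (tr_assign hV2 f4.le (by norm_num) (e := .reg 8)
      (by simp [Expr.Ok]) (by simp only [Expr.leaves]; omega)) ?_ (by decide)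
    rintro M' rfl
    have e7 : Expr.eval (.reg 8) (M3.setReg 6 (cnt * 6)) = h := by
      simpa [Expr.op_eq, Expr.eval, Op.eval, Mem.setReg] using r3
    rw [e7]
    exact ⟨f4.setSz hhV, F3, G3⟩
  · have key : ∀ p q r N : ℕ, 4 + 2 + ((N + 1) * (2 * p + q + 50) + ((N + 1) * (2 * p + r + 50) +
        100)) ≤ (N + 1) * (4 * p + q + r + 230) := by
      intro p q r N
      nlinarith
    exact key _ _ _ _

/-- The number of entries after a backward step, and in the base case. -/
def blockCount : Expr := .reg 6 * (.reg 7 * .reg 7)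

/-- An entry after a backward step. -/
def backwardEntry : BExpr :=
  .xorRange 6 fun r => .gate and
    (.lookup (fun q => outCoeff q r) 4
      (.const 2 * (.reg 3 / .reg 7 % .reg 7 / .reg 8) + .reg 3 % .reg 7 / .reg 8))
    (.bit 6 (((.reg 3 / (.reg 7 * .reg 7) * .const 6 + .const r) * .reg 8 +
        .reg 3 / .reg 7 % .reg 7 % .reg 8) * .reg 8 + .reg 3 % .reg 7 % .reg 8))

lemma ok_backwardEntry (hV : 6 ≤ V) (hκ : 40 ≤ κ) : backwardEntry.Ok V κ := by
  refine BExpr.ok_xorRange (by omega) (by omega) fun q hq =>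
    ⟨BExpr.ok_lookup (by omega) _ (by omega) ?_ ?_, by norm_num, ?_, ?_⟩
  · simp only [Expr.op_eq, Expr.Ok]
    omega
  · simp only [Expr.op_eq, Expr.leaves]
    omega
  · simp only [Expr.op_eq, Expr.Ok]
    omega
  · simp only [Expr.op_eq, Expr.leaves]
    omega

lemma avoids_backwardEntry : backwardEntry.Avoids 7 :=
  BExpr.avoids_xorRange fun _ _ => ⟨BExpr.avoids_lookup _ _ _ _, by norm_num [BExpr.Avoids]⟩

/-- Block `(x / h, y / h)` of matrix `R` collects its six children `R * 6 + r`. Here register `7`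
already holds the new size and register `8` the old one. -/
lemma toGF2_backwardEntry {M : Mem} {cnt h : ℕ} {F : ℕ → ℕ → ℕ → ZMod 2} (h7 : M.reg 7 = 2 * h)
    (h8 : M.reg 8 = h) (hF : Holds M 6 (cnt * 6) h F) {R x y : ℕ} (hR : R < cnt) (hx : x < 2 * h)
    (hy : y < 2 * h) :
    toGF2 (backwardEntry.eval (M.setReg 3 ((R * (2 * h) + x) * (2 * h) + y))) =
      ∑ r ∈ Finset.range 6, toGF2 (outCoeff (2 * (x / h) + y / h) r) *
        F (R * 6 + r) (x % h) (y % h) := by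
  rw [backwardEntry, BExpr.toGF2_xorRange]
  refine Finset.sum_congr rfl fun r hr => ?_
  have hr6 : r < 6 := Finset.mem_range.mp hr
  have hh : 0 < h := by omega
  set t := (R * (2 * h) + x) * (2 * h) + y with ht
  have e3 : (M.setReg 3 t).reg 3 = t := by simp [Mem.setReg]
  have e7 : (M.setReg 3 t).reg 7 = 2 * h := by simp [Mem.setReg, h7]
  have e8 : (M.setReg 3 t).reg 8 = h := by simp [Mem.setReg, h8]
  have eb : (M.setReg 3 t).bit 6 = M.bit 6 := rfl
  have hxh : x / h < 2 := Nat.div_lt_of_lt_mul (by rwa [mul_comm])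
  have hyh : y / h < 2 := Nat.div_lt_of_lt_mul (by rwa [mul_comm])
  have eq : Expr.eval (.const 2 * (.reg 3 / .reg 7 % .reg 7 / .reg 8) + .reg 3 % .reg 7 / .reg 8)
      (M.setReg 3 t) = 2 * (x / h) + y / h := by
    simp only [Expr.op_eq, Expr.eval, Op.eval, e3, e7, e8]
    rw [ht, index_div_mod hx hy, index_mod hy]
  rw [BExpr.eval, BExpr.toGF2_and, BExpr.toGF2_lookup, eq]
  · congr 1
    simp only [BExpr.eval, Expr.op_eq, Expr.eval, Op.eval,
      e3, e7, e8, eb]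
    rw [ht, index_div_mod hx hy, index_mod hy, index_div_div hx hy]
    exact hF _ (by omega) _ (Nat.mod_lt _ hh) _ (Nat.mod_lt _ hh)
  · rw [eq]
    omega

/-- One backward step. -/
def backwardStep : Program :=
  .seq (assign 6 (.reg 6 / .const 6))
    (.seq (assign 8 (.reg 7))
      (.seq (assign 7 (.reg 7 * .const 2)) (refill 6 blockCount backwardEntry)))

def backwardCost : ℕ := 2 * blockCount.cost + backwardEntry.cost + 100

lemma ok_blockCount : blockCount.Ok V := by
  simp [blockCount, Expr.op_eq, Expr.Ok]

lemma leaves_blockCount : blockCount.leaves = 3 := rfl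

lemma eval_blockCount {M : Mem} {cnt sz : ℕ} (h6 : M.reg 6 = cnt) (h7 : M.reg 7 = sz) (t : ℕ) :
    blockCount.eval (M.setReg 3 t) = cnt * (sz * sz) := by
  simp [blockCount, Expr.op_eq, Expr.eval, Op.eval, Mem.setReg, h6, h7]

lemma tr_backwardStep (hV : 6 ≤ V) (hκ : 40 ≤ κ) {M₀ M : Mem} {cnt h : ℕ}
    {F : ℕ → ℕ → ℕ → ZMod 2} (hM : Frame V M₀ (cnt * 6) h M) (hF : Holds M 6 (cnt * 6) h F)
    (hh : 2 * h ≤ V) (hN : cnt * (2 * h * (2 * h)) ≤ V) :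
    Tr backwardStep M (fun M' => Frame V M₀ cnt (2 * h) M' ∧
        Holds M' 6 cnt (2 * h) (fun R x y => ∑ r ∈ Finset.range 6,
          toGF2 (outCoeff (2 * (x / h) + y / h) r) * F (R * 6 + r) (x % h) (y % h)))
      ((cnt * (2 * h * (2 * h)) + 1) * backwardCost) (V ^ κ) := by
  have hV2 : 2 ≤ V := by omega
  have hκ2 : 2 ≤ κ := by omega
  have hcV : cnt ≤ V := by
    have := hM.le.1 6
    rw [hM.cnt] at this
    omega
  refine Tr.mono (Tr.seq (tr_assign hV2 hM.le (by norm_num) (e := .reg 6 / .const 6)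
    (by simp [Expr.op_eq, Expr.Ok, hV]) (by simp only [Expr.op_eq, Expr.leaves]; omega))
    (T' := 4 + (6 + (cnt * (2 * h * (2 * h)) + 1) * (2 * blockCount.cost + backwardEntry.cost + 50)))
    ?_) (fun _ h => h) ?_
  · rintro M' rfl
    have e6 : Expr.eval (.reg 6 / .const 6) M = cnt := by
      simp [Expr.op_eq, Expr.eval, Op.eval, hM.cnt]
    rw [e6]
    have f1 := hM.setCnt hcV
    refine Tr.seq (tr_assign hV2 f1.le (by norm_num) (e := .reg 7)
      (by simp [Expr.Ok]) (by simp only [Expr.leaves]; omega)) ?_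
    rintro M' rfl
    have e7 : Expr.eval (.reg 7) (M.setReg 6 cnt) = h := f1.sz
    rw [e7]
    have f2 := f1.setReg (r := 8) (v := h) (by omega) (Or.inr le_rfl)
    have e7 : Expr.eval (.reg 7 * .const 2) ((M.setReg 6 cnt).setReg 8 h) = 2 * h := by
      simp only [Expr.eval, Op.eval]
      rw [f2.sz, mul_comm]
    have t7 : Tr (assign 7 (.reg 7 * .const 2)) ((M.setReg 6 cnt).setReg 8 h)
        (· = ((M.setReg 6 cnt).setReg 8 h).setReg 7 (2 * h)) 6 (V ^ κ) := by
      rw [← e7]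
      exact tr_assign hV2 f2.le (by norm_num) (by simp [Expr.Ok, hV2])
        (by simp only [Expr.leaves]; omega)
    refine Tr.seq t7 ?_
    rintro M' rfl
    set M3 := ((M.setReg 6 cnt).setReg 8 h).setReg 7 (2 * h) with hM3
    have f3 : Frame V M₀ cnt (2 * h) M3 := f2.setSz hh
    have r3 : M3.reg 8 = h := by simp [hM3, Mem.setReg]
    refine Tr.mono (tr_refill hV2 hκ2 f3.le (by norm_num) (by norm_num) ok_blockCount
      (by rw [leaves_blockCount]; omega) (ok_backwardEntry hV hκ) avoids_backwardEntry
      (eval_blockCount f3.cnt f3.sz) hN) ?_ le_rfl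
    rintro M' rfl
    exact ⟨f3.refilled (by norm_num) hN, holds_refilled rfl fun R hR x hx y hy =>
      toGF2_backwardEntry f3.sz r3 (M := M3) hF hR hx hy⟩
  · have : (Expr.reg 6 / Expr.const 6).cost = 4 := rfl
    simp only [this, backwardCost]
    nlinarith [Nat.zero_le (cnt * (2 * h * (2 * h)))]

/-- An entry of the products in the base case. -/
def baseEntry (b : ℕ) : BExpr :=
  .xorRange b fun k => .gate and
    (.bit 4 (.reg 3 / .reg 7 * .reg 7 + .const k))
    (.bit 5 ((.reg 3 / (.reg 7 * .reg 7) * .reg 7 + .const k) * .reg 7 + .reg 3 % .reg 7))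

/-- The products in the base case. -/
def baseStep (b : ℕ) : Program := refill 6 blockCount (baseEntry b)

lemma tr_baseStep {b : ℕ} (hV : 6 ≤ V) (hbV : b ≤ V) (hκ : 40 ≤ κ) {M₀ M : Mem} {cnt : ℕ}
    {F G : ℕ → ℕ → ℕ → ZMod 2} (hM : Frame V M₀ cnt b M) (hF : Holds M 4 cnt b F)
    (hG : Holds M 5 cnt b G) (hN : cnt * (b * b) ≤ V) :
    Tr (baseStep b) M (fun M' => Frame V M₀ cnt b M' ∧
        Holds M' 6 cnt b (fun R => natPseudoProduct b 0 (F R) (G R)))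
      ((cnt * (b * b) + 1) * (2 * blockCount.cost + (baseEntry b).cost + 50)) (V ^ κ) := by
  refine Tr.mono (tr_refill (by omega) (by omega) hM.le (by norm_num) (by norm_num) ok_blockCount
    (by rw [leaves_blockCount]; omega) ?_ ?_ (eval_blockCount hM.cnt hM.sz) hN) ?_ le_rfl
  · refine BExpr.ok_xorRange (by omega) (by omega) fun k hk =>
      ⟨⟨by norm_num, ?_, ?_⟩, by norm_num, ?_, ?_⟩
    · simp only [Expr.op_eq, Expr.Ok]
      omega
    · simp only [Expr.op_eq, Expr.leaves]
      omega
    · simp only [Expr.op_eq, Expr.Ok]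
      omega
    · simp only [Expr.op_eq, Expr.leaves]
      omega
  · exact BExpr.avoids_xorRange fun _ _ => by norm_num [BExpr.Avoids]
  · rintro M' rfl
    refine ⟨hM.refilled (by norm_num) hN, holds_refilled rfl fun R hR x hx y hy => ?_⟩
    rw [baseEntry, BExpr.toGF2_xorRange, natPseudoProduct]
    refine Finset.sum_congr rfl fun k hk => ?_
    have hkb : k < b := Finset.mem_range.mp hk
    set t := (R * b + x) * b + y with ht
    have e3 : (M.setReg 3 t).reg 3 = t := by simp [Mem.setReg]
    have e7 : (M.setReg 3 t).reg 7 = b := by simp [Mem.setReg, hM.sz]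
    have eb : (M.setReg 3 t).bit = M.bit := rfl
    rw [BExpr.eval, BExpr.toGF2_and]
    simp only [BExpr.eval, Expr.op_eq, Expr.eval, Op.eval,
      e3, e7, eb]
    rw [ht, index_div hy, index_mod hy, index_div_div hx hy, hF R hR x hx k hkb,
      hG R hR k hkb y hy]

end Levels

/-! ### The program for the pseudo-product -/

lemma Holds.congr {M : Mem} {a cnt sz : ℕ} {F G : ℕ → ℕ → ℕ → ZMod 2} (h : Holds M a cnt sz F)
    (hFG : ∀ R < cnt, ∀ u < sz, ∀ v < sz, F R u v = G R u v) : Holds M a cnt sz G :=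
  fun R hR u hu v hv => (h R hR u hu v hv).trans (hFG R hR u hu v hv)

/-- Pseudo-products of the matrices in the arrays `4` and `5`, stored in the array `6`. -/
def multiply (b : ℕ) : Program :=
  .seq (assign 6 (.const 1)) (.seq (assign 7 (.reg 4))
    (.seq (repeatProg (.reg 5) forwardStep) (.seq (baseStep b) (repeatProg (.reg 5) backwardStep))))

/-- The number of steps of `multiply b` is at most `6 ^ s * multiplyCost b`. -/
def multiplyCost (b : ℕ) : ℕ :=
  (3 * b ^ 2 + 1) * (forwardCost + backwardCost + (2 * blockCount.cost + (baseEntry b).cost + 50)) +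
    20

/-- A geometric series with ratio `4 / 6` from the deepest level upwards, hence the factor `3`. -/
lemma sum_six_pow_mul_four_pow_le (s : ℕ) :
    ∑ l ∈ Finset.range s, 6 ^ (l + 1) * 4 ^ (s - (l + 1)) ≤ 3 * 6 ^ s := by
  induction s with
  | zero => simp
  | succ s ih =>
    have : ∀ l ∈ Finset.range s, 6 ^ (l + 1) * 4 ^ (s + 1 - (l + 1)) =
        4 * (6 ^ (l + 1) * 4 ^ (s - (l + 1))) := by
      intro l hl
      have : s + 1 - (l + 1) = s - (l + 1) + 1 := by
        have := Finset.mem_range.mp hl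
        omega
      rw [this, pow_succ 4]
      ring
    rw [Finset.sum_range_succ, Finset.sum_congr rfl this, ← Finset.mul_sum, Nat.sub_self, pow_zero,
      pow_succ]
    omega

lemma six_pow_mul_four_pow_le {s l : ℕ} (h : l ≤ s) : 6 ^ l * 4 ^ (s - l) ≤ 6 ^ s := by
  calc 6 ^ l * 4 ^ (s - l) ≤ 6 ^ l * 6 ^ (s - l) :=
        Nat.mul_le_mul_left _ (Nat.pow_le_pow_left (by norm_num) _)
    _ = 6 ^ s := by rw [← pow_add, Nat.add_sub_cancel' h]

lemma two_pow_mul_sq (n b : ℕ) : 2 ^ n * b * (2 ^ n * b) = 4 ^ n * b ^ 2 := by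
  rw [show (4 : ℕ) = 2 ^ 2 by norm_num, ← pow_mul, pow_mul']
  ring

lemma six_pow_mul_size_le {b s l V : ℕ} (hsV : 6 ^ s * b ^ 2 ≤ V) (hl : l ≤ s) :
    6 ^ l * (2 ^ (s - l) * b * (2 ^ (s - l) * b)) ≤ V := by
  rw [two_pow_mul_sq, ← mul_assoc]
  exact (Nat.mul_le_mul_right _ (six_pow_mul_four_pow_le hl)).trans hsV

lemma two_pow_mul_le {b s l V : ℕ} (hsV : 6 ^ s * b ^ 2 ≤ V) (hl : l ≤ s) : 2 ^ l * b ≤ V :=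
  (Nat.mul_le_mul ((Nat.pow_le_pow_left (by norm_num) l).trans
    (Nat.pow_le_pow_right (by norm_num) hl)) (Nat.le_self_pow (by norm_num) b)).trans hsV

lemma six_pow_le {b s l V : ℕ} (hb : 1 ≤ b) (hsV : 6 ^ s * b ^ 2 ≤ V) (hl : l ≤ s) : 6 ^ l ≤ V :=
  (Nat.pow_le_pow_right (by norm_num) hl).trans
    ((Nat.le_mul_of_pos_right _ (by positivity)).trans hsV)

lemma sum_levels_le (b s c : ℕ) :
    ∑ l ∈ Finset.range s, ((6 ^ (l + 1) * (2 ^ (s - (l + 1)) * b * (2 ^ (s - (l + 1)) * b)) + 1) * c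
      + 1) ≤ 6 ^ s * ((3 * b ^ 2 + 1) * c + 1) := by
  have h1 : s ≤ 6 ^ s := (Nat.lt_pow_self (by norm_num)).le
  have h2 := sum_six_pow_mul_four_pow_le s
  have h3 : ∀ l ∈ Finset.range s,
      ((6 ^ (l + 1) * (2 ^ (s - (l + 1)) * b * (2 ^ (s - (l + 1)) * b)) + 1) * c + 1) =
        6 ^ (l + 1) * 4 ^ (s - (l + 1)) * (b ^ 2 * c) + (c + 1) := by
    intro l _
    rw [two_pow_mul_sq]
    ring
  rw [Finset.sum_congr rfl h3, Finset.sum_add_distrib, ← Finset.sum_mul, Finset.sum_const,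
    Finset.card_range, smul_eq_mul]
  calc _ ≤ 3 * 6 ^ s * (b ^ 2 * c) + 6 ^ s * (c + 1) :=
        Nat.add_le_add (Nat.mul_le_mul_right _ h2) (Nat.mul_le_mul_right _ h1)
    _ = _ := by ring

section Multiply

variable {V κ b s : ℕ} {X Y : ℕ → ℕ → ZMod 2} {M₀ M : Mem}

/-- After `l` passes there are `6 ^ l` pairs of factors of size `2 ^ (s - l) * b`, stored
consecutively. -/
lemma tr_forward (hV : 6 ≤ V) (hκ : 40 ≤ κ) (hb : 1 ≤ b) (hsV : 6 ^ s * b ^ 2 ≤ V)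
    (hM : Frame V M₀ 1 (2 ^ s * b) M) (h5 : M₀.reg 5 = s) (hX : Holds M 4 1 (2 ^ s * b) fun _ => X)
    (hY : Holds M 5 1 (2 ^ s * b) fun _ => Y) :
    Tr (repeatProg (.reg 5) forwardStep) M (fun M' => Frame V M₀ (6 ^ s) b M' ∧
        Holds M' 4 (6 ^ s) b (levelMatrix leftCoeff b s X s) ∧
        Holds M' 5 (6 ^ s) b (levelMatrix rightCoeff b s Y s))
      (6 ^ s * ((3 * b ^ 2 + 1) * forwardCost + 4)) (V ^ κ) := by
  refine Tr.mono (tr_repeatProg (by omega) hM.le (n := .reg 5) (show 5 < 100 by norm_num)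
    (show 1 ≤ κ by omega) (N := s) ((hM.reg 5 (by simp)).trans h5)
    (fun l M' => Frame V M₀ (6 ^ l) (2 ^ (s - l) * b) M' ∧
      Holds M' 4 (6 ^ l) (2 ^ (s - l) * b) (levelMatrix leftCoeff b s X l) ∧
      Holds M' 5 (6 ^ l) (2 ^ (s - l) * b) (levelMatrix rightCoeff b s Y l))
    (fun l => (6 ^ (l + 1) * (2 ^ (s - (l + 1)) * b * (2 ^ (s - (l + 1)) * b)) + 1) * forwardCost)
    ⟨hM, hX, hY⟩ ?_) ?_ ?_
  · rintro l hl M' ⟨h1, h2, h3⟩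
    have hs : 2 ^ (s - l) * b = 2 * (2 ^ (s - (l + 1)) * b) := by
      rw [← mul_assoc, ← pow_succ']
      congr 2
      omega
    rw [hs] at h1 h2 h3
    exact tr_forwardStep hV hκ h1 h2 h3 (six_pow_le hb hsV hl) (six_pow_mul_size_le hsV hl)
  · intro M' h
    simpa using h
  · have h1 := sum_levels_le b s forwardCost
    have h2 : 1 ≤ 6 ^ s := Nat.one_le_pow _ _ (by norm_num)
    simp only [Expr.cost]
    rw [show (3 * b ^ 2 + 1) * forwardCost + 4 = ((3 * b ^ 2 + 1) * forwardCost + 1) + 3 from rfl,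
      mul_add]
    omega

lemma tr_backward (hV : 6 ≤ V) (hκ : 40 ≤ κ) (hsV : 6 ^ s * b ^ 2 ≤ V)
    (hM : Frame V M₀ (6 ^ s) b M) (h5 : M₀.reg 5 = s)
    (hXY : Holds M 6 (6 ^ s) b fun R =>
      natPseudoProduct b 0 (levelMatrix leftCoeff b s X s R) (levelMatrix rightCoeff b s Y s R)) :
    Tr (repeatProg (.reg 5) backwardStep) M (fun M' => Frame V M₀ 1 (2 ^ s * b) M' ∧
        Holds M' 6 1 (2 ^ s * b) fun _ => natPseudoProduct b s X Y)
      (6 ^ s * ((3 * b ^ 2 + 1) * backwardCost + 4)) (V ^ κ) := by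
  refine Tr.mono (tr_repeatProg (by omega) hM.le (n := .reg 5) (show 5 < 100 by norm_num)
    (show 1 ≤ κ by omega) (N := s) ((hM.reg 5 (by simp)).trans h5)
    (fun k M' => Frame V M₀ (6 ^ (s - k)) (2 ^ k * b) M' ∧
      Holds M' 6 (6 ^ (s - k)) (2 ^ k * b) fun R => natPseudoProduct b k
        (levelMatrix leftCoeff b s X (s - k) R) (levelMatrix rightCoeff b s Y (s - k) R))
    (fun k => (6 ^ (s - (k + 1)) * (2 ^ (s - (s - (k + 1))) * b * (2 ^ (s - (s - (k + 1))) * b)) + 1)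
      * backwardCost) ⟨by simpa using hM, by simpa using hXY⟩ ?_) ?_ ?_
  · rintro k hk M' ⟨h1, h2⟩
    -- Removes the truncated subtractions: pass `k` goes from level `l + 1` to level `l`.
    obtain ⟨l, rfl⟩ : ∃ l, s = l + 1 + k := ⟨s - (k + 1), by omega⟩
    have e1 : l + 1 + k - k = l + 1 := by omega
    have e2 : l + 1 + k - (k + 1) = l := by omega
    have e3 : l + 1 + k - l = k + 1 := by omega
    have e4 : l + 1 + k - (l + 1) = k := by omega
    have e5 : 2 ^ (k + 1) * b = 2 * (2 ^ k * b) := by ring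
    rw [e1] at h1 h2
    have hN := six_pow_mul_size_le (l := l) hsV (by omega)
    rw [e3, e5] at hN
    rw [e2, e3, e5]
    refine Tr.mono (tr_backwardStep hV hκ h1 h2 ?_ hN) ?_ le_rfl
    · rw [← e5]
      exact two_pow_mul_le hsV hk
    · rintro M' ⟨g1, g2⟩
      refine ⟨g1, g2.congr fun R hR x hx y hy => ?_⟩
      rw [natPseudoProduct_succ b k _ _
        (Nat.div_lt_of_lt_mul (by rwa [mul_comm]))
        (Nat.div_lt_of_lt_mul (by rwa [mul_comm]))]
      refine Finset.sum_congr rfl fun r hr => ?_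
      have hr6 := Finset.mem_range.mp hr
      have m1 : (R * 6 + r) % 6 = r := by omega
      have m2 : (R * 6 + r) / 6 = R := by omega
      simp only [levelMatrix, m1, m2, e4]
  · rintro M' ⟨h1, h2⟩
    simp only [Nat.sub_self] at h1 h2
    exact ⟨h1, h2⟩
  · have h1 := sum_levels_le b s backwardCost
    have h2 : 1 ≤ 6 ^ s := Nat.one_le_pow _ _ (by norm_num)
    -- A level has no more entries than the next deeper one, as `4 ≤ 6`. So, after reversing the
    -- order of summation, the bound for the forward passes applies.
    have h3 : ∀ l ∈ Finset.range s, 6 ^ l * (2 ^ (s - l) * b * (2 ^ (s - l) * b)) ≤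
        6 ^ (l + 1) * (2 ^ (s - (l + 1)) * b * (2 ^ (s - (l + 1)) * b)) := by
      intro l hl
      have e : s - l = s - (l + 1) + 1 := by
        have := Finset.mem_range.mp hl
        omega
      rw [two_pow_mul_sq, two_pow_mul_sq, e, pow_succ 4, pow_succ 6]
      nlinarith [Nat.zero_le (6 ^ l * 4 ^ (s - (l + 1)) * b ^ 2)]
    have h4 := Finset.sum_range_reflect (fun l =>
      (6 ^ l * (2 ^ (s - l) * b * (2 ^ (s - l) * b)) + 1) * backwardCost + 1) s
    simp only [Nat.sub_sub, add_comm 1] at h4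
    have h5 : ∑ l ∈ Finset.range s,
        ((6 ^ l * (2 ^ (s - l) * b * (2 ^ (s - l) * b)) + 1) * backwardCost + 1) ≤ _ :=
      (Finset.sum_le_sum fun l hl => Nat.add_le_add_right (Nat.mul_le_mul_right _
        (Nat.add_le_add_right (h3 l hl) 1)) 1).trans h1
    simp only [Expr.cost, h4]
    rw [show (3 * b ^ 2 + 1) * backwardCost + 4 = ((3 * b ^ 2 + 1) * backwardCost + 1) + 3 from rfl,
      mul_add]
    omega

lemma tr_multiply (hV : 6 ≤ V) (hκ : 40 ≤ κ) (hb : 1 ≤ b) (hsV : 6 ^ s * b ^ 2 ≤ V)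
    (hM : M.Le V) (h4 : M.reg 4 = 2 ^ s * b) (h5 : M.reg 5 = s)
    (hX : ∀ u < 2 ^ s * b, ∀ v < 2 ^ s * b, toGF2 (M.bit 4 (u * (2 ^ s * b) + v)) = X u v)
    (hY : ∀ u < 2 ^ s * b, ∀ v < 2 ^ s * b, toGF2 (M.bit 5 (u * (2 ^ s * b) + v)) = Y u v) :
    Tr (multiply b) M (fun M' => Frame V M 1 (2 ^ s * b) M' ∧
        ∀ x < 2 ^ s * b, ∀ y < 2 ^ s * b,
          toGF2 (M'.bit 6 (x * (2 ^ s * b) + y)) = natPseudoProduct b s X Y x y)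
      (6 ^ s * multiplyCost b) (V ^ κ) := by
  have hmV := two_pow_mul_le hsV le_rfl
  have hbV : b ≤ V := by simpa using two_pow_mul_le (l := 0) hsV (Nat.zero_le s)
  have f0 : Frame V M 1 (2 ^ s * b) ((M.setReg 6 1).setReg 7 (2 ^ s * b)) :=
    ⟨(hM.setReg 6 (by omega)).setReg 7 hmV, rfl, fun r hr => by
      have h6 : r ≠ 6 := by rintro rfl; simp at hr
      have h7 : r ≠ 7 := by rintro rfl; simp at hr
      simp [Mem.setReg, h6, h7], by simp [Mem.setReg], by simp [Mem.setReg], rfl⟩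
  have t1 : Tr (assign 6 (.const 1)) M (· = M.setReg 6 1) 3 (V ^ κ) :=
    tr_assign (by omega) hM (by norm_num) (show 1 ≤ V by omega) (show 1 ≤ κ by omega)
  have t2 : Tr (assign 7 (.reg 4)) (M.setReg 6 1) (· = (M.setReg 6 1).setReg 7 (2 ^ s * b)) 4
      (V ^ κ) := by
    have e : Expr.eval (.reg 4) (M.setReg 6 1) = 2 ^ s * b := h4
    rw [← e]
    exact tr_assign (by omega) (hM.setReg 6 (by omega)) (by norm_num) (show 4 < 100 by norm_num)
      (show 1 ≤ κ by omega)
  have hN : 6 ^ s * (b * b) ≤ V := by rwa [← sq]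
  refine Tr.mono (t1.seq (T' := 4 + (6 ^ s * ((3 * b ^ 2 + 1) * forwardCost + 4) +
      ((6 ^ s * (b * b) + 1) * (2 * blockCount.cost + (baseEntry b).cost + 50) +
        6 ^ s * ((3 * b ^ 2 + 1) * backwardCost + 4)))) ?_) (fun _ h => h) ?_
  · rintro M' rfl
    refine t2.seq ?_
    rintro M' rfl
    refine (tr_forward (X := X) (Y := Y) hV hκ hb hsV f0 h5 ?_ ?_).seq ?_
    · intro R hR u hu v hv
      obtain rfl : R = 0 := by omega
      rw [Nat.zero_mul, Nat.zero_add]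
      exact hX u hu v hv
    · intro R hR u hu v hv
      obtain rfl : R = 0 := by omega
      rw [Nat.zero_mul, Nat.zero_add]
      exact hY u hu v hv
    rintro M1 ⟨f1, g1, g2⟩
    refine (tr_baseStep hV hbV hκ f1 g1 g2 hN).seq ?_
    rintro M2 ⟨f2, g3⟩
    refine Tr.mono (tr_backward hV hκ hsV f2 h5 g3) ?_ le_rfl
    rintro M3 ⟨f3, g4⟩
    refine ⟨f3, fun x hx y hy => ?_⟩
    simpa using g4 0 one_pos x hx y hy
  · have h2 : 1 ≤ 6 ^ s := Nat.one_le_pow _ _ (by norm_num)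
    have key : ∀ p q r n B : ℕ, 1 ≤ n → 3 + (4 + (n * ((3 * B + 1) * p + 4) +
        ((n * B + 1) * r + n * ((3 * B + 1) * q + 4)))) ≤ n * ((3 * B + 1) * (p + q + r) + 20) := by
      intro p q r n B hn
      have : r ≤ n * r := Nat.le_mul_of_pos_left r hn
      nlinarith [Nat.zero_le (n * B * r)]
    have := key forwardCost backwardCost (2 * blockCount.cost + (baseEntry b).cost + 50) (6 ^ s)
      (b ^ 2) h2
    rw [← sq]
    exact this

end Multiply

/-! ### From the random choices to the result -/

/-- The number of entries of the large matrices. -/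
def entryCount : Expr := .reg 4 * .reg 4

/-- An entry of the left large matrix. -/
def leftFill : BExpr := .bit 0 (.load 0 (.reg 3 / .reg 4) * .reg 2 + .load 2 (.reg 3 % .reg 4))

/-- An entry of the right large matrix. -/
def rightFill : BExpr :=
  .gate and (.bit 1 (.load 2 (.reg 3 / .reg 4) * .reg 1 + .load 1 (.reg 3 % .reg 4)))
    (.bit 3 (.reg 3))

/-- The position of the output that an entry of the pseudo-product belongs to. -/
def outPosition : Expr := .load 0 (.reg 3 / .reg 4) * .reg 1 + .load 1 (.reg 3 % .reg 4)

/-- The disjunction of the output at that position with the entry of the pseudo-product. -/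
def outValue : BExpr := .gate or (.bit 2 outPosition) (.bit 6 (.reg 3))

/-- The deterministic part of the algorithm. -/
def compute (b : ℕ) : Program :=
  .seq (mapBits 4 entryCount leftFill) (.seq (mapBits 5 entryCount rightFill)
    (.seq (multiply b) (scatter 2 entryCount outPosition outValue)))

/-- The number of steps of `compute b` is at most `6 ^ s * computeCost b`. -/
def computeCost (b : ℕ) : ℕ :=
  (b ^ 2 + 1) * ((entryCount.cost + leftFill.cost + 22) + (entryCount.cost + rightFill.cost + 22) +
    (entryCount.cost + outPosition.cost + outValue.cost + 20)) + multiplyCost b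

section Compute

variable {V κ : ℕ}

/-- The output array starts as all `false` and accumulates disjunctions, so after `t` passes it
marks the positions hit by a `1` among the first `t` entries. -/
lemma tr_scatter_or (hV : 2 ≤ V) (hκ : 10 ≤ κ) {M : Mem} (hM : M.Le V)
    (h2 : M.bit 2 = fun _ => false) {m d : ℕ} (h4 : M.reg 4 = m) (h1 : M.reg 1 = d)
    (hm : m * m ≤ V) :
    Tr (scatter 2 entryCount outPosition outValue) M (fun M' => ∀ p, M'.bit 2 p = true ↔
        ∃ x < m, ∃ y < m, M.word 0 x * d + M.word 1 y = p ∧ M.bit 6 (x * m + y) = true)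
      ((m * m + 1) * (entryCount.cost + outPosition.cost + outValue.cost + 20)) (V ^ κ) := by
  set dst : ℕ → ℕ := fun t => M.word 0 (t / m) * d + M.word 1 (t % m) with hdst
  have hd : ∀ t g, outPosition.eval ((M.setReg 3 t).setBits 2 g) = dst t := by
    intro t g
    simp [outPosition, Expr.op_eq, Expr.eval, Op.eval, Mem.setReg, Mem.setBits, h4, h1, hdst]
  refine Tr.mono (tr_scatter hV (by omega) hM (by norm_num)
    (show entryCount.Ok V from ⟨by norm_num [Expr.Ok], by norm_num [Expr.Ok]⟩)
    (show 2 ≤ κ by omega)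
    (show outPosition.Ok V by simp [outPosition, Expr.op_eq, Expr.Ok]) (show 5 ≤ κ by omega)
    (show outValue.Ok V κ from ⟨⟨by norm_num, by simp [outPosition, Expr.op_eq, Expr.Ok],
      show 5 ≤ κ by omega⟩, by norm_num, by norm_num [Expr.Ok], show 1 ≤ κ by omega⟩)
    (N := m * m) ?_ hm
    (fun t p => decide (∃ t' < t, dst t' = p ∧ M.bit 6 t' = true)) ?_ ?_) ?_ le_rfl
  · simp [entryCount, Expr.op_eq, Expr.eval, Op.eval, Mem.setReg, h4]
  · simp [h2]
  · intro t ht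
    have hv : ∀ g, outValue.eval ((M.setReg 3 t).setBits 2 g) = (g (dst t) || M.bit 6 t) := by
      intro g
      simp only [outValue, BExpr.eval, hd]
      simp [Expr.eval, Mem.setReg, Mem.setBits]
    rw [hd, hv]
    ext p
    by_cases hp : p = dst t
    · subst hp
      rw [Function.update_self, Bool.eq_iff_iff]
      simp only [decide_eq_true_eq, Bool.or_eq_true, Nat.lt_succ_iff_lt_or_eq, or_and_right,
        exists_or, exists_eq_left, true_and]
    · simp only [Function.update_of_ne hp]
      congr 1
      refine propext ⟨?_, ?_⟩
      · rintro ⟨t', ht', h⟩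
        rcases Nat.lt_succ_iff_lt_or_eq.mp ht' with h' | rfl
        · exact ⟨t', h', h⟩
        · exact absurd h.1.symm hp
      · rintro ⟨t', ht', h⟩
        exact ⟨t', by omega, h⟩
  · rintro M' rfl p
    simp only [Mem.setBits, Function.update_self, decide_eq_true_eq]
    constructor
    · rintro ⟨t, ht, h1, h2⟩
      have hm0 : 0 < m := by
        rcases Nat.eq_zero_or_pos m with rfl | h
        · simp at ht
        · exact h
      exact ⟨t / m, Nat.div_lt_of_lt_mul ht, t % m, Nat.mod_lt _ hm0, h1, by
        rwa [mul_comm, Nat.div_add_mod]⟩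
    · rintro ⟨x, hx, y, hy, h1, h2⟩
      have e1 : (x * m + y) / m = x := by
        rw [add_comm, Nat.add_mul_div_right _ _ (by omega), Nat.div_eq_of_lt hy, zero_add]
      have e2 : (x * m + y) % m = y := by
        rw [add_comm, Nat.add_mul_mod_self_right, Nat.mod_eq_of_lt hy]
      refine ⟨x * m + y, by nlinarith, ?_, h2⟩
      simpa only [hdst, e1, e2] using h1

lemma toGF2_eq_one {v : Bool} : toGF2 v = 1 ↔ v = true := by
  cases v <;> simp [toGF2]

lemma tr_compute (hV : 6 ≤ V) (hκ : 40 ≤ κ) {b s : ℕ} (hb : 1 ≤ b) (hsV : 6 ^ s * b ^ 2 ≤ V)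
    {M : Mem} (hM : M.Le V) {d₂ d₃ : ℕ} (h1 : M.reg 1 = d₂) (h2 : M.reg 2 = d₃)
    (h4 : M.reg 4 = 2 ^ s * b) (h5 : M.reg 5 = s) (hb2 : M.bit 2 = fun _ => false) :
    Tr (compute b) M (fun M' => ∀ p, M'.bit 2 p = true ↔ ∃ x < 2 ^ s * b, ∃ y < 2 ^ s * b,
        M.word 0 x * d₂ + M.word 1 y = p ∧ natPseudoProduct b s
          (fun u v => toGF2 (M.bit 0 (M.word 0 u * d₃ + M.word 2 v)))
          (fun u v => toGF2 (M.bit 1 (M.word 2 u * d₂ + M.word 1 v)) *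
            toGF2 (M.bit 3 (u * (2 ^ s * b) + v))) x y = 1)
      (6 ^ s * computeCost b) (V ^ κ) := by
  -- Work linear in the number of entries of the large matrices is within the budget, because `4 ≤
  -- 6`.
  have hmm : 2 ^ s * b * (2 ^ s * b) ≤ 6 ^ s * b ^ 2 := by
    rw [two_pow_mul_sq]
    exact Nat.mul_le_mul_right _ (Nat.pow_le_pow_left (by norm_num) s)
  have hmV := hmm.trans hsV
  have hm1 : 2 ^ s * b ≤ V := two_pow_mul_le hsV le_rfl
  set m := 2 ^ s * b with hm
  have hcok : entryCount.Ok V := ⟨by norm_num [Expr.Ok], by norm_num [Expr.Ok]⟩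
  have hcount : ∀ (M : Mem) t, M.reg 4 = m → entryCount.eval (M.setReg 3 t) = m * m := by
    intro M t h
    simp [entryCount, Expr.op_eq, Expr.eval, Op.eval, Mem.setReg, h]
  set l : ℕ → Bool := fun t => M.bit 0 (M.word 0 (t / m) * d₃ + M.word 2 (t % m)) with hl
  set r : ℕ → Bool := fun t => M.bit 1 (M.word 2 (t / m) * d₂ + M.word 1 (t % m)) && M.bit 3 t
    with hr
  set M1 := (M.setReg 3 (m * m)).setBits 4 fun p => if p < m * m then l p else M.bit 4 p with hM1
  set M2 := (M1.setReg 3 (m * m)).setBits 5 fun p => if p < m * m then r p else M1.bit 5 p with hM2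
  have t1 : Tr (mapBits 4 entryCount leftFill) M (· = M1)
      ((m * m + 1) * (entryCount.cost + leftFill.cost + 22)) (V ^ κ) := by
    refine tr_mapBits (by omega) (by omega) hM (by norm_num) hcok (show 2 ≤ κ by omega)
      (show leftFill.Ok V κ from ⟨by norm_num, by simp [Expr.op_eq, Expr.Ok],
        show 5 ≤ κ by omega⟩) (hcount M 0 h4) hmV l ?_
    intro t _ g
    simp [leftFill, BExpr.eval, Expr.op_eq, Expr.eval, Op.eval, Mem.setReg, Mem.setBits, h4, h2, hl]
  have le1 : M1.Le V := (hM.setReg 3 hmV).setBits _ _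
  have t2 : Tr (mapBits 5 entryCount rightFill) M1 (· = M2)
      ((m * m + 1) * (entryCount.cost + rightFill.cost + 22)) (V ^ κ) := by
    refine tr_mapBits (by omega) (by omega) le1 (by norm_num) hcok (show 2 ≤ κ by omega)
      (show rightFill.Ok V κ from ⟨⟨by norm_num, by simp [Expr.op_eq, Expr.Ok],
        show 5 ≤ κ by omega⟩, by norm_num, by norm_num [Expr.Ok], show 1 ≤ κ by omega⟩)
      (hcount M1 0 (by simpa [hM1, Mem.setReg, Mem.setBits] using h4)) hmV r ?_
    intro t _ g
    simp [rightFill, BExpr.eval, Expr.op_eq, Expr.eval, Op.eval, Mem.setReg, Mem.setBits, h4, h1,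
      hr, hM1]
  have le2 : M2.Le V := (le1.setReg 3 hmV).setBits _ _
  have hlt : ∀ {u v}, u < m → v < m → u * m + v < m * m := fun hu hv => by nlinarith
  have hdiv : ∀ {u v}, v < m → (u * m + v) / m = u := fun {u v} hv => by
    rw [add_comm, Nat.add_mul_div_right _ _ (by omega), Nat.div_eq_of_lt hv, zero_add]
  have hmod : ∀ {u v}, v < m → (u * m + v) % m = v := fun {u v} hv => by
    rw [add_comm, Nat.add_mul_mod_self_right, Nat.mod_eq_of_lt hv]
  have t3 := tr_multiply (M := M2) (s := s)
    (X := fun u v => toGF2 (M.bit 0 (M.word 0 u * d₃ + M.word 2 v)))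
    (Y := fun u v => toGF2 (M.bit 1 (M.word 2 u * d₂ + M.word 1 v)) * toGF2 (M.bit 3 (u * m + v)))
    hV hκ hb hsV le2
    (by simpa [hM2, hM1, Mem.setReg, Mem.setBits] using h4)
    (by simpa [hM2, hM1, Mem.setReg, Mem.setBits] using h5)
    (by
      intro u hu v hv
      have := hlt hu hv
      simp [hM2, hM1, Mem.setReg, Mem.setBits, ← hm, this, hl, hdiv hv, hmod hv])
    (by
      intro u hu v hv
      have := hlt hu hv
      rw [← BExpr.toGF2_and]
      simp [hM2, Mem.setReg, Mem.setBits, ← hm, this, hr, hdiv hv, hmod hv])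
  refine Tr.mono (t1.seq (T' := (m * m + 1) * (entryCount.cost + rightFill.cost + 22) +
    (6 ^ s * multiplyCost b + (m * m + 1) *
      (entryCount.cost + outPosition.cost + outValue.cost + 20))) ?_) (fun _ h => h) ?_
  · rintro M' rfl
    refine t2.seq ?_
    rintro M' rfl
    refine t3.seq ?_
    rintro M3 ⟨f, h6⟩
    have w3 : M3.word = M.word := f.word
    have e1 : M3.reg 1 = d₂ := (f.reg 1 (by simp)).trans (by simpa [hM2, hM1, Mem.setReg, Mem.setBits] using h1)
    have e4 : M3.reg 4 = m := (f.reg 4 (by simp)).trans (by simpa [hM2, hM1, Mem.setReg, Mem.setBits] using h4)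
    have e2 : M3.bit 2 = fun _ => false := f.out.trans hb2
    refine Tr.mono (tr_scatter_or (by omega) (by omega) f.le e2 e4 e1 hmV) ?_ le_rfl
    intro M4 h p
    rw [h p, w3]
    refine exists_congr fun x => and_congr_right fun hx => exists_congr fun y =>
      and_congr_right fun hy => and_congr_right fun _ => ?_
    rw [← toGF2_eq_one, h6 x hx y hy]
  · have h6 : 1 ≤ 6 ^ s := Nat.one_le_pow _ _ (by norm_num)
    have key : ∀ n N B p q r M : ℕ, 1 ≤ n → N ≤ n * B →
        (N + 1) * p + ((N + 1) * q + (n * M + (N + 1) * r)) ≤ n * ((B + 1) * (p + q + r) + M) := by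
      intro n N B p q r M hn hN
      have : (N + 1) * (p + q + r) ≤ (n * (B + 1)) * (p + q + r) :=
        Nat.mul_le_mul_right _ (by rw [mul_add]; omega)
      nlinarith
    exact key _ _ _ _ _ _ _ h6 hmm

end Compute

/-! ### Computing the parameter on the machine -/

section Parameters

/-- Compute the parameter `s` in register `5` and the size `2 ^ s * b` in register `4`. -/
def parameters (C b : ℕ) : Program :=
  -- Register `9` holds `C * ψ₃`, register `5` the current `s`, which starts at `0`, and register
  -- `10` holds `7 ^ s`.
  .seq (assign 9 (.const C * (.reg 0 * .reg 1 * .reg 2)))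
    (.seq (assign 10 (.const 1))
      (.seq (repeatProg (.reg 0 + .reg 1 + .reg 2 + .const C)
          -- By truncated subtraction this is `1` if `7 ^ s < C * ψ₃ * (s + 1)` and `0` otherwise.
          -- Then `s` grows by it and `7 ^ s` is multiplied by `7` or `1`.
          (.seq (assign 8 (.const 1 - (.const 1 - (.reg 9 * (.reg 5 + .const 1) - .reg 10))))
            (.seq (assign 5 (.reg 5 + .reg 8))
              (assign 10 (.reg 10 * (.const 1 + .const 6 * .reg 8))))))
        (.seq (assign 4 (.const b)) (repeatProg (.reg 5) (assign 4 (.const 2 * .reg 4))))))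

/-- Bounds all intermediate values of the search by the final one. -/
lemma growExp_mono (N : ℕ) : Monotone (growExp N) := by
  refine monotone_nat_of_le_succ fun k => ?_
  simp only [growExp]
  split_ifs <;> omega

variable {V κ : ℕ}

/-- The memories agree up to the registers above `2`. -/
structure Agree (V : ℕ) (M M' : Mem) : Prop where
  le : M'.Le V
  word : M'.word = M.word
  bit : M'.bit = M.bit
  reg : ∀ r < 3, M'.reg r = M.reg r

lemma Agree.setReg {M M' : Mem} (h : Agree V M M') {r v : ℕ} (hr : 3 ≤ r) (hv : v ≤ V) :
    Agree V M (M'.setReg r v) where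
  le := h.le.setReg r hv
  word := h.word
  bit := h.bit
  reg r' hr' := by
    have : r' ≠ r := by omega
    simpa [Mem.setReg, this] using h.reg r' hr'

lemma tr_set {M : Mem} {r v : ℕ} {e : Expr} (hV : 2 ≤ V) (hM : M.Le V) (hr : r < 100)
    (he : e.Ok V) (hκ : e.leaves ≤ κ) (hv : e.eval M = v) :
    Tr (assign r e) M (· = M.setReg r v) (e.cost + 2) (V ^ κ) := by
  rw [← hv]
  exact tr_assign hV hM hr he hκ

lemma tr_parameters (hV : 10 ≤ V) (hκ : 40 ≤ κ) {C b d₁ d₂ d₃ : ℕ} (hb : 1 ≤ b) {M : Mem}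
    (hM : M.Le V) (h0 : M.reg 0 = d₁) (h1 : M.reg 1 = d₂) (h2 : M.reg 2 = d₃) (h5 : M.reg 5 = 0)
    (hCV : C ≤ V) (hsV : 7 ^ levels C d₁ d₂ d₃ * b ≤ V) (hs : levels C d₁ d₂ d₃ ≤ V) :
    Tr (parameters C b) M (fun M' => Agree V M M' ∧
        M'.reg 4 = 2 ^ levels C d₁ d₂ d₃ * b ∧ M'.reg 5 = levels C d₁ d₂ d₃)
      ((d₁ + d₂ + d₃ + C) * 60 + levels C d₁ d₂ d₃ * 20 + 60) (V ^ κ) := by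
  set N := C * (d₁ * d₂ * d₃) with hN
  set s := levels C d₁ d₂ d₃ with hs'
  have h7 : 7 ^ s ≤ V := (Nat.le_mul_of_pos_right _ hb).trans hsV
  have hNV : N ≤ V := ((Nat.le_mul_of_pos_right _ (Nat.succ_pos _)).trans
    (levels_spec C d₁ d₂ d₃)).trans h7
  have hV2 : 2 ≤ V := by omega
  have t1 := tr_set (r := 9) (v := N) (κ := κ) (e := .const C * (.reg 0 * .reg 1 * .reg 2)) hV2 hM
    (by norm_num) (by simp [Expr.Ok, hCV]) (by change 4 ≤ κ; omega)
    (by simp [Expr.eval, Op.eval, h0, h1, h2, hN])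
  have a0 : Agree V M M := ⟨hM, rfl, rfl, fun _ _ => rfl⟩
  have a1 := a0.setReg (r := 9) (v := N) (by norm_num) hNV
  have t2 := tr_set (r := 10) (v := 1) (κ := κ) (e := .const 1) hV2 a1.le (by norm_num)
    (show 1 ≤ V by omega) (by change 1 ≤ κ; omega) rfl
  have a2 := a1.setReg (r := 10) (v := 1) (by norm_num) (by omega)
  set M2 := (M.setReg 9 N).setReg 10 1 with hM2
  have t3 : Tr (repeatProg (.reg 0 + .reg 1 + .reg 2 + .const C)
      (.seq (assign 8 (.const 1 - (.const 1 - (.reg 9 * (.reg 5 + .const 1) - .reg 10))))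
        (.seq (assign 5 (.reg 5 + .reg 8))
          (assign 10 (.reg 10 * (.const 1 + .const 6 * .reg 8)))))) M2
      (fun M' => Agree V M M' ∧ M'.reg 5 = s) ((d₁ + d₂ + d₃ + C) * 60 + 20) (V ^ κ) := by
    refine Tr.mono (tr_repeatProg hV2 a2.le (by simp [Expr.Ok, hCV])
      (by change 4 ≤ κ; omega) (N := d₁ + d₂ + d₃ + C)
      (by simp [Expr.eval, Op.eval, a2.reg, h0, h1, h2])
      (fun k M' => Agree V M M' ∧ M'.reg 5 = growExp N k ∧ M'.reg 9 = N ∧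
        M'.reg 10 = 7 ^ growExp N k) (fun _ => 50) ?_ ?_) ?_ ?_
    · exact ⟨a2, by simpa [hM2, Mem.setReg, growExp] using h5, by simp [hM2, Mem.setReg],
        by simp [hM2, Mem.setReg, growExp]⟩
    · rintro k hk M' ⟨a, e5, e9, e10⟩
      have hg : growExp N (k + 1) ≤ s := growExp_mono N hk
      have hp : 7 ^ growExp N (k + 1) ≤ V := (Nat.pow_le_pow_right (by norm_num) hg).trans h7
      set x := if 7 ^ growExp N k < N * (growExp N k + 1) then 1 else 0 with hx
      have hx1 : x ≤ 1 := by rw [hx]; split_ifs <;> omega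
      have g1 : growExp N k + x = growExp N (k + 1) := by
        rw [growExp, hx]; split_ifs <;> omega
      have g2 : 7 ^ growExp N k * (1 + 6 * x) = 7 ^ growExp N (k + 1) := by
        rw [← g1, pow_add, hx]; split_ifs <;> simp
      have u1 := tr_set (r := 8) (v := x) (κ := κ)
        (e := .const 1 - (.const 1 - (.reg 9 * (.reg 5 + .const 1) - .reg 10))) hV2 a.le
        (by norm_num) (by simp [Expr.op_eq, Expr.Ok]; omega) (by change 6 ≤ κ; omega)
        (by
          simp only [Expr.op_eq, Expr.eval, Op.eval, e5, e9, e10, hx]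
          split_ifs <;> omega)
      have b1 := a.setReg (r := 8) (v := x) (by norm_num) (by omega)
      have u2 := tr_set (r := 5) (v := growExp N (k + 1)) (κ := κ) (e := .reg 5 + .reg 8) hV2 b1.le
        (by norm_num) (by simp [Expr.Ok]) (by change 2 ≤ κ; omega)
        (by simp [Expr.eval, Op.eval, Mem.setReg, e5, g1])
      have b2 := b1.setReg (r := 5) (v := growExp N (k + 1)) (by norm_num) (by omega)
      have u3 := tr_set (r := 10) (v := 7 ^ growExp N (k + 1)) (κ := κ)
        (e := .reg 10 * (.const 1 + .const 6 * .reg 8)) hV2 b2.le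
        (by norm_num) (by simp [Expr.Ok]; omega) (by change 4 ≤ κ; omega)
        (by simp [Expr.eval, Op.eval, Mem.setReg, e10, g2])
      have b3 := b2.setReg (r := 10) (v := 7 ^ growExp N (k + 1)) (by norm_num) hp
      refine Tr.mono (u1.seq (T' := 4 + 3 + (1 + 2 + 2 + 1 + 20)) ?_) (fun _ h => h) ?_
      · rintro M' rfl
        refine Tr.mono (u2.seq (T' := 15) ?_) (fun _ h => h) ?_
        · rintro M' rfl
          refine Tr.mono u3 ?_ ?_
          · rintro M' rfl
            exact ⟨b3, by simp [Mem.setReg], by simpa [Mem.setReg] using e9, by simp [Mem.setReg]⟩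
          · simp [Expr.cost]
        · simp [Expr.cost]
      · simp [Expr.op_eq, Expr.cost]
    · rintro M' ⟨a, e, -, -⟩
      exact ⟨a, e⟩
    · simp [Expr.cost]
      omega
  refine Tr.mono (t1.seq (T' := 3 + ((d₁ + d₂ + d₃ + C) * 60 + 20 + (3 + (s * 20 + 3)))) ?_)
    (fun _ h => h) ?_
  · rintro M' rfl
    refine Tr.seq t2 ?_
    rintro M' rfl
    refine t3.seq ?_
    rintro M3 ⟨a3, e5⟩
    have hbV : b ≤ V := (Nat.le_mul_of_pos_left _ (by positivity)).trans hsV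
    have t4 := tr_set (r := 4) (v := b) (κ := κ) (e := .const b) hV2 a3.le (by norm_num) hbV
      (by change 1 ≤ κ; omega) rfl
    have a4 := a3.setReg (r := 4) (v := b) (by norm_num) hbV
    refine t4.seq ?_
    rintro M' rfl
    refine Tr.mono (tr_repeatProg hV2 a4.le (n := .reg 5) (show 5 < 100 by norm_num)
      (by change 1 ≤ κ; omega) (N := s) (by simpa [Expr.eval, Mem.setReg] using e5)
      (fun k M' => Agree V M M' ∧ M'.reg 4 = 2 ^ k * b ∧ M'.reg 5 = s) (fun _ => 6) ?_ ?_)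
      (fun _ h => h) ?_
    · exact ⟨a4, by simp [Mem.setReg], by simpa [Mem.setReg] using e5⟩
    · rintro k hk M' ⟨a, e4, e5⟩
      have hpV : 2 ^ (k + 1) * b ≤ V := (Nat.mul_le_mul_right b ((Nat.pow_le_pow_left
        (by norm_num) _).trans (Nat.pow_le_pow_right (by norm_num) hk))).trans hsV
      refine Tr.mono (tr_set (r := 4) (v := 2 ^ (k + 1) * b) (e := .const 2 * .reg 4) hV2 a.le
        (by norm_num) (by simp [Expr.Ok, hV2]) (by change 2 ≤ κ; omega)
        (by simp [Expr.eval, Op.eval, e4, pow_succ']; ring)) ?_ ?_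
      · rintro M' rfl
        exact ⟨a.setReg (by norm_num) hpV, by simp [Mem.setReg], by simpa [Mem.setReg] using e5⟩
      · simp [Expr.cost]
    · simp [Expr.cost]
      omega
  · simp [Expr.cost]
    omega

end Parameters

/-! ### The whole program -/

lemma bitArray_apply {p q : ℕ} (A : Matrix (Fin p) (Fin q) Bool) (i : Fin p) (j : Fin q) :
    bitArray A (i * q + j) = A i j := by
  have e : (⟨i * q + j, by nlinarith [i.2, j.2]⟩ : Fin (p * q)) = finProdFinEquiv (i, j) := by
    ext
    simp [finProdFinEquiv]
    ring
  have h : (i * q + j : ℕ) < p * q := by nlinarith [i.2, j.2]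
  rw [bitArray, dif_pos h, e, Equiv.symm_apply_apply]

section Estimate

variable {d₁ d₂ d₃ s b : ℕ}

lemma natPseudoProduct_eq_pseudoProduct {X Y : ℕ → ℕ → ZMod 2}
    {A B : Matrix (Index s b) (Index s b) (ZMod 2)}
    (hX : ∀ x z, X (encode b s x) (encode b s z) = A x z)
    (hY : ∀ z y, Y (encode b s z) (encode b s y) = B z y) (x y : Index s b) :
    natPseudoProduct b s X Y (encode b s x) (encode b s y) = pseudoProduct A B x y := by
  rw [← sum_compatible_eq_natPseudoProduct, pseudoProduct_apply]
  simp only [hX, hY]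

lemma estimate_eq_true_iff (A : Matrix (Fin d₁) (Fin d₃) Bool) (B : Matrix (Fin d₃) (Fin d₂) Bool)
    (ω : Coins d₁ d₂ d₃ s b) {w₀ w₁ w₂ : ℕ → ℕ} {D : ℕ → Bool}
    (h₀ : ∀ x, w₀ (encode b s x) = ω.1 x) (h₁ : ∀ x, w₁ (encode b s x) = ω.2.1 x)
    (h₂ : ∀ x, w₂ (encode b s x) = ω.2.2.1 x)
    (hD : ∀ z y, D (encode b s z * (2 ^ s * b) + encode b s y) = ω.2.2.2 z y) (i : Fin d₁)
    (j : Fin d₂) :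
    (∃ x < 2 ^ s * b, ∃ y < 2 ^ s * b, w₀ x * d₂ + w₁ y = i * d₂ + j ∧ natPseudoProduct b s
      (fun u v => toGF2 (bitArray A (w₀ u * d₃ + w₂ v)))
      (fun u v => toGF2 (bitArray B (w₂ u * d₂ + w₁ v)) * toGF2 (D (u * (2 ^ s * b) + v))) x y = 1)
      ↔ estimate A B ω i j = true := by
  have key := natPseudoProduct_eq_pseudoProduct (A := Abar A ω) (B := Bbar B ω)
    (X := fun u v => toGF2 (bitArray A (w₀ u * d₃ + w₂ v)))
    (Y := fun u v => toGF2 (bitArray B (w₂ u * d₂ + w₁ v)) * toGF2 (D (u * (2 ^ s * b) + v)))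
    (fun x z => by simp only [h₀, h₂, bitArray_apply, Abar])
    (fun z y => by simp only [h₁, h₂, hD, bitArray_apply, Bbar])
  -- Row and column are recovered as quotient and remainder modulo `d₂`, since both column numbers
  -- are below `d₂`.
  have pos : ∀ x y, w₀ (encode b s x) * d₂ + w₁ (encode b s y) = i * d₂ + j ↔
      ω.1 x = i ∧ ω.2.1 y = j := by
    intro x y
    rw [h₀, h₁]
    constructor
    · intro h
      have hy := (ω.2.1 y).2
      have hj := j.2
      have e1 := congrArg (· / d₂) h
      have e2 := congrArg (· % d₂) h
      simp only [Nat.add_mod, Nat.mul_mod_left, Nat.zero_add, Nat.mod_eq_of_lt hy,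
        Nat.mod_eq_of_lt hj] at e2
      simp only [add_comm _ (ω.2.1 y : ℕ), add_comm _ (j : ℕ),
        Nat.add_mul_div_right _ _ (Nat.zero_lt_of_lt hj), Nat.div_eq_of_lt hy, Nat.div_eq_of_lt hj,
        Nat.zero_add] at e1
      exact ⟨Fin.ext e1, Fin.ext e2⟩
    · rintro ⟨rfl, rfl⟩
      rfl
  simp only [estimate, decide_eq_true_eq]
  constructor
  · rintro ⟨x, hx, y, hy, h⟩
    obtain ⟨x', hx'⟩ := (encode b s).surjective ⟨x, hx⟩
    obtain ⟨y', hy'⟩ := (encode b s).surjective ⟨y, hy⟩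
    obtain rfl : (encode b s x' : ℕ) = x := congrArg Fin.val hx'
    obtain rfl : (encode b s y' : ℕ) = y := congrArg Fin.val hy'
    rw [key, pos] at h
    exact ⟨x', y', h.1.1, h.1.2, h.2⟩
  · rintro ⟨x, y, h1, h2, h⟩
    exact ⟨_, (encode b s x).2, _, (encode b s y).2, (pos x y).mpr ⟨h1, h2⟩, by rw [key, h]⟩

/-- The random choices as the sequences in which they are drawn. -/
def coinsEquiv (d₁ d₂ d₃ s b : ℕ) : Coins d₁ d₂ d₃ s b ≃
    (Fin (2 ^ s * b) → Fin d₁) × (Fin (2 ^ s * b) → Fin d₂) × (Fin (2 ^ s * b) → Fin d₃) ×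
      (Fin (2 ^ s * b * (2 ^ s * b)) → Bool) :=
  (Equiv.arrowCongr (encode b s) (Equiv.refl _)).prodCongr
    ((Equiv.arrowCongr (encode b s) (Equiv.refl _)).prodCongr
      ((Equiv.arrowCongr (encode b s) (Equiv.refl _)).prodCongr
        ((Equiv.curry _ _ _).symm.trans (Equiv.arrowCongr
          (((encode b s).prodCongr (encode b s)).trans finProdFinEquiv) (Equiv.refl _)))))

end Estimate

/-- Draw the random choices. -/
def draws : Program :=
  .seq (drawWords 0 (.reg 4) 0) (.seq (drawWords 1 (.reg 4) 1)
    (.seq (drawWords 2 (.reg 4) 2) (drawBits 3 entryCount)))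

/-- The memory `M'` arises from `M` by storing the random choices. -/
structure Drawn {d₁ d₂ d₃ m : ℕ} (V : ℕ) (M : Mem) (f₁ : Fin m → Fin d₁) (f₂ : Fin m → Fin d₂)
    (f₃ : Fin m → Fin d₃) (D : Fin (m * m) → Bool) (M' : Mem) : Prop where
  le : M'.Le V
  reg : ∀ r ≠ 3, M'.reg r = M.reg r
  bit : ∀ a ≠ 3, M'.bit a = M.bit a
  word₀ : ∀ i, M'.word 0 i = if h : i < m then (f₁ ⟨i, h⟩ : ℕ) else M.word 0 i
  word₁ : ∀ i, M'.word 1 i = if h : i < m then (f₂ ⟨i, h⟩ : ℕ) else M.word 1 i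
  word₂ : ∀ i, M'.word 2 i = if h : i < m then (f₃ ⟨i, h⟩ : ℕ) else M.word 2 i
  bits : ∀ i, M'.bit 3 i = if h : i < m * m then D ⟨i, h⟩ else M.bit 3 i

lemma Mem.Le.setWords {V : ℕ} {M : Mem} (h : M.Le V) (a : ℕ) {g : ℕ → ℕ} (hg : ∀ i, g i ≤ V) :
    (M.setWords a g).Le V := by
  refine ⟨h.1, fun a' i => ?_⟩
  by_cases ha : a' = a
  · subst ha
    simpa [Mem.setWords] using hg i
  · simpa [Mem.setWords, ha] using h.2 a' i

lemma rn_draws {V κ d₁ d₂ d₃ m : ℕ} [NeZero d₁] [NeZero d₂] [NeZero d₃] (hV : 2 ≤ V) (hκ : 2 ≤ κ)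
    {M : Mem} (hM : M.Le V) (h0 : M.reg 0 = d₁) (h1 : M.reg 1 = d₂) (h2 : M.reg 2 = d₃)
    (h4 : M.reg 4 = m) (hm : m * m ≤ V) :
    Rn draws M (fun (α : (Fin m → Fin d₁) × (Fin m → Fin d₂) × (Fin m → Fin d₃) ×
      (Fin (m * m) → Bool)) => Drawn V M α.1 α.2.1 α.2.2.1 α.2.2.2)
      ((m + 1) * 24 + ((m + 1) * 24 + ((m + 1) * 24 + (m * m + 1) * 26))) (V ^ κ) := by
  have hmV : m ≤ V := h4 ▸ hM.1 4
  have e4 : Expr.Ok V (.reg 4) := show 4 < 100 by norm_num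
  have l4 : (Expr.reg 4).leaves ≤ κ := show 1 ≤ κ by omega
  have hle : ∀ {M : Mem} {a d : ℕ} (f : Fin m → Fin d), M.Le V → d ≤ V →
      ((M.setReg 3 m).setWords a fun t => if h : t < m then (f ⟨t, h⟩ : ℕ) else M.word a t).Le V := by
    intro M a d f h hd
    refine (h.setReg 3 hmV).setWords a fun i => ?_
    split_ifs with hi
    · exact (f ⟨i, hi⟩).2.le.trans hd
    · exact h.2 a i
  refine Rn.seq (Q' := fun f₁ (β : (Fin m → Fin d₂) × (Fin m → Fin d₃) × (Fin (m * m) → Bool)) =>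
     Drawn V M f₁ β.1 β.2.1 β.2.2) (rn_drawWords hV hκ hM e4 l4
    (N := m) h4 hmV (d := d₁) (u := 0) (by norm_num) (by norm_num) h0) ?_
  rintro f₁ M' rfl
  have le1 := hle (a := 0) f₁ hM (h0 ▸ hM.1 0)
  set M1 := (M.setReg 3 m).setWords 0 fun t => if h : t < m then (f₁ ⟨t, h⟩ : ℕ) else M.word 0 t
    with hM1
  refine Rn.seq (Q' := fun f₂ (β : (Fin m → Fin d₃) × (Fin (m * m) → Bool)) =>
     Drawn V M f₁ f₂ β.1 β.2) (rn_drawWords hV hκ le1 e4 l4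
    (N := m) h4 hmV (d := d₂) (u := 1) (by norm_num) (by norm_num) h1) ?_
  rintro f₂ M' rfl
  have le2 := hle (a := 1) f₂ le1 (h1 ▸ hM.1 1)
  set M2 := (M1.setReg 3 m).setWords 1 fun t => if h : t < m then (f₂ ⟨t, h⟩ : ℕ) else M1.word 1 t
    with hM2
  refine Rn.seq (Q' := fun f₃ D => Drawn V M f₁ f₂ f₃ D) (rn_drawWords hV hκ le2 e4 l4
    (N := m) h4 hmV (d := d₃) (u := 2) (by norm_num) (by norm_num) h2) ?_
  rintro f₃ M' rfl
  have le3 := hle (a := 2) f₃ le2 (h2 ▸ hM.1 2)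
  set M3 := (M2.setReg 3 m).setWords 2 fun t => if h : t < m then (f₃ ⟨t, h⟩ : ℕ) else M2.word 2 t
    with hM3
  have e3 : entryCount.eval (M3.setReg 3 0) = m * m := congrArg₂ (· * ·) h4 h4
  refine Rn.mono (rn_drawBits hV hκ le3 (a := 3) (n := entryCount)
    ⟨by norm_num [Expr.Ok], by norm_num [Expr.Ok]⟩ (show 2 ≤ κ by omega) e3 hm (by norm_num))
    ?_ le_rfl
  rintro D M' rfl
  refine ⟨(le3.setReg 3 hm).setBits _ _, fun r hr => ?_, fun a ha => ?_, fun i => ?_, fun i => ?_,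
    fun i => ?_, fun i => ?_⟩
  · simp [hM3, hM2, hM1, Mem.setReg, Mem.setWords, Mem.setBits, hr]
  · simp [hM3, hM2, hM1, Mem.setReg, Mem.setWords, Mem.setBits, ha]
  · simp [hM3, hM2, hM1, Mem.setReg, Mem.setWords, Mem.setBits]
  · simp [hM3, hM2, hM1, Mem.setReg, Mem.setWords, Mem.setBits]
  · simp [hM3, hM2, hM1, Mem.setReg, Mem.setWords, Mem.setBits]
  · simp [hM3, hM2, hM1, Mem.setReg, Mem.setWords, Mem.setBits]

/-- The program. -/
def program (C b : ℕ) : Program := .seq (parameters C b) (.seq draws (compute b))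

/-- The number of steps of `program C b` is at most `6 ^ s * programCost C b`. -/
def programCost (C b : ℕ) : ℕ :=
  60 * C + 140 + 72 * (b + 1) + 26 * (b ^ 2 + 1) + computeCost b

/-- The search for `s` takes time linear in `d₁ + d₂ + d₃`; `hd` keeps it within the budget. The
drawn sequences are identified with the coins by `coinsEquiv`, so the output is the estimate for the
same coins. -/
lemma rn_program {V κ C b d₁ d₂ d₃ : ℕ} [NeZero d₁] [NeZero d₂] [NeZero d₃] (hV : 10 ≤ V)
    (hκ : 40 ≤ κ) (hb : 1 ≤ b) (hCV : C ≤ V) (hsV : 7 ^ levels C d₁ d₂ d₃ * b ^ 2 ≤ V)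
    (hd : d₁ + d₂ + d₃ ≤ 6 ^ levels C d₁ d₂ d₃) (A : Matrix (Fin d₁) (Fin d₃) Bool)
    (B : Matrix (Fin d₃) (Fin d₂) Bool) :
    Rn (program C b) (initial A B).view
      (fun (ω : Coins d₁ d₂ d₃ (levels C d₁ d₂ d₃) b) M' =>
        ∀ (i : Fin d₁) (j : Fin d₂), M'.bit 2 (i * d₂ + j) = estimate A B ω i j)
      (6 ^ levels C d₁ d₂ d₃ * programCost C b) (V ^ κ) := by
  have hV2 : 2 ≤ V := by omega
  have hκ2 : 2 ≤ κ := by omega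
  have hs6 : levels C d₁ d₂ d₃ ≤ 6 ^ levels C d₁ d₂ d₃ := (Nat.lt_pow_self (by norm_num)).le
  have h61 : 1 ≤ 6 ^ levels C d₁ d₂ d₃ := Nat.one_le_pow _ _ (by norm_num)
  have hpar := tr_parameters (κ := κ) (C := C) (M := (initial A B).view) hV hκ hb (d₁ := d₁)
    (d₂ := d₂) (d₃ := d₃)
  generalize levels C d₁ d₂ d₃ = s at *
  have hb2 : b ≤ b ^ 2 := Nat.le_self_pow (by norm_num) b
  have h67 : 6 ^ s * b ^ 2 ≤ V :=
    (Nat.mul_le_mul_right _ (Nat.pow_le_pow_left (by norm_num) s)).trans hsV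
  have h6V : 6 ^ s ≤ V := six_pow_le hb h67 le_rfl
  have hmm : 2 ^ s * b * (2 ^ s * b) ≤ 6 ^ s * b ^ 2 := by
    rw [two_pow_mul_sq]
    exact Nat.mul_le_mul_right _ (Nat.pow_le_pow_left (by norm_num) s)
  have hm6 : 2 ^ s * b ≤ 6 ^ s * b := Nat.mul_le_mul_right _ (Nat.pow_le_pow_left (by norm_num) s)
  have hMle : (initial A B).view.Le V := by
    refine ⟨fun r => ?_, fun a i => Nat.zero_le _⟩
    simp only [State.view, initial]
    split_ifs <;> omega
  refine Rn.mono (Tr.seq_rn (hpar hMle rfl rfl rfl rfl hCV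
    ((Nat.mul_le_mul_left _ hb2).trans hsV) (hs6.trans h6V))
    (Q' := fun (ω : Coins d₁ d₂ d₃ s b) M' =>
        ∀ (i : Fin d₁) (j : Fin d₂), M'.bit 2 (i * d₂ + j) = estimate A B ω i j)
    (T' := 24 * ((2 ^ s * b + 1) + ((2 ^ s * b + 1) + (2 ^ s * b + 1))) +
      26 * (2 ^ s * b * (2 ^ s * b) + 1) + 6 ^ s * computeCost b) ?_) (fun _ _ h => h) ?_
  · rintro M ⟨a, m4, m5⟩
    have hdraw := rn_draws (d₁ := d₁) (d₂ := d₂) (d₃ := d₃) hV2 hκ2 a.le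
      (a.reg 0 (by norm_num)) (a.reg 1 (by norm_num)) (a.reg 2 (by norm_num)) m4 (hmm.trans h67)
    refine Rn.mono (Rn.seq_tr (hdraw.equiv (coinsEquiv d₁ d₂ d₃ s b)) ?_) (fun _ _ h => h)
      (T := _ + 6 ^ s * computeCost b) ?_
    · rintro ω M1 h
      refine Tr.mono (tr_compute (by omega) hκ hb h67 h.le (d₂ := d₂) (d₃ := d₃)
        ((h.reg 1 (by norm_num)).trans (a.reg 1 (by norm_num)))
        ((h.reg 2 (by norm_num)).trans (a.reg 2 (by norm_num)))
        ((h.reg 4 (by norm_num)).trans m4) ((h.reg 5 (by norm_num)).trans m5)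
        ((h.bit 2 (by norm_num)).trans (congrFun a.bit 2))) ?_ le_rfl
      intro M2 hM2 i j
      rw [Bool.eq_iff_iff, hM2, h.bit 0 (by norm_num), h.bit 1 (by norm_num), a.bit]
      refine estimate_eq_true_iff A B ω (w₀ := M1.word 0) (w₁ := M1.word 1) (w₂ := M1.word 2)
        (D := M1.bit 3) ?_ ?_ ?_ ?_ i j
      · intro x
        simp [h.word₀, coinsEquiv]
      · intro x
        simp [h.word₁, coinsEquiv]
      · intro x
        simp [h.word₂, coinsEquiv]
      · intro z y
        have hlt : (encode b s z * (2 ^ s * b) + encode b s y : ℕ) < 2 ^ s * b * (2 ^ s * b) := by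
          nlinarith [(encode b s z).2, (encode b s y).2]
        have e : (⟨encode b s z * (2 ^ s * b) + encode b s y, hlt⟩ :
            Fin (2 ^ s * b * (2 ^ s * b))) = finProdFinEquiv (encode b s z, encode b s y) := by
          ext
          simp [finProdFinEquiv]
          ring
        rw [h.bits, dif_pos hlt, e]
        simp [coinsEquiv]
    · omega
  · have key : ∀ n m N B C d p s : ℕ, 1 ≤ n → m ≤ n * b → N ≤ n * B → d ≤ n → s ≤ n →
        (d + C) * 60 + s * 20 + 60 + (24 * ((m + 1) + ((m + 1) + (m + 1))) + 26 * (N + 1) + n * p) ≤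
          n * (60 * C + 140 + 72 * (b + 1) + 26 * (B + 1) + p) := by
      intro n m N B C d p s hn hm hN hd hs
      have : C ≤ n * C := Nat.le_mul_of_pos_left C hn
      nlinarith
    exact key _ _ _ _ _ _ _ _ h61 hm6 hmm hd hs6

/-! ### Numerical bounds in terms of `ψ₃` -/

lemma one_lt_prod_of_sum_le {d₁ d₂ d₃ : ℕ} [NeZero d₁] [NeZero d₂] [NeZero d₃]
    (h : (d₁ + d₂ + d₃ : ℝ) ≤ (d₁ * d₂ * d₃ : ℝ) ^ (0.345 : ℝ)) : 2 ≤ d₁ * d₂ * d₃ := by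
  have h1 := NeZero.one_le (n := d₁)
  have h2 := NeZero.one_le (n := d₂)
  have h3 := NeZero.one_le (n := d₃)
  by_contra hn
  have h4 : d₁ * d₂ * d₃ = 1 := by
    have : 0 < d₁ * d₂ * d₃ := by positivity
    omega
  have h5 : (d₁ * d₂ * d₃ : ℝ) = 1 := mod_cast h4
  rw [h5, Real.one_rpow] at h
  have : d₁ + d₂ + d₃ ≤ 1 := mod_cast h
  omega

/-- `ψ₃ ^ 0.345` is at most the square root of `7 ^ s`, and `7 ≤ 6 ^ 2`. -/
lemma sum_le_six_pow {s d₁ d₂ d₃ : ℕ} (hs : d₁ * d₂ * d₃ ≤ 7 ^ s)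
    (h : (d₁ + d₂ + d₃ : ℝ) ≤ (d₁ * d₂ * d₃ : ℝ) ^ (0.345 : ℝ)) : d₁ + d₂ + d₃ ≤ 6 ^ s := by
  have h1 : (d₁ * d₂ * d₃ : ℝ) ≤ 7 ^ s := mod_cast hs
  have h2 : (1 : ℝ) ≤ 7 ^ s := one_le_pow₀ (by norm_num)
  have h3 : (d₁ * d₂ * d₃ : ℝ) ^ (0.345 : ℝ) ≤ 6 ^ s := by
    calc (d₁ * d₂ * d₃ : ℝ) ^ (0.345 : ℝ) ≤ ((7 : ℝ) ^ s) ^ (0.345 : ℝ) :=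
          Real.rpow_le_rpow (by positivity) h1 (by norm_num)
      _ ≤ ((7 : ℝ) ^ s) ^ (1 / 2 : ℝ) := Real.rpow_le_rpow_of_exponent_le h2 (by norm_num)
      _ = √(7 ^ s) := (Real.sqrt_eq_rpow _).symm
      _ ≤ 6 ^ s := by
        refine Real.sqrt_le_iff.mpr ⟨by positivity, ?_⟩
        rw [← pow_mul, mul_comm, pow_mul]
        exact pow_le_pow_left₀ (by norm_num) (by norm_num) s
  exact_mod_cast h.trans h3

/-- In `7 ^ s ≤ 7 C ψ₃ s` the last factor is replaced crudely by `2 ^ s`; then `log (7 / 2) ≥ 1`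
suffices. The constant `log (7 C)` is absorbed because `log ψ₃ ≥ log 2`. -/
lemma levels_le_log {C d₁ d₂ d₃ : ℕ} (hC : 1 ≤ C) (h : 2 ≤ d₁ * d₂ * d₃) :
    (levels C d₁ d₂ d₃ : ℝ) ≤
      (Real.log (7 * C) / Real.log 2 + 1) * Real.log (d₁ * d₂ * d₃) := by
  set s := levels C d₁ d₂ d₃ with hs
  have hC0 : (0 : ℝ) < C := by exact_mod_cast hC
  have hn2 : (2 : ℝ) ≤ d₁ * d₂ * d₃ := mod_cast h
  have h1 : 7 ^ s ≤ 7 * (C * (d₁ * d₂ * d₃)) * 2 ^ s :=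
    (pow_levels_le C d₁ d₂ d₃ (h.trans (Nat.le_mul_of_pos_left _ hC))).trans
      (Nat.mul_le_mul_left _ Nat.lt_two_pow_self.le)
  have h2 : (7 : ℝ) ^ s ≤ 7 * C * (d₁ * d₂ * d₃) * 2 ^ s := by
    have : (7 : ℝ) ^ s ≤ 7 * (C * (d₁ * d₂ * d₃)) * 2 ^ s := mod_cast h1
    linarith
  have h3 : (7 / 2 : ℝ) ^ s ≤ 7 * C * (d₁ * d₂ * d₃) := by
    rw [div_pow, div_le_iff₀ (by positivity)]
    exact h2
  have h4 := Real.log_le_log (by positivity) h3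
  rw [Real.log_pow, Real.log_mul (by positivity) (by linarith)] at h4
  have h5 : 1 ≤ Real.log (7 / 2) := by
    rw [Real.le_log_iff_exp_le (by norm_num)]
    linarith [Real.exp_one_lt_d9]
  have h6 : 0 < Real.log 2 := Real.log_pos (by norm_num)
  have h7 := Real.log_le_log (by norm_num) hn2
  have h8 : 0 ≤ Real.log (7 * C) := Real.log_nonneg (by
    have : (1 : ℝ) ≤ C := mod_cast hC
    linarith)
  have h9 : Real.log (7 * C) ≤ Real.log (7 * C) / Real.log 2 * Real.log (d₁ * d₂ * d₃) := by
    rw [div_mul_eq_mul_div, le_div_iff₀ h6]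
    exact mul_le_mul_of_nonneg_left h7 h8
  have h10 : (s : ℝ) ≤ s * Real.log (7 / 2) := le_mul_of_one_le_right (Nat.cast_nonneg _) h5
  rw [add_mul, one_mul]
  linarith

/-- Inserting the logarithmic bound for `s` into `7 ^ s ≤ 7 C ψ₃ s` gives the order `ψ₃ log ψ₃`;
then `6 ^ s = (7 ^ s) ^ (log 6 / log 7)`. -/
lemma six_pow_levels_le {C d₁ d₂ d₃ : ℕ} (hC : 1 ≤ C) (h : 2 ≤ d₁ * d₂ * d₃) :
    (6 : ℝ) ^ levels C d₁ d₂ d₃ ≤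
      (7 * C * (Real.log (7 * C) / Real.log 2 + 1)) ^ (Real.log 6 / Real.log 7) *
        (d₁ * d₂ * d₃ * Real.log (d₁ * d₂ * d₃)) ^ (Real.log 6 / Real.log 7) := by
  have h1 := levels_le_log hC h
  have h2 := pow_levels_le C d₁ d₂ d₃ (h.trans (Nat.le_mul_of_pos_left _ hC))
  set s := levels C d₁ d₂ d₃ with hs
  have hn2 : (2 : ℝ) ≤ d₁ * d₂ * d₃ := mod_cast h
  have hC1 : (1 : ℝ) ≤ C := mod_cast hC
  have h6 : 0 < Real.log 2 := Real.log_pos (by norm_num)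
  have h8 : 0 ≤ Real.log (7 * C) := Real.log_nonneg (by linarith)
  have h9 : 0 ≤ Real.log (d₁ * d₂ * d₃) := Real.log_nonneg (by linarith)
  have h7 : 0 < Real.log 7 := Real.log_pos (by norm_num)
  have h3 : (7 : ℝ) ^ s ≤ 7 * (C * (d₁ * d₂ * d₃)) * s := mod_cast h2
  have h4 : (7 : ℝ) ^ s ≤ 7 * C * (Real.log (7 * C) / Real.log 2 + 1) *
      (d₁ * d₂ * d₃ * Real.log (d₁ * d₂ * d₃)) :=
    h3.trans ((mul_le_mul_of_nonneg_left h1 (by positivity)).trans_eq (by ring))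
  have h5 : (6 : ℝ) ^ s = ((7 : ℝ) ^ s) ^ (Real.log 6 / Real.log 7) := by
    rw [← Real.rpow_natCast 7 s, ← Real.rpow_mul (by norm_num), mul_comm,
      Real.rpow_mul (by norm_num), Real.rpow_natCast]
    congr 1
    rw [Real.rpow_def_of_pos (by norm_num), mul_div_cancel₀ _ h7.ne', Real.exp_log (by norm_num)]
  rw [h5, ← Real.mul_rpow (by positivity) (by positivity)]
  exact Real.rpow_le_rpow (by positivity) h4 (by positivity)

/-- As `ψ₃ ≥ 2`, a constant factor `a` is at most `2 ^ a ≤ ψ₃ ^ a` and moves into the exponent. -/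
lemma bound_le_pow {C b d₁ d₂ d₃ : ℕ} [NeZero d₁] [NeZero d₂] [NeZero d₃] (hC : 1 ≤ C)
    (h : 2 ≤ d₁ * d₂ * d₃) : 7 ^ levels C d₁ d₂ d₃ * b ^ 2 + C + 10 ≤
      (d₁ * d₂ * d₃) ^ (7 * C * (3 + C) * b ^ 2 + C + 10 + 2) := by
  have h1 := pow_levels_le C d₁ d₂ d₃ (h.trans (Nat.le_mul_of_pos_left _ hC))
  have h2 : levels C d₁ d₂ d₃ ≤ d₁ + d₂ + d₃ + C := growExp_le _ _
  have p1 := NeZero.one_le (n := d₁)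
  have p2 := NeZero.one_le (n := d₂)
  have p3 := NeZero.one_le (n := d₃)
  set n := d₁ * d₂ * d₃ with hn
  have q1 : d₁ ≤ n := by
    rw [hn, mul_assoc]; exact Nat.le_mul_of_pos_right _ (by positivity)
  have q2 : d₂ ≤ n := by
    rw [hn]; exact (Nat.le_mul_of_pos_left _ p1).trans (Nat.le_mul_of_pos_right _ p3)
  have q3 : d₃ ≤ n := Nat.le_mul_of_pos_left _ (by positivity)
  have h3 : levels C d₁ d₂ d₃ ≤ (3 + C) * n := by nlinarith
  have h4 : 7 ^ levels C d₁ d₂ d₃ ≤ 7 * C * (3 + C) * n ^ 2 :=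
    (h1.trans (Nat.mul_le_mul_left _ h3)).trans_eq (by ring)
  have h5 : 1 ≤ n ^ 2 := Nat.one_le_pow _ _ (by omega)
  calc 7 ^ levels C d₁ d₂ d₃ * b ^ 2 + C + 10
      ≤ 7 * C * (3 + C) * n ^ 2 * b ^ 2 + C * n ^ 2 + 10 * n ^ 2 := by
        have := Nat.mul_le_mul_right (b ^ 2) h4
        have := Nat.le_mul_of_pos_right C h5
        omega
    _ = (7 * C * (3 + C) * b ^ 2 + C + 10) * n ^ 2 := by ring
    _ ≤ n ^ (7 * C * (3 + C) * b ^ 2 + C + 10) * n ^ 2 :=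
        Nat.mul_le_mul_right _ (Nat.lt_two_pow_self.le.trans (Nat.pow_le_pow_left h _))
    _ = _ := (pow_add _ _ _).symm

end BMM

/-! ### The main theorem -/

theorem mainTheorem2 (b : ℕ) (hb : 1 ≤ b) (c : ℝ) (hc : 0 < c) :
    ∃ (s : ℕ → ℕ → ℕ → ℕ) (P : BMM.Program) (K : ℝ) (κ : ℕ),
      ∀ (d₁ d₂ d₃ : ℕ) [NeZero d₁] [NeZero d₂] [NeZero d₃] (ψ₁ ψ₂ ψ₃ : ℝ),
        ψ₁ = d₁ + d₂ + d₃ →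
        ψ₂ = d₁ * d₂ + d₁ * d₃ + d₂ * d₃ →
        ψ₃ = d₁ * d₂ * d₃ →
        ψ₁ ≤ ψ₃ ^ (0.345 : ℝ) →
        ψ₂ ≤ ψ₃ ^ (0.681 : ℝ) →
        ∀ (A : Matrix (Fin d₁) (Fin d₃) Bool) (B : Matrix (Fin d₃) (Fin d₂) Bool),
          -- the algorithm is correct with probability at least `1 - ψ₃ ^ (-c)`
          1 - ψ₃ ^ (-c) ≤
            (BMM.algorithmLaw (s d₁ d₂ d₃) b A B (BMM.boolMul A B)).toReal ∧
          -- the program `P` carries out the algorithm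
          (P.run (BMM.initial A B)).map (BMM.output d₁ d₂) =
            BMM.algorithmLaw (s d₁ d₂ d₃) b A B ∧
          -- in every run, `P` obeys the time bound, with words of `O(log ψ₃)` bits
          ∀ σ ∈ (P.run (BMM.initial A B)).support,
            (σ.time : ℝ) ≤ K * (ψ₃ * Real.log ψ₃) ^ (Real.log 6 / Real.log 7) ∧
            (σ.peak : ℝ) ≤ ψ₃ ^ κ := by
  obtain ⟨C, hC⟩ := exists_nat_ge
    (max 1 ((6000 * (8 * (c + 1)) * (b : ℝ) ^ 2) ^ 3 + 6 * (8 * (c + 1))))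
  have hC1 : 1 ≤ C := by exact_mod_cast (le_max_left _ _).trans hC
  refine ⟨BMM.levels C, BMM.program C b,
    (7 * C * (Real.log (7 * C) / Real.log 2 + 1)) ^ (Real.log 6 / Real.log 7) *
      -- `40` bounds the number of leaves of the integer expressions in the program, hence the power
      -- of `V` that intermediate values can reach.
      BMM.programCost C b, (7 * C * (3 + C) * b ^ 2 + C + 10 + 2) * 40, ?_⟩
  rintro d₁ d₂ d₃ _ _ _ ψ₁ ψ₂ ψ₃ rfl rfl rfl h₁ h₂ A B
  have hn := BMM.one_lt_prod_of_sum_le h₁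
  have hn' : (1 : ℝ) < d₁ * d₂ * d₃ := by
    have : (2 : ℝ) ≤ d₁ * d₂ * d₃ := mod_cast hn
    linarith
  have hs := BMM.levels_spec C d₁ d₂ d₃
  have hns : d₁ * d₂ * d₃ ≤ 7 ^ BMM.levels C d₁ d₂ d₃ :=
    ((Nat.le_mul_of_pos_left _ hC1).trans (Nat.le_mul_of_pos_right _ (Nat.succ_pos _))).trans hs
  -- This `V` bounds every stored value: `7 ^ s` from the search, the array sizes, and the constants
  -- of the program.
  obtain ⟨g, hg, hb'⟩ := BMM.rn_program
    (V := 7 ^ BMM.levels C d₁ d₂ d₃ * b ^ 2 + C + 10) (κ := 40) (by omega) le_rfl hb (by omega)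
    (by omega) (BMM.sum_le_six_pow hns h₁) A B (BMM.initial A B) rfl
  refine ⟨BMM.one_sub_rpow_le_algorithmLaw hc hb ((le_max_right _ _).trans hC) hs rfl rfl rfl hn'
    h₁ h₂ A B, ?_, ?_⟩
  · rw [hg, PMF.map_comp, BMM.algorithmLaw]
    congr 1
    funext ω i j
    exact (hb' ω).1 i j
  · intro σ hσ
    rw [hg, PMF.mem_support_map_iff] at hσ
    obtain ⟨ω, -, rfl⟩ := hσ
    obtain ⟨-, ht, hp⟩ := hb' ω
    constructor
    · have h3 : (g ω).time ≤ 6 ^ BMM.levels C d₁ d₂ d₃ * BMM.programCost C b := by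
        simpa [BMM.initial] using ht
      have h4 : ((g ω).time : ℝ) ≤ 6 ^ BMM.levels C d₁ d₂ d₃ * BMM.programCost C b := mod_cast h3
      refine h4.trans ((mul_le_mul_of_nonneg_right (BMM.six_pow_levels_le hC1 hn)
        (Nat.cast_nonneg _)).trans_eq ?_)
      ring
    · have h3 : (g ω).peak ≤ (7 ^ BMM.levels C d₁ d₂ d₃ * b ^ 2 + C + 10) ^ 40 := by
        simpa [BMM.initial] using hp
      have h4 := h3.trans (Nat.pow_le_pow_left (BMM.bound_le_pow (b := b) hC1 hn) 40)
      rw [← pow_mul] at h4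
      exact_mod_cast h4
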